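/- All structures are countable. A semigroup is completely simple if it has no proper (two-sided) ideals and contains an idempotent $e$ which is minimal among idempotents (for every idempotent $f$, $ef=fe=f$ implies $f=e$). In such a semigroup every $x$ has a unique relative inverse (its inverse in the maximal subgroup containing it), and $S$ is regarded as a unary semigroup with this operation; $S$ is homogeneous if every isomorphism between finitely generated unary subsemigroups (subsemigroups closed under relative inverses) of $S$ extends to an automorphism of $S$. A group is homogeneous if every isomorphism between finitely generated subgroups extends to an automorphism. For a group $G$ with identity $\epsilon$, non-empty sets $I,\Lambda$ and a $\Lambda\times I$ matrix $P=(p_{\lambda,i})$ over $G$, $\mathcal M[G;I,\Lambda;P]$ is the set $I\times G\times\Lambda$ with multiplication $(i,g,\lambda)(j,h,\mu)=(i,g\,p_{\lambda,j}\,h,\mu)$. It is normalised if, for some fixed $1_\Lambda\in\Lambda$ and $1_I\in I$, $p_{1_\Lambda,i}=\epsilon=p_{\lambda,1_I}$ for all $i\in I,\lambda\in\Lambda$. Put $G^P=\{p_{\lambda,i}:\lambda\in\Lambda,i\in I\}$, let $P'$ be the submatrix of $P$ on $(\Lambda\setminus\{1_\Lambda\})\times(I\setminus\{1_I\})$, and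 let $\Gamma(S)$ be the complete bipartite graph with left set $\Lambda\setminus\{1_\Lambda\}$ and right set $I\setminus\{1_I\}$ in which the edge $(\lambda,i)$ has colour $p_{\lambda,i}$; it is $C$-edge-coloured if $C$ is the set of colours that occur. A set of edges is a perfect matching if each vertex is incident to exactly one of them. For a set $C$, a bipartite graph with left set $L$, right set $R$ and colouring $F:L\times R\to C$ is $C$-generic if $|L|=|R|=\aleph_0$, for every map $\alpha$ from a finite subset of $L$ to $C$ there is $x\in R$ with $F(y,x)=\alpha(y)$ for all $y\in\operatorname{dom}\alpha$, and dually with $L$ and $R$ interchanged. A rectangular band is a set $I\times\Lambda$ ($I,\Lambda$ non-empty) with multiplication $(i,\lambda)(j,\mu)=(i,\mu)$. The age of a structure is the class of finitely generated structures (groups, respectively completely simple semigroups) that embed in it. **Theorem.** Let $S$ be a countable completely simple semigroup. Then $S$ is homogeneous if and only if there exist a countable homogeneous group $G$ and a characteristic subgroup $H$ of $G$ such that, up to isomorphism, one of the following holds (all Rees matrix semigroups being normalised): 1. $S=G\times B$ for some rectangular band $B$; 2. $S=\mathcal M[G;\{1,2\},\{1,2\};P]$, where $H=\{\epsilon,a\}\cong\mathbb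 Z_2$ and $P'=(a)$; 3. $S=\mathcal M[G;\{1,2,3\},\{1,2,3\};P]$, where $H=\{\epsilon,a,a^{-1}\}\cong\mathbb Z_3$ and $\Gamma(S)$ is $\{a,a^{-1}\}$-edge-coloured, the edges of colour $a$ forming a perfect matching; 4. $S=\mathcal M[G;\{1,2,3,4\},\{1,2,3,4\};P]$, where $H=\{\epsilon,a\}\cong\mathbb Z_2$ and $\Gamma(S)$ is $\{\epsilon,a\}$-edge-coloured, the edges of colour $\epsilon$ forming a perfect matching; 5. $S=\mathcal M[G;I,\Lambda;P]$ with $G^P=H$ and $\Gamma(S)$ being $H$-generic. Moreover, for every countable homogeneous group $G$ with characteristic subgroup $H$, $S$ is as in (5) if and only if $S$ is the Fraïssé limit of $\mathcal{CS}(G;H)$, that is, $S$ is a countable homogeneous completely simple semigroup whose age is $\mathcal{CS}(G;H)$. Here $\mathcal{CS}(G;H)$ is the class of all finitely generated completely simple semigroups isomorphic to a normalised Rees matrix semigroup $\mathcal M[K;J,M;Q]$ with $K$ in the age of $G$ and the subgroup $\langle K^Q\rangle$ generated by the entries of $Q$ in the age of $H$. -/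

import Mathlib

universe u v w

section CompletelySimple

variable {S : Type u} [Semigroup S]

/-- A (two-sided) ideal of a semigroup: a non-empty subset absorbing multiplication on both sides. -/
def IsSemigroupIdeal (J : Set S) : Prop :=
  J.Nonempty ∧ ∀ a ∈ J, ∀ s : S, s * a ∈ J ∧ a * s ∈ J

variable (S) in
/-- A semigroup is completely simple if it has no proper ideals and it contains an idempotent `e`
that is minimal for the natural order on idempotents. -/
def IsCompletelySimple : Prop :=
  (∀ J : Set S, IsSemigroupIdeal J → J = Set.univ) ∧
    ∃ e : S, IsIdempotentElem e ∧
      ∀ f : S, IsIdempotentElem f → e * f = f → f * e = f → f = e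

/-- `y` is the relative inverse of `x`, that is, the inverse of `x` in the maximal subgroup
containing `x`. It is unique when it exists; in a completely simple semigroup it always exists,
and `x ↦ y` is the basic unary operation. -/
def IsRelativeInverse (x y : S) : Prop :=
  x * y * x = x ∧ y * x * y = y ∧ x * y = y * x

/-- The substructures for the unary semigroup signature: subsemigroups closed under
relative inverses. -/
def IsUnarySubsemigroup (T : Subsemigroup S) : Prop :=
  ∀ x ∈ T, ∀ y : S, IsRelativeInverse x y → y ∈ T

/-- The unary subsemigroup generated by a set. -/
def unaryClosure (X : Set S) : Subsemigroup S :=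
  sInf {T : Subsemigroup S | X ⊆ (T : Set S) ∧ IsUnarySubsemigroup T}

/-- `T` is a finitely generated unary subsemigroup. -/
def IsFGUnary (T : Subsemigroup S) : Prop :=
  ∃ X : Set S, X.Finite ∧ unaryClosure X = T

variable (S) in
/-- Homogeneity as a unary semigroup: every isomorphism between finitely generated unary
subsemigroups extends to an automorphism. (A multiplicative isomorphism automatically preserves
relative inverses.) -/
def IsHomogeneousSemigroup : Prop :=
  ∀ A B : Subsemigroup S, IsFGUnary A → IsFGUnary B → ∀ φ : A ≃* B,
    ∃ ψ : S ≃* S, ∀ a : A, ψ (a : S) = (φ a : S)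

/-- `T` belongs to the age of `S`: it is a finitely generated completely simple semigroup which
embeds in `S`. -/
def InSemigroupAge (T : Type v) [Semigroup T] (S : Type u) [Semigroup S] : Prop :=
  IsCompletelySimple T ∧ IsFGUnary (⊤ : Subsemigroup T) ∧
    ∃ f : T →ₙ* S, Function.Injective f

end CompletelySimple

section Groups

/-- A group is homogeneous if every isomorphism between finitely generated subgroups extends to
an automorphism. -/
def IsHomogeneousGroup (G : Type u) [Group G] : Prop :=
  ∀ A B : Subgroup G, A.FG → B.FG → ∀ φ : A ≃* B,
    ∃ ψ : G ≃* G, ∀ a : A, ψ (a : G) = (φ a : G)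

/-- The group `K` belongs to the age of `G`: it is finitely generated and embeds in `G`. -/
def InGroupAge (K : Type v) [Group K] (G : Type u) [Group G] : Prop :=
  Group.FG K ∧ ∃ f : K →* G, Function.Injective f

end Groups

section RectangularBand

/-- The rectangular band on `I × Λ`, with multiplication `(i, l) (j, m) = (i, m)`. -/
@[ext]
structure RectangularBand (I : Type u) (Λ : Type v) where
  fst : I
  snd : Λ

instance (I : Type u) (Λ : Type v) : Semigroup (RectangularBand I Λ) where
  mul a b := ⟨a.fst, b.snd⟩
  mul_assoc _ _ _ := rfl

end RectangularBand

section ReesMatrix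

variable {G : Type u} {I : Type v} {Λ : Type w}

/-- The Rees matrix semigroup `M[G; I, Λ; P]`: triples `(i, g, l)` with multiplication
`(i, g, l) (j, h, m) = (i, g * P l j * h, m)`. -/
@[ext]
structure ReesMatrix (P : Matrix Λ I G) where
  left : I
  elt : G
  right : Λ

instance [Group G] (P : Matrix Λ I G) : Semigroup (ReesMatrix P) where
  mul a b := ⟨a.left, a.elt * P a.right b.left * b.elt, b.right⟩
  mul_assoc a b c := by
    refine ReesMatrix.ext rfl ?_ rfl
    change a.elt * P a.right b.left * b.elt * P b.right c.left * c.elt =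
      a.elt * P a.right b.left * (b.elt * P b.right c.left * c.elt)
    simp only [mul_assoc]

/-- `P` is normalised along row `l₀` and column `i₀`. -/
def IsNormalised [Group G] (P : Matrix Λ I G) (l₀ : Λ) (i₀ : I) : Prop :=
  (∀ i, P l₀ i = 1) ∧ ∀ l, P l i₀ = 1

/-- The set `G^P` of entries of `P`. -/
def entrySet (P : Matrix Λ I G) : Set G :=
  {g | ∃ l i, P l i = g}

/-- The colouring function of the edge-coloured bipartite graph `Γ(S)` induced by
`S = M[G; I, Λ; P]` normalised along row `l₀` and column `i₀`. The left set is `Λ \ {l₀}`, the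
right set is `I \ {i₀}`, and the edge `(l, i)` has colour `P l i`. -/
def inducedColouring (P : Matrix Λ I G) (l₀ : Λ) (i₀ : I) :
    {l : Λ // l ≠ l₀} → {i : I // i ≠ i₀} → G :=
  fun l i => P l i

end ReesMatrix

section Bipartite

variable {L : Type u} {R : Type v} {X : Type w}

/-- The set of colours occurring in an edge-coloured (complete) bipartite graph. -/
def colourSet (F : L → R → X) : Set X :=
  {c | ∃ l r, F l r = c}

/-- The edges of colour `c` form a perfect matching: each vertex is incident to exactly one
edge of that colour. -/
def IsColourPerfectMatching (F : L → R → X) (c : X) : Prop :=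
  (∀ l, ∃! r, F l r = c) ∧ ∀ r, ∃! l, F l r = c

/-- The edge-coloured bipartite graph with left set `L`, right set `R` and colouring `F` is
`C`-generic. -/
def IsColourGeneric (C : Set X) (F : L → R → X) : Prop :=
  (∀ l r, F l r ∈ C) ∧
  Cardinal.mk L = Cardinal.aleph0 ∧ Cardinal.mk R = Cardinal.aleph0 ∧
  (∀ (s : Finset L) (α : s → C), ∃ r : R, ∀ y : s, F y r = α y) ∧
  (∀ (s : Finset R) (α : s → C), ∃ l : L, ∀ y : s, F l y = α y)

end Bipartite

section Classification

/-- The class `CS(G; H)`: finitely generated completely simple semigroups isomorphic to a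
normalised Rees matrix semigroup `M[K; J, M; Q]` with `K` in the age of `G` and the subgroup
generated by the entries of `Q` in the age of `H`. -/
def InCS (G : Type u) [Group G] (H : Subgroup G) (T : Type u) [Semigroup T] : Prop :=
  IsCompletelySimple T ∧ IsFGUnary (⊤ : Subsemigroup T) ∧
    ∃ (K : Type u) (_ : Group K) (J M : Type u) (Q : Matrix M J K) (m₀ : M) (j₀ : J),
      IsNormalised Q m₀ j₀ ∧ InGroupAge K G ∧
      InGroupAge (Subgroup.closure (entrySet Q)) H ∧ Nonempty (T ≃* ReesMatrix Q)

/-- `S` is the Fraïssé limit of `CS(G; H)`: a countable homogeneous completely simple semigroup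
whose age is `CS(G; H)`. -/
def IsFraisseLimitCS (S : Type u) [Semigroup S] (G : Type u) [Group G] (H : Subgroup G) : Prop :=
  Countable S ∧ IsCompletelySimple S ∧ IsHomogeneousSemigroup S ∧
    ∀ (T : Type u) [Semigroup T], InSemigroupAge T S ↔ InCS G H T

variable (S : Type u) [Semigroup S] (G : Type u) [Group G] (H : Subgroup G)

/-- `S` is the direct product of `G` and a rectangular band. -/
def IsRectangularGroupOver : Prop :=
  ∃ I Λ : Type u, Nonempty I ∧ Nonempty Λ ∧ Nonempty (S ≃* G × RectangularBand I Λ)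

/-- `S = M[G; 2, 2; P]` with `P` normalised, `H = {1, a} ≅ ℤ₂` and `P' = (a)`. -/
def IsReesTypeTwo : Prop :=
  ∃ (P : Matrix (Fin 2) (Fin 2) G) (a : G),
    IsNormalised P 0 0 ∧ Nonempty (S ≃* ReesMatrix P) ∧
    (H : Set G) = {1, a} ∧ Nonempty (H ≃* Multiplicative (ZMod 2)) ∧
    P 1 1 = a

/-- `S = M[G; 3, 3; P]` with `P` normalised, `H = {1, a, a⁻¹} ≅ ℤ₃`, and `Γ(S)` is
`{a, a⁻¹}`-edge-coloured, the edges of colour `a` forming a perfect matching. -/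
def IsReesTypeThree : Prop :=
  ∃ (P : Matrix (Fin 3) (Fin 3) G) (a : G),
    IsNormalised P 0 0 ∧ Nonempty (S ≃* ReesMatrix P) ∧
    (H : Set G) = {1, a, a⁻¹} ∧ Nonempty (H ≃* Multiplicative (ZMod 3)) ∧
    colourSet (inducedColouring P 0 0) = {a, a⁻¹} ∧
    IsColourPerfectMatching (inducedColouring P 0 0) a

/-- `S = M[G; 4, 4; P]` with `P` normalised, `H = {1, a} ≅ ℤ₂`, and `Γ(S)` is
`{1, a}`-edge-coloured, the edges of colour `1` forming a perfect matching. -/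
def IsReesTypeFour : Prop :=
  ∃ (P : Matrix (Fin 4) (Fin 4) G) (a : G),
    IsNormalised P 0 0 ∧ Nonempty (S ≃* ReesMatrix P) ∧
    (H : Set G) = {1, a} ∧ Nonempty (H ≃* Multiplicative (ZMod 2)) ∧
    colourSet (inducedColouring P 0 0) = {1, a} ∧
    IsColourPerfectMatching (inducedColouring P 0 0) 1

/-- `S = M[G; I, Λ; P]` with `P` normalised, `G^P = H` and `Γ(S)` being `H`-generic. -/
def IsReesGeneric : Prop :=
  ∃ (I Λ : Type u) (P : Matrix Λ I G) (l₀ : Λ) (i₀ : I),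
    IsNormalised P l₀ i₀ ∧ Nonempty (S ≃* ReesMatrix P) ∧
    entrySet P = (H : Set G) ∧
    IsColourGeneric (H : Set G) (inducedColouring P l₀ i₀)

end Classification

/-!
The proof turns homogeneity of a completely simple semigroup into a statement about its sandwich
matrix. By the Rees theorem (`IsCompletelySimple.exists_reesMatrix`) such a semigroup is a Rees
matrix semigroup `M[G; I, Λ; P]` with `P` normalised, that is, with trivial base row and base column.
Embeddings that respect the base idempotents act coordinatewise (`ReesMatrix.exists_coordinates`),
and any idempotent becomes the base idempotent after renormalising `P` (`ReesMatrix.rebase`).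
Finitely generated unary subsemigroups are, up to renormalisation, blocks given by finitely many
rows and columns and a finitely generated subgroup of `G` (`ReesMatrix.exists_eq_block`).
Consequently `M[G; I, Λ; P]` is homogeneous as soon as `G` is homogeneous and all finite partial
isomorphisms between the `G`-coloured bipartite graphs of the renormalisations of `P` extend
(`ReesMatrix.isHomogeneousSemigroup`).

For the classification, homogeneity is applied to blocks with trivial matrix, in particular to those
with a single column or a single row, which impose no condition on the entries of `P`. This yields
the homogeneity of `G` and the symmetries collected in `RowSymmetric`, for `P` and for its dual:
finite restrictions of columns are closed under permutations of the rows, the base row included,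
and under quotients, and the entries of a column occur equally often. Therefore the entries form a
characteristic subgroup `H`, each row and each column off the base takes all values in `H`, and for
nontrivial `P` there are two cases.
* If no entry off the base row and column is trivial, then rows and columns off the base are
  bijections onto `H`. Three such rows are impossible, since different permutations of them would
  produce the same column (`RowSymmetric.not_three_rows`); so `H` has two or three elements.
* Otherwise there are at least three rows off the base row, and any assignment of elements of `H` to
  finitely many, but not all, of them is realised by a column (`RowSymmetric.exists_column`), because
  quotients of columns provide the assignments supported in a single row. For infinite `Λ` this is
  genericity. For finite `Λ` it gives a column with exactly two trivial entries and a prescribed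
  nontrivial value elsewhere; comparing the sizes of fibres leaves `|H| = 2` and `|Λ| = 4`
  (`RowSymmetric.of_finite`).

Conversely, in the types with a finite nontrivial matrix all renormalisations of one explicit matrix
are perfect matchings, a finite verification in `ℤ/2` or `ℤ/3`, and finite partial isomorphisms of
perfect matchings extend (`IsMatching.extendsPartialIsos`). Genericity is preserved under
renormalisation, and partial isomorphisms of countable generic graphs extend by back and forth
(`IsGenericMatrix.extendsPartialIsos`).

A generic matrix embeds all finite normalised matrices over `H`, which determines the age of the
semigroup (`IsReesGeneric.inSemigroupAge_iff`); an arbitrary embedding of the group generated by the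
entries is moved into `H` by homogeneity of `G` and invariance of `H`. Conversely, the structure
group of a Fraïssé limit of `CS(G; H)` is a countable homogeneous group with the age of `G`, hence
isomorphic to `G` (`IsHomogeneousGroup.nonempty_mulEquiv`), and the embeddability of all finite
matrices over `H` together with homogeneity makes the sandwich matrix generic
(`IsGenericMatrix.of_age`).
-/

/-! ### Relative inverses and generated unary subsemigroups -/

section RelativeInverse

variable {S : Type*} [Semigroup S] {T : Type*} [Semigroup T]

theorem IsRelativeInverse.unique {x y z : S} (hy : IsRelativeInverse x y)
    (hz : IsRelativeInverse x z) : y = z := by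
  obtain ⟨h1, h2, h3⟩ := hy
  obtain ⟨k1, k2, k3⟩ := hz
  have h : x * y = x * z := by
    calc x * y = x * z * x * y := by rw [k1]
      _ = z * x * (x * y) := by rw [k3, mul_assoc]
      _ = z * (x * y * x) := by rw [mul_assoc x y x, ← h3, mul_assoc]
      _ = x * z := by rw [h1, k3]
  calc y = y * (x * y) := by rw [← mul_assoc, h2]
    _ = y * x * z := by rw [h, mul_assoc]
    _ = z * x * z := by rw [← h3, h, k3]
    _ = z := k2

theorem IsRelativeInverse.map (f : S →ₙ* T) {x y : S} (h : IsRelativeInverse x y) :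
    IsRelativeInverse (f x) (f y) := by
  refine ⟨?_, ?_, ?_⟩
  · rw [← map_mul, ← map_mul, h.1]
  · rw [← map_mul, ← map_mul, h.2.1]
  · rw [← map_mul, ← map_mul, h.2.2]

variable (S) in
/-- Every element has a relative inverse, that is, the semigroup is completely regular. -/
def HasRelativeInverses : Prop := ∀ x : S, ∃ y, IsRelativeInverse x y

theorem HasRelativeInverses.of_equiv (h : HasRelativeInverses S) (e : S ≃* T) :
    HasRelativeInverses T := fun x => by
  obtain ⟨y, hy⟩ := h (e.symm x)
  refine ⟨e y, ?_⟩
  simpa using hy.map (e : S →ₙ* T)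

theorem subset_unaryClosure (X : Set S) : X ⊆ (unaryClosure X : Set S) := by
  intro x hx
  simp only [unaryClosure, SetLike.mem_coe, Subsemigroup.mem_sInf]
  exact fun T hT => hT.1 hx

theorem isUnary_unaryClosure (X : Set S) : IsUnarySubsemigroup (unaryClosure X) := by
  intro x hx y hy
  simp only [unaryClosure, Subsemigroup.mem_sInf] at hx ⊢
  exact fun T hT => hT.2 x (hx T hT) y hy

theorem unaryClosure_le {X : Set S} {T : Subsemigroup S} (h : X ⊆ T)
    (hT : IsUnarySubsemigroup T) : unaryClosure X ≤ T :=
  sInf_le (show T ∈ {T : Subsemigroup S | X ⊆ (T : Set S) ∧ IsUnarySubsemigroup T} from ⟨h, hT⟩)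

theorem IsFGUnary.isUnary {A : Subsemigroup S} (h : IsFGUnary A) : IsUnarySubsemigroup A := by
  obtain ⟨X, -, rfl⟩ := h
  exact isUnary_unaryClosure X

theorem IsUnarySubsemigroup.map (f : S →ₙ* T) (hS : HasRelativeInverses S) {A : Subsemigroup S}
    (hA : IsUnarySubsemigroup A) : IsUnarySubsemigroup (A.map f) := by
  rintro _ ⟨x, hx, rfl⟩ y hy
  obtain ⟨z, hz⟩ := hS x
  rw [hy.unique (hz.map f)]
  exact ⟨z, hA x hx z hz, rfl⟩

theorem IsUnarySubsemigroup.comap (f : S →ₙ* T) {B : Subsemigroup T}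
    (hB : IsUnarySubsemigroup B) : IsUnarySubsemigroup (B.comap f) :=
  fun _ hx _ hy => hB _ hx _ (hy.map f)

theorem unaryClosure_image (f : S →ₙ* T) (hS : HasRelativeInverses S) (X : Set S) :
    unaryClosure (f '' X) = (unaryClosure X).map f := by
  apply le_antisymm
  · refine unaryClosure_le ?_ ((isUnary_unaryClosure X).map f hS)
    rintro _ ⟨x, hx, rfl⟩
    exact ⟨x, subset_unaryClosure X hx, rfl⟩
  · rw [Subsemigroup.map_le_iff_le_comap]
    refine unaryClosure_le ?_ ((isUnary_unaryClosure _).comap f)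
    intro x hx
    exact subset_unaryClosure _ ⟨x, hx, rfl⟩

theorem IsFGUnary.map (f : S →ₙ* T) (hS : HasRelativeInverses S) {A : Subsemigroup S}
    (hA : IsFGUnary A) : IsFGUnary (A.map f) := by
  obtain ⟨X, hX, rfl⟩ := hA
  exact ⟨f '' X, hX.image f, unaryClosure_image f hS X⟩

theorem isFGUnary_srange (f : S →ₙ* T) (hS : HasRelativeInverses S)
    (h : IsFGUnary (⊤ : Subsemigroup S)) : IsFGUnary f.srange := by
  have := h.map f hS
  rwa [← MulHom.srange_eq_map] at this

theorem isFGUnary_top_of_equiv (e : S ≃* T) (hS : HasRelativeInverses S)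
    (h : IsFGUnary (⊤ : Subsemigroup S)) : IsFGUnary (⊤ : Subsemigroup T) := by
  have h1 := isFGUnary_srange (e : S →ₙ* T) hS h
  have h2 : (e : S →ₙ* T).srange = ⊤ := MulHom.srange_eq_top_iff_surjective.2 e.surjective
  rwa [h2] at h1

/-- A finitely generated unary subsemigroup `A` is completely regular, and finitely generated as a
unary semigroup in its own right. -/
theorem isFGUnary_top_coe {A : Subsemigroup S} (hS : HasRelativeInverses S) (hA : IsFGUnary A) :
    IsFGUnary (⊤ : Subsemigroup A) ∧ HasRelativeInverses A := by
  have hrel : HasRelativeInverses A := fun x => by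
    obtain ⟨y, hy⟩ := hS x
    refine ⟨⟨y, hA.isUnary x x.2 y hy⟩, ?_, ?_, ?_⟩
    · exact Subtype.ext hy.1
    · exact Subtype.ext hy.2.1
    · exact Subtype.ext hy.2.2
  refine ⟨?_, hrel⟩
  obtain ⟨X, hX, rfl⟩ := hA
  set A := unaryClosure X
  refine ⟨(MulMemClass.subtype A) ⁻¹' X, hX.preimage Subtype.coe_injective.injOn, ?_⟩
  have h1 : unaryClosure ((MulMemClass.subtype A) '' ((MulMemClass.subtype A) ⁻¹' X)) = A := by
    rw [Set.image_preimage_eq_of_subset]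
    intro x hx
    exact ⟨⟨x, subset_unaryClosure X hx⟩, rfl⟩
  rw [unaryClosure_image _ hrel] at h1
  rw [eq_top_iff]
  rintro ⟨x, hx⟩ -
  rw [← h1] at hx
  obtain ⟨y, hy, hyx⟩ := hx
  obtain rfl : (y : S) = x := hyx
  exact hy

/-- Homogeneity in terms of pairs of embeddings of a finitely generated completely regular
semigroup: they differ by an automorphism. -/
theorem IsHomogeneousSemigroup.exists_comp_eq (h : IsHomogeneousSemigroup S)
    (hT : HasRelativeInverses T) (hfg : IsFGUnary (⊤ : Subsemigroup T)) (f g : T →ₙ* S)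
    (hf : Function.Injective f) (hg : Function.Injective g) :
    ∃ ψ : S ≃* S, ∀ t, ψ (f t) = g t := by
  let ef : T ≃* f.srange := MulEquiv.ofBijective f.srangeRestrict
    ⟨fun a b hab => hf (congrArg Subtype.val hab), f.srangeRestrict_surjective⟩
  let eg : T ≃* g.srange := MulEquiv.ofBijective g.srangeRestrict
    ⟨fun a b hab => hg (congrArg Subtype.val hab), g.srangeRestrict_surjective⟩
  obtain ⟨ψ, hψ⟩ := h _ _ (isFGUnary_srange f hT hfg) (isFGUnary_srange g hT hfg)
    (ef.symm.trans eg)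
  refine ⟨ψ, fun t => ?_⟩
  have := hψ (ef t)
  rw [MulEquiv.trans_apply, MulEquiv.symm_apply_apply] at this
  exact this

/-- A semigroup is homogeneous once embeddings of its finitely generated unary subsemigroups
extend. -/
theorem isHomogeneousSemigroup_of_extend
    (h : ∀ A : Subsemigroup S, IsFGUnary A → ∀ φ : A →ₙ* S, Function.Injective φ →
      ∃ ψ : S ≃* S, ∀ a : A, ψ a = φ a) : IsHomogeneousSemigroup S := by
  intro A B hA _ φ
  exact h A hA ((MulMemClass.subtype B).comp (φ : A →ₙ* B))
    (Subtype.coe_injective.comp φ.injective)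

theorem IsHomogeneousSemigroup.of_equiv (h : IsHomogeneousSemigroup S)
    (hS : HasRelativeInverses S) (e : S ≃* T) : IsHomogeneousSemigroup T := by
  have hT := hS.of_equiv e
  apply isHomogeneousSemigroup_of_extend
  intro A hA φ hφ
  obtain ⟨h1, h2⟩ := isFGUnary_top_coe hT hA
  obtain ⟨ψ, hψ⟩ := h.exists_comp_eq h2 h1
    ((e.symm : T →ₙ* S).comp (MulMemClass.subtype A)) ((e.symm : T →ₙ* S).comp φ)
    (e.symm.injective.comp Subtype.coe_injective) (e.symm.injective.comp hφ)
  refine ⟨(e.symm.trans ψ).trans e, fun a => ?_⟩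
  have := hψ a
  simp at this
  simp [this]

end RelativeInverse

section GroupHomogeneity

variable {G : Type*} [Group G]

/-- Two embeddings of a finitely generated group in a homogeneous group differ by an
automorphism. -/
theorem IsHomogeneousGroup.exists_extend (h : IsHomogeneousGroup G) {K : Type*} [Group K]
    (hK : Group.FG K) (f g : K →* G) (hf : Function.Injective f) (hg : Function.Injective g) :
    ∃ θ : G ≃* G, ∀ k, θ (f k) = g k := by
  have hfg : ∀ f : K →* G, f.range.FG := fun f => (Group.fg_iff_subgroup_fg _).1
    (Group.fg_range f)
  obtain ⟨ψ, hψ⟩ := h _ _ (hfg f) (hfg g)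
    ((MonoidHom.ofInjective hf).symm.trans (MonoidHom.ofInjective hg))
  refine ⟨ψ, fun t => ?_⟩
  have := hψ (MonoidHom.ofInjective hf t)
  rw [MulEquiv.trans_apply, MulEquiv.symm_apply_apply] at this
  exact this

end GroupHomogeneity

/-! ### Rees matrix semigroups -/

namespace ReesMatrix

variable {G : Type*} [Group G] {I Λ : Type*} {P : Matrix Λ I G}

@[simp] theorem mul_left (a b : ReesMatrix P) : (a * b).left = a.left := rfl
@[simp] theorem mul_right (a b : ReesMatrix P) : (a * b).right = b.right := rfl
@[simp] theorem mul_elt (a b : ReesMatrix P) :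
    (a * b).elt = a.elt * P a.right b.left * b.elt := rfl

theorem mk_mul_mk (i j : I) (g h : G) (l m : Λ) :
    (⟨i, g, l⟩ : ReesMatrix P) * ⟨j, h, m⟩ = ⟨i, g * P l j * h, m⟩ := rfl

theorem isRelativeInverse_mk (x : ReesMatrix P) :
    IsRelativeInverse x
      ⟨x.left, (P x.right x.left)⁻¹ * x.elt⁻¹ * (P x.right x.left)⁻¹, x.right⟩ := by
  refine ⟨?_, ?_, ?_⟩ <;> ext <;> simp [mul_assoc]

theorem hasRelativeInverses (P : Matrix Λ I G) : HasRelativeInverses (ReesMatrix P) :=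
  fun x => ⟨_, isRelativeInverse_mk x⟩

theorem isIdempotentElem_iff (x : ReesMatrix P) :
    IsIdempotentElem x ↔ x.elt = (P x.right x.left)⁻¹ := by
  constructor
  · intro h
    have : x.elt * P x.right x.left * x.elt = x.elt := congrArg ReesMatrix.elt h
    rw [mul_assoc, mul_eq_left] at this
    exact (eq_inv_of_mul_eq_one_right this)
  · intro h
    ext
    · rfl
    · simp [h]
    · rfl

theorem isCompletelySimple (P : Matrix Λ I G) [Nonempty I] [Nonempty Λ] :
    IsCompletelySimple (ReesMatrix P) := by
  obtain ⟨i⟩ := ‹Nonempty I›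
  obtain ⟨l⟩ := ‹Nonempty Λ›
  constructor
  · rintro J ⟨⟨a, ha⟩, hJ⟩
    rw [Set.eq_univ_iff_forall]
    intro x
    have h1 := (hJ a ha ⟨x.left, (a.elt)⁻¹ * (P x.right a.left)⁻¹, x.right⟩).1
    have h2 := (hJ _ h1 ⟨a.left, (P a.right a.left)⁻¹ * x.elt, x.right⟩).2
    convert h2
    ext <;> simp [mul_assoc]
  · refine ⟨⟨i, (P l i)⁻¹, l⟩, (isIdempotentElem_iff _).2 rfl, ?_⟩
    intro f hf h1 h2
    have e1 : f.left = i := by rw [← h1]; rfl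
    have e2 : f.right = l := by rw [← h2]; rfl
    rw [isIdempotentElem_iff] at hf
    ext
    · exact e1
    · rw [hf, e1, e2]
    · exact e2

variable {G₁ G₂ : Type*} [Group G₁] [Group G₂] {I₁ I₂ Λ₁ Λ₂ : Type*}
  {P₁ : Matrix Λ₁ I₁ G₁} {P₂ : Matrix Λ₂ I₂ G₂}

/-- The homomorphism of Rees matrix semigroups given by a group homomorphism and maps of the
index sets that match the entries of the two matrices. -/
def mapHom (κ : G₁ →* G₂) (σ : I₁ → I₂) (τ : Λ₁ → Λ₂)
    (h : ∀ l i, κ (P₁ l i) = P₂ (τ l) (σ i)) : ReesMatrix P₁ →ₙ* ReesMatrix P₂ where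
  toFun x := ⟨σ x.left, κ x.elt, τ x.right⟩
  map_mul' x y := by ext <;> simp [h]

theorem mapHom_injective {κ : G₁ →* G₂} {σ : I₁ → I₂} {τ : Λ₁ → Λ₂}
    {h : ∀ l i, κ (P₁ l i) = P₂ (τ l) (σ i)} (hκ : Function.Injective κ)
    (hσ : Function.Injective σ) (hτ : Function.Injective τ) :
    Function.Injective (mapHom κ σ τ h) := by
  intro x y hxy
  simp only [mapHom, MulHom.coe_mk, ReesMatrix.mk.injEq] at hxy
  exact ReesMatrix.ext (hσ hxy.1) (hκ hxy.2.1) (hτ hxy.2.2)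

/-- The isomorphism of Rees matrix semigroups given by a group isomorphism and bijections of the
index sets that match the entries of the two matrices. -/
noncomputable def mapEquiv (θ : G₁ ≃* G₂) (σ : I₁ ≃ I₂) (τ : Λ₁ ≃ Λ₂)
    (h : ∀ l i, θ (P₁ l i) = P₂ (τ l) (σ i)) : ReesMatrix P₁ ≃* ReesMatrix P₂ :=
  MulEquiv.ofBijective (mapHom (θ : G₁ →* G₂) σ τ h)
    ⟨mapHom_injective θ.injective σ.injective τ.injective, fun x =>
      ⟨⟨σ.symm x.left, θ.symm x.elt, τ.symm x.right⟩, by simp [mapHom]⟩⟩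

@[simp] theorem mapEquiv_apply (θ : G₁ ≃* G₂) (σ : I₁ ≃ I₂) (τ : Λ₁ ≃ Λ₂)
    (h : ∀ l i, θ (P₁ l i) = P₂ (τ l) (σ i)) (x : ReesMatrix P₁) :
    mapEquiv θ σ τ h x = ⟨σ x.left, θ x.elt, τ x.right⟩ := rfl

/-- A homomorphism between normalised Rees matrix semigroups that respects the base idempotents
acts coordinatewise. -/
theorem exists_coordinates {l₁ : Λ₁} {i₁ : I₁} {l₂ : Λ₂} {i₂ : I₂} (h₁ : IsNormalised P₁ l₁ i₁)
    (h₂ : IsNormalised P₂ l₂ i₂) (f : ReesMatrix P₁ →ₙ* ReesMatrix P₂)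
    (hf : f ⟨i₁, 1, l₁⟩ = ⟨i₂, 1, l₂⟩) :
    ∃ (κ : G₁ →* G₂) (σ : I₁ → I₂) (τ : Λ₁ → Λ₂),
      (∀ x, f x = ⟨σ x.left, κ x.elt, τ x.right⟩) ∧
      (∀ l i, κ (P₁ l i) = P₂ (τ l) (σ i)) ∧ σ i₁ = i₂ ∧ τ l₁ = l₂ := by
  obtain ⟨a1, a2⟩ := h₁
  obtain ⟨b1, b2⟩ := h₂
  have hI : ∀ i, f ⟨i, 1, l₁⟩ = ⟨(f ⟨i, 1, l₁⟩).left, 1, l₂⟩ := fun i => by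
    have e1 : (⟨i, 1, l₁⟩ : ReesMatrix P₁) * ⟨i₁, 1, l₁⟩ = ⟨i, 1, l₁⟩ := by simp [mk_mul_mk, a2]
    have e2 : (⟨i₁, 1, l₁⟩ : ReesMatrix P₁) * ⟨i, 1, l₁⟩ = ⟨i₁, 1, l₁⟩ := by simp [mk_mul_mk, a1]
    have e1' := congrArg f e1
    have e2' := congrArg f e2
    rw [map_mul, hf] at e1' e2'
    have r1 : l₂ = (f ⟨i, 1, l₁⟩).right := congrArg ReesMatrix.right e1'
    have r2 := congrArg ReesMatrix.elt e2'
    simp only [mul_elt, b1, one_mul, mul_one] at r2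
    exact ReesMatrix.ext rfl r2 r1.symm
  have hL : ∀ l, f ⟨i₁, 1, l⟩ = ⟨i₂, 1, (f ⟨i₁, 1, l⟩).right⟩ := fun l => by
    have e1 : (⟨i₁, 1, l₁⟩ : ReesMatrix P₁) * ⟨i₁, 1, l⟩ = ⟨i₁, 1, l⟩ := by simp [mk_mul_mk, a2]
    have e2 : (⟨i₁, 1, l⟩ : ReesMatrix P₁) * ⟨i₁, 1, l₁⟩ = ⟨i₁, 1, l₁⟩ := by simp [mk_mul_mk, a2]
    have e1' := congrArg f e1
    have e2' := congrArg f e2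
    rw [map_mul, hf] at e1' e2'
    have r1 : i₂ = (f ⟨i₁, 1, l⟩).left := congrArg ReesMatrix.left e1'
    have r2 := congrArg ReesMatrix.elt e2'
    simp only [mul_elt, b2, mul_one] at r2
    exact ReesMatrix.ext r1.symm r2 rfl
  have hG : ∀ g, f ⟨i₁, g, l₁⟩ = ⟨i₂, (f ⟨i₁, g, l₁⟩).elt, l₂⟩ := fun g => by
    have e1 : (⟨i₁, 1, l₁⟩ : ReesMatrix P₁) * ⟨i₁, g, l₁⟩ = ⟨i₁, g, l₁⟩ := by simp [mk_mul_mk, a2]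
    have e2 : (⟨i₁, g, l₁⟩ : ReesMatrix P₁) * ⟨i₁, 1, l₁⟩ = ⟨i₁, g, l₁⟩ := by simp [mk_mul_mk, a2]
    have e1' := congrArg f e1
    have e2' := congrArg f e2
    rw [map_mul, hf] at e1' e2'
    exact ReesMatrix.ext (congrArg ReesMatrix.left e1').symm rfl
      (congrArg ReesMatrix.right e2').symm
  refine ⟨MonoidHom.mk' (fun g => (f ⟨i₁, g, l₁⟩).elt) ?_, fun i => (f ⟨i, 1, l₁⟩).left,
    fun l => (f ⟨i₁, 1, l⟩).right, ?_, ?_, ?_, ?_⟩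
  · intro g h
    have : (⟨i₁, g * h, l₁⟩ : ReesMatrix P₁) = ⟨i₁, g, l₁⟩ * ⟨i₁, h, l₁⟩ := by
      simp [mk_mul_mk, a2]
    rw [this, map_mul, hG g, hG h]
    simp [mk_mul_mk, b2]
  · rintro ⟨i, g, l⟩
    have : (⟨i, g, l⟩ : ReesMatrix P₁) = ⟨i, 1, l₁⟩ * ⟨i₁, g, l₁⟩ * ⟨i₁, 1, l⟩ := by
      simp [mk_mul_mk, a2]
    conv_lhs => rw [this, map_mul, map_mul, hI i, hG g, hL l]
    simp [mk_mul_mk, b2]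
  · intro l i
    have : (⟨i₁, P₁ l i, l₁⟩ : ReesMatrix P₁) = ⟨i₁, 1, l⟩ * ⟨i, 1, l₁⟩ := by
      simp [mk_mul_mk]
    simp only [MonoidHom.mk'_apply]
    rw [this, map_mul, hI i, hL l]
    simp [mk_mul_mk]
  · simp [hf]
  · simp [hf]

theorem coordinates_injective {f : ReesMatrix P₁ →ₙ* ReesMatrix P₂} {κ : G₁ →* G₂} {σ : I₁ → I₂}
    {τ : Λ₁ → Λ₂} (l₁ : Λ₁) (i₁ : I₁) (h : ∀ x, f x = ⟨σ x.left, κ x.elt, τ x.right⟩)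
    (hf : Function.Injective f) :
    Function.Injective κ ∧ Function.Injective σ ∧ Function.Injective τ := by
  refine ⟨fun a b hab => ?_, fun a b hab => ?_, fun a b hab => ?_⟩
  · have : f ⟨i₁, a, l₁⟩ = f ⟨i₁, b, l₁⟩ := by simp [h, hab]
    exact congrArg ReesMatrix.elt (hf this)
  · have : f ⟨a, 1, l₁⟩ = f ⟨b, 1, l₁⟩ := by simp [h, hab]
    exact congrArg ReesMatrix.left (hf this)
  · have : f ⟨i₁, 1, a⟩ = f ⟨i₁, 1, b⟩ := by simp [h, hab]
    exact congrArg ReesMatrix.right (hf this)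

/-- An isomorphism between normalised Rees matrix semigroups that respects the base idempotents
acts by bijections on the coordinates. -/
theorem exists_equiv_coordinates {l₁ : Λ₁} {i₁ : I₁} {l₂ : Λ₂} {i₂ : I₂}
    (h₁ : IsNormalised P₁ l₁ i₁) (h₂ : IsNormalised P₂ l₂ i₂)
    (f : ReesMatrix P₁ ≃* ReesMatrix P₂)
    (hf : f ⟨i₁, 1, l₁⟩ = ⟨i₂, 1, l₂⟩) :
    ∃ (κ : G₁ ≃* G₂) (σ : I₁ ≃ I₂) (τ : Λ₁ ≃ Λ₂),
      (∀ x, f x = ⟨σ x.left, κ x.elt, τ x.right⟩) ∧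
      (∀ l i, κ (P₁ l i) = P₂ (τ l) (σ i)) ∧ σ i₁ = i₂ ∧ τ l₁ = l₂ := by
  obtain ⟨κ, σ, τ, hc, hP, hσ, hτ⟩ := exists_coordinates h₁ h₂ (f : _ →ₙ* _) hf
  obtain ⟨c1, c2, c3⟩ := coordinates_injective l₁ i₁ hc f.injective
  refine ⟨MulEquiv.ofBijective κ ⟨c1, fun g => ?_⟩, Equiv.ofBijective σ ⟨c2, fun i => ?_⟩,
    Equiv.ofBijective τ ⟨c3, fun l => ?_⟩, hc, hP, hσ, hτ⟩
  · obtain ⟨x, hx⟩ := f.surjective ⟨i₂, g, l₂⟩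
    exact ⟨x.elt, by have := (hc x).symm.trans hx; exact congrArg ReesMatrix.elt this⟩
  · obtain ⟨x, hx⟩ := f.surjective ⟨i, 1, l₂⟩
    exact ⟨x.left, by have := (hc x).symm.trans hx; exact congrArg ReesMatrix.left this⟩
  · obtain ⟨x, hx⟩ := f.surjective ⟨i₂, 1, l⟩
    exact ⟨x.right, by have := (hc x).symm.trans hx; exact congrArg ReesMatrix.right this⟩

/-- The sandwich matrix obtained from `P` by normalising along row `m` and column `j`. -/
def rebase (P : Matrix Λ I G) (m : Λ) (j : I) : Matrix Λ I G :=
  fun l i => (P l j)⁻¹ * P l i * (P m i)⁻¹ * P m j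

theorem isNormalised_rebase (P : Matrix Λ I G) (m : Λ) (j : I) :
    IsNormalised (rebase P m j) m j :=
  ⟨fun i => by simp [rebase], fun l => by simp [rebase]⟩

/-- Changing the normalisation of the sandwich matrix does not change the semigroup. -/
def rebaseEquiv (P : Matrix Λ I G) (m : Λ) (j : I) : ReesMatrix P ≃* ReesMatrix (rebase P m j) where
  toFun x := ⟨x.left, (P m j)⁻¹ * P m x.left * x.elt * P x.right j, x.right⟩
  invFun x := ⟨x.left, (P m x.left)⁻¹ * P m j * x.elt * (P x.right j)⁻¹, x.right⟩
  left_inv x := by ext <;> simp [mul_assoc]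
  right_inv x := by ext <;> simp [mul_assoc]
  map_mul' x y := by ext <;> simp [rebase, mul_assoc]

theorem rebaseEquiv_base (P : Matrix Λ I G) (m : Λ) (j : I) :
    rebaseEquiv P m j ⟨j, (P m j)⁻¹, m⟩ = ⟨j, 1, m⟩ := by
  ext <;> simp [rebaseEquiv]

theorem rebase_self {P : Matrix Λ I G} {m : Λ} {j : I} (h : IsNormalised P m j) :
    rebase P m j = P := by
  ext l i
  simp [rebase, h.1, h.2]

/-- Every embedding of a normalised Rees matrix semigroup in another becomes a coordinatewise one
after renormalising the target. -/
theorem exists_rebase_coordinates {l₁ : Λ₁} {i₁ : I₁} (h₁ : IsNormalised P₁ l₁ i₁)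
    (f : ReesMatrix P₁ →ₙ* ReesMatrix P₂) (hf : Function.Injective f) :
    ∃ (m : Λ₂) (j : I₂) (κ : G₁ →* G₂) (σ : I₁ → I₂) (τ : Λ₁ → Λ₂),
      f ⟨i₁, 1, l₁⟩ = ⟨j, (P₂ m j)⁻¹, m⟩ ∧
      (∀ x, rebaseEquiv P₂ m j (f x) = ⟨σ x.left, κ x.elt, τ x.right⟩) ∧
      (∀ l i, κ (P₁ l i) = rebase P₂ m j (τ l) (σ i)) ∧ σ i₁ = j ∧ τ l₁ = m ∧
      Function.Injective κ ∧ Function.Injective σ ∧ Function.Injective τ := by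
  have hid : IsIdempotentElem (⟨i₁, 1, l₁⟩ : ReesMatrix P₁) := by
    rw [isIdempotentElem_iff]; simp [h₁.1]
  have hid' : IsIdempotentElem (f ⟨i₁, 1, l₁⟩) := by
    rw [IsIdempotentElem, ← map_mul, hid]
  rw [isIdempotentElem_iff] at hid'
  set e := f ⟨i₁, 1, l₁⟩ with he
  have he' : e = ⟨e.left, (P₂ e.right e.left)⁻¹, e.right⟩ := ReesMatrix.ext rfl hid' rfl
  obtain ⟨κ, σ, τ, hc, hP, hσ, hτ⟩ := exists_coordinates h₁
    (isNormalised_rebase P₂ e.right e.left)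
    ((rebaseEquiv P₂ e.right e.left : _ →ₙ* _).comp f) (by
      change rebaseEquiv P₂ e.right e.left e = _
      rw [← rebaseEquiv_base, ← he'])
  obtain ⟨c1, c2, c3⟩ := coordinates_injective l₁ i₁ hc
    ((rebaseEquiv P₂ e.right e.left).injective.comp hf)
  exact ⟨e.right, e.left, κ, σ, τ, he', hc, hP, hσ, hτ, c1, c2, c3⟩

/-- A normalised Rees matrix semigroup with finite index sets over a finitely generated group is
finitely generated. -/
theorem isFGUnary_top {l₀ : Λ} {i₀ : I} (h : IsNormalised P l₀ i₀) [Finite I] [Finite Λ]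
    (hG : Group.FG G) : IsFGUnary (⊤ : Subsemigroup (ReesMatrix P)) := by
  obtain ⟨X, hX⟩ := Group.fg_iff.1 hG
  set Y : Set (ReesMatrix P) := (fun g => ⟨i₀, g, l₀⟩) '' X ∪ Set.range (fun i => ⟨i, 1, l₀⟩) ∪
    Set.range (fun l => ⟨i₀, 1, l⟩) with hY
  refine ⟨Y, ((hX.2.image _).union (Set.finite_range _)).union (Set.finite_range _), ?_⟩
  rw [eq_top_iff]
  have hsub := subset_unaryClosure Y
  have hI : ∀ i, (⟨i, 1, l₀⟩ : ReesMatrix P) ∈ unaryClosure Y := fun i =>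
    hsub (Or.inl (Or.inr ⟨i, rfl⟩))
  have hL : ∀ l, (⟨i₀, 1, l⟩ : ReesMatrix P) ∈ unaryClosure Y := fun l =>
    hsub (Or.inr ⟨l, rfl⟩)
  have hK : ∀ g, (⟨i₀, g, l₀⟩ : ReesMatrix P) ∈ unaryClosure Y := fun g => by
    have hg : g ∈ Subgroup.closure X := hX.1 ▸ Subgroup.mem_top g
    induction hg using Subgroup.closure_induction with
    | mem x hx => exact hsub (Or.inl (Or.inl ⟨x, hx, rfl⟩))
    | one => exact hI i₀
    | mul x y _ _ hx hy =>
      have := mul_mem hx hy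
      simpa [mk_mul_mk, h.1] using this
    | inv x _ hx =>
      have := isUnary_unaryClosure Y _ hx _ (isRelativeInverse_mk _)
      simpa [h.1] using this
  rintro ⟨i, g, l⟩ -
  have := mul_mem (mul_mem (hI i) (hK g)) (hL l)
  simpa [mk_mul_mk, h.1, h.2] using this

/-- The elements of `ReesMatrix P` with coordinates in `J`, `K` and `M`, where the subgroup `K`
contains the corresponding entries of `P`. -/
def block (P : Matrix Λ I G) (J : Set I) (K : Subgroup G) (M : Set Λ)
    (h : ∀ l ∈ M, ∀ i ∈ J, P l i ∈ K) : Subsemigroup (ReesMatrix P) where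
  carrier := {x | x.left ∈ J ∧ x.elt ∈ K ∧ x.right ∈ M}
  mul_mem' ha hb := ⟨ha.1, K.mul_mem (K.mul_mem ha.2.1 (h _ ha.2.2 _ hb.1)) hb.2.1, hb.2.2⟩

theorem isUnary_block (P : Matrix Λ I G) (J : Set I) (K : Subgroup G) (M : Set Λ)
    (h : ∀ l ∈ M, ∀ i ∈ J, P l i ∈ K) : IsUnarySubsemigroup (block P J K M h) := by
  rintro x ⟨h1, h2, h3⟩ y hy
  rw [hy.unique (isRelativeInverse_mk x)]
  have := h _ h3 _ h1
  exact ⟨h1, K.mul_mem (K.mul_mem (K.inv_mem this) (K.inv_mem h2)) (K.inv_mem this), h3⟩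

/-- A finitely generated unary subsemigroup containing the base idempotent is a block with finite
index sets and finitely generated group. -/
theorem exists_eq_block {l₀ : Λ} {i₀ : I} (hP : IsNormalised P l₀ i₀)
    {A : Subsemigroup (ReesMatrix P)} (hA : IsFGUnary A)
    (h0 : (⟨i₀, 1, l₀⟩ : ReesMatrix P) ∈ A) :
    ∃ (J : Set I) (K : Subgroup G) (M : Set Λ) (h : ∀ l ∈ M, ∀ i ∈ J, P l i ∈ K),
      J.Finite ∧ M.Finite ∧ K.FG ∧ i₀ ∈ J ∧ l₀ ∈ M ∧ A = block P J K M h := by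
  have hU := hA.isUnary
  obtain ⟨X, hX, rfl⟩ := hA
  set A := unaryClosure X
  set J : Set I := insert i₀ (ReesMatrix.left '' X) with hJ
  set M : Set Λ := insert l₀ (ReesMatrix.right '' X) with hM
  have hJf : J.Finite := (hX.image _).insert _
  have hMf : M.Finite := (hX.image _).insert _
  have hmul : ∀ (x : ReesMatrix P) (i : I) (g : G) (l : Λ),
      x * ⟨i, g, l⟩ = ⟨x.left, x.elt * P x.right i * g, l⟩ ∧
      (⟨i, g, l⟩ : ReesMatrix P) * x = ⟨i, g * P l x.left * x.elt, x.right⟩ :=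
    fun _ _ _ _ => ⟨rfl, rfl⟩
  set Y : Set G := ReesMatrix.elt '' X ∪ Set.image2 (fun l i => P l i) M J with hY
  set K := Subgroup.closure Y with hK
  have hPK : ∀ l ∈ M, ∀ i ∈ J, P l i ∈ K := fun l hl i hi =>
    Subgroup.subset_closure (Or.inr ⟨l, hl, i, hi, rfl⟩)
  refine ⟨J, K, M, hPK, hJf, hMf, ?_, Set.mem_insert _ _, Set.mem_insert _ _, ?_⟩
  · exact (Subgroup.fg_iff K).2 ⟨Y, rfl, (hX.image _).union (hMf.image2 _ hJf)⟩
  have hIA : ∀ i ∈ J, (⟨i, 1, l₀⟩ : ReesMatrix P) ∈ A := by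
    rintro i (rfl | ⟨x, hx, rfl⟩)
    · exact h0
    · have h1 := mul_mem (subset_unaryClosure X hx) h0
      have h2 := mul_mem h1 (hU _ h1 _ (isRelativeInverse_mk _))
      simpa [hmul, hP.1, hP.2] using h2
  have hLA : ∀ l ∈ M, (⟨i₀, 1, l⟩ : ReesMatrix P) ∈ A := by
    rintro l (rfl | ⟨x, hx, rfl⟩)
    · exact h0
    · have h1 := mul_mem h0 (subset_unaryClosure X hx)
      have h2 := mul_mem h1 (hU _ h1 _ (isRelativeInverse_mk _))
      simpa [hmul, hP.1, hP.2] using h2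
  have hKA : ∀ g ∈ K, (⟨i₀, g, l₀⟩ : ReesMatrix P) ∈ A := by
    intro g hg
    induction hg using Subgroup.closure_induction with
    | mem x hx =>
      rcases hx with ⟨x, hx, rfl⟩ | ⟨l, hl, i, hi, rfl⟩
      · have := mul_mem (mul_mem h0 (subset_unaryClosure X hx)) h0
        simpa [hmul, hP.1, hP.2] using this
      · have := mul_mem (hLA l hl) (hIA i hi)
        simpa [mk_mul_mk] using this
    | one => exact h0
    | mul x y _ _ hx hy =>
      have := mul_mem hx hy
      simpa [mk_mul_mk, hP.1] using this
    | inv x _ hx =>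
      have := hU _ hx _ (isRelativeInverse_mk _)
      simpa [hP.1] using this
  apply le_antisymm
  · refine unaryClosure_le ?_ (isUnary_block _ _ _ _ _)
    intro x hx
    exact ⟨Or.inr ⟨x, hx, rfl⟩, Subgroup.subset_closure (Or.inl ⟨x, hx, rfl⟩),
      Or.inr ⟨x, hx, rfl⟩⟩
  · rintro ⟨i, g, l⟩ ⟨h1, h2, h3⟩
    have := mul_mem (mul_mem (hIA i h1) (hKA g h2)) (hLA l h3)
    simpa [mk_mul_mk, hP.1, hP.2] using this

/-- The sandwich matrix of a block. -/
def blockMatrix (P : Matrix Λ I G) (J : Set I) (K : Subgroup G) (M : Set Λ)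
    (h : ∀ l ∈ M, ∀ i ∈ J, P l i ∈ K) : Matrix M J K :=
  fun l i => ⟨P l i, h l l.2 i i.2⟩

/-- A block is a Rees matrix semigroup in its own right. -/
def blockHom (P : Matrix Λ I G) (J : Set I) (K : Subgroup G) (M : Set Λ)
    (h : ∀ l ∈ M, ∀ i ∈ J, P l i ∈ K) :
    ReesMatrix (blockMatrix P J K M h) →ₙ* block P J K M h where
  toFun x := ⟨⟨x.left, x.elt, x.right⟩, x.left.2, x.elt.2, x.right.2⟩
  map_mul' _ _ := rfl

theorem blockHom_bijective (P : Matrix Λ I G) (J : Set I) (K : Subgroup G) (M : Set Λ)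
    (h : ∀ l ∈ M, ∀ i ∈ J, P l i ∈ K) : Function.Bijective (blockHom P J K M h) := by
  constructor
  · intro x y hxy
    have := ReesMatrix.mk.inj (congrArg Subtype.val hxy)
    exact ReesMatrix.ext (Subtype.ext this.1) (Subtype.ext this.2.1) (Subtype.ext this.2.2)
  · rintro ⟨x, h1, h2, h3⟩
    exact ⟨⟨⟨x.left, h1⟩, ⟨x.elt, h2⟩, ⟨x.right, h3⟩⟩, rfl⟩

end ReesMatrix

/-! ### The Rees theorem -/

section ReesTheorem

variable {S : Type u} [Semigroup S]

/-- A completely simple semigroup is isomorphic to a normalised Rees matrix semigroup. The index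
sets are the idempotents `f` with `f * e = f`, `e * f = e` and with `e * f = f`, `f * e = e`, for a
minimal idempotent `e`, the group is `e * S * e`, and the entries of the matrix are the
products `l * i`. -/
theorem IsCompletelySimple.exists_reesMatrix (hS : IsCompletelySimple S) :
    ∃ (G : Type u) (_ : Group G) (I Λ : Type u) (P : Matrix Λ I G) (l₀ : Λ) (i₀ : I),
      IsNormalised P l₀ i₀ ∧ Nonempty (S ≃* ReesMatrix P) := by
  obtain ⟨hsimple, e, he, hmin⟩ := hS
  have he' : e * e = e := he
  have hfac : ∀ a b : S, ∃ s t, s * a * t = b := by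
    intro a b
    have : ∃ s t, b = s * a * t := by
      have := hsimple {x | ∃ s t, x = s * a * t} ⟨⟨a * a * a, a, a, rfl⟩, ?_⟩
      · exact (this ▸ Set.mem_univ b : b ∈ {x | ∃ s t, x = s * a * t})
      · rintro _ ⟨s, t, rfl⟩ r
        exact ⟨⟨r * s, t, by simp only [mul_assoc]⟩, ⟨s, t * r, by simp only [mul_assoc]⟩⟩
    obtain ⟨s, t, h⟩ := this
    exact ⟨s, t, h.symm⟩
  -- the local monoid at `e` is a group
  let G := {x : S // e * x = x ∧ x * e = x}
  have hcorner : ∀ x : S, e * (e * x * e) = e * x * e ∧ (e * x * e) * e = e * x * e := fun x =>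
    ⟨by rw [mul_assoc e x e, ← mul_assoc e e, he'], by rw [mul_assoc (e * x), he']⟩
  have hinv : ∀ x : G, ∃ y : G, y.1 * x.1 = e := by
    rintro ⟨a, ha1, ha2⟩
    obtain ⟨s, t, hst⟩ := hfac a e
    set s' := e * s * e with hs'
    set t' := e * t * e with ht'
    have h1 : s' * a * t' = e := by
      calc s' * a * t' = e * s * ((e * a) * e) * t * e := by simp only [hs', ht', mul_assoc]
        _ = e * (s * a * t) * e := by rw [ha1, ha2]; simp only [mul_assoc]
        _ = e := by rw [hst, he', he']
    obtain ⟨hs1, hs2⟩ := hcorner s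
    obtain ⟨ht1, ht2⟩ := hcorner t
    rw [← hs'] at hs1 hs2
    rw [← ht'] at ht1 ht2
    clear_value s' t'
    refine ⟨⟨t' * s', by rw [← mul_assoc, ht1], by rw [mul_assoc, hs2]⟩, ?_⟩
    refine hmin (t' * s' * a) ?_ ?_ ?_
    · change t' * s' * a * (t' * s' * a) = t' * s' * a
      calc t' * s' * a * (t' * s' * a) = t' * (s' * a * t') * (s' * a) := by simp only [mul_assoc]
        _ = t' * s' * a := by rw [h1, ht2, mul_assoc]
    · rw [← mul_assoc, ← mul_assoc, ht1]
    · rw [mul_assoc, ha2]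
  choose inv hinv using hinv
  let : Mul G := ⟨fun x y => ⟨x.1 * y.1, by rw [← mul_assoc, x.2.1], by rw [mul_assoc, y.2.2]⟩⟩
  let : One G := ⟨⟨e, he', he'⟩⟩
  let : Inv G := ⟨inv⟩
  let : Group G := Group.ofLeftAxioms (fun x y z => Subtype.ext (mul_assoc x.1 y.1 z.1))
    (fun x => Subtype.ext x.2.1) (fun x => Subtype.ext (hinv x))
  have hval : ∀ x y : G, (x * y).1 = x.1 * y.1 := fun _ _ => rfl
  have hone : (1 : G).1 = e := rfl
  let I := {f : S // f * e = f ∧ e * f = e}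
  let Λ := {f : S // e * f = f ∧ f * e = e}
  let P : Matrix Λ I G := fun l i =>
    ⟨l.1 * i.1, by rw [← mul_assoc, l.2.1], by rw [mul_assoc, i.2.1]⟩
  let f : ReesMatrix P →ₙ* S :=
    { toFun := fun x => x.left.1 * x.elt.1 * x.right.1
      map_mul' := fun x y => by
        simp only [ReesMatrix.mul_left, ReesMatrix.mul_elt, ReesMatrix.mul_right, hval, P,
          mul_assoc] }
  have hf : Function.Bijective f := by
    constructor
    · rintro ⟨i, g, l⟩ ⟨j, h, m⟩ hxy
      change i.1 * g.1 * l.1 = j.1 * h.1 * m.1 at hxy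
      have e1 : g.1 * l.1 = h.1 * m.1 := by
        have := congrArg (e * ·) hxy
        simp only [← mul_assoc, i.2.2, j.2.2, g.2.1, h.2.1] at this
        exact this
      have e2 : i.1 * g.1 = j.1 * h.1 := by
        have := congrArg (· * e) hxy
        simp only [mul_assoc, l.2.2, m.2.2, g.2.2, h.2.2] at this
        exact this
      have e3 : g = h := by
        have := congrArg (· * e) e1
        simp only [mul_assoc, l.2.2, m.2.2, g.2.2, h.2.2] at this
        exact Subtype.ext this
      subst e3
      have hg1 : (g⁻¹).1 * g.1 = e := by rw [← hval, inv_mul_cancel, hone]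
      have hg2 : g.1 * (g⁻¹).1 = e := by rw [← hval, mul_inv_cancel, hone]
      have e4 := congrArg ((g⁻¹).1 * ·) e1
      simp only [← mul_assoc, hg1, l.2.1, m.2.1] at e4
      have e5 := congrArg (· * (g⁻¹).1) e2
      simp only [mul_assoc, hg2, i.2.1, j.2.1] at e5
      exact ReesMatrix.ext (Subtype.ext e5) rfl (Subtype.ext e4)
    · intro x
      obtain ⟨s, t, hst⟩ := hfac e x
      let a : G := ⟨e * s * e, hcorner s⟩
      let b : G := ⟨e * t * e, hcorner t⟩
      let c : G := ⟨e * x * e, hcorner x⟩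
      have hc : c = a * b := by
        apply Subtype.ext
        change e * x * e = e * s * e * (e * t * e)
        rw [← hst, show e * s * e * (e * t * e) = e * s * (e * e) * t * e by
          simp only [mul_assoc], he']
        simp only [mul_assoc]
      set y : G := c⁻¹ with hy
      have hbya : b.1 * y.1 * a.1 = e := by
        rw [← hval, ← hval, hy, hc, mul_inv_rev, mul_inv_cancel_left, inv_mul_cancel, hone]
      have hye : e * y.1 = y.1 := y.2.1
      have hye' : y.1 * e = y.1 := y.2.2
      have hxyx : x * y.1 * x = x := by
        have h1 : e * t * y.1 * s * e = e := by
          refine Eq.trans ?_ hbya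
          change _ = e * t * e * y.1 * (e * s * e)
          rw [mul_assoc (e * t) e, hye, ← mul_assoc (e * t * y.1), ← mul_assoc (e * t * y.1),
            mul_assoc (e * t) y.1 e, hye']
        calc x * y.1 * x = s * (e * t * y.1 * s * e) * t := by
              rw [← hst]; simp only [mul_assoc]
          _ = x := by rw [h1, hst]
      have hcy : e * x * e * y.1 = e := by
        change (c * y).1 = e
        rw [hy, mul_inv_cancel, hone]
      have hyc : y.1 * (e * x * e) = e := by
        change (y * c).1 = e
        rw [hy, inv_mul_cancel, hone]
      refine ⟨⟨⟨x * y.1, by rw [mul_assoc, hye'], ?_⟩, c, ⟨y.1 * x, by rw [← mul_assoc, hye], ?_⟩⟩,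
        ?_⟩
      · rw [mul_assoc, hye] at hcy
        rw [← mul_assoc, hcy]
      · rw [mul_assoc e x e, ← mul_assoc, hye'] at hyc
        rw [mul_assoc, hyc]
      · change x * y.1 * (e * x * e) * (y.1 * x) = x
        rw [mul_assoc x, hyc, mul_assoc x, ← mul_assoc e, hye, ← mul_assoc, hxyx]
  refine ⟨G, inferInstance, I, Λ, P, ⟨e, he', he'⟩, ⟨e, he', he'⟩, ⟨fun i => ?_, fun l => ?_⟩,
    ⟨(MulEquiv.ofBijective f hf).symm⟩⟩
  · exact Subtype.ext i.2.2
  · exact Subtype.ext l.2.2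

theorem IsCompletelySimple.hasRelativeInverses (hS : IsCompletelySimple S) :
    HasRelativeInverses S := by
  obtain ⟨G, _, I, Λ, P, l₀, i₀, -, ⟨e⟩⟩ := hS.exists_reesMatrix
  exact (ReesMatrix.hasRelativeInverses P).of_equiv e.symm

end ReesTheorem

/-! ### Homogeneity in terms of the sandwich matrix -/

section Criterion

/-- Every finite partial isomorphism between the `G`-coloured complete bipartite graphs `P₁` and
`P₂` that contains the pairs of base points `(l₁, l₂)` and `(i₁, i₂)` extends to an isomorphism. -/
def ExtendsPartialIsos {G I₁ I₂ Λ₁ Λ₂ : Type*} (P₁ : Matrix Λ₁ I₁ G) (l₁ : Λ₁) (i₁ : I₁)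
    (P₂ : Matrix Λ₂ I₂ G) (l₂ : Λ₂) (i₂ : I₂) : Prop :=
  ∀ (J : Set I₁) (M : Set Λ₁) (hi : i₁ ∈ J) (hl : l₁ ∈ M) (σ₀ : J → I₂) (τ₀ : M → Λ₂),
    J.Finite → M.Finite → Function.Injective σ₀ → Function.Injective τ₀ →
    σ₀ ⟨i₁, hi⟩ = i₂ → τ₀ ⟨l₁, hl⟩ = l₂ → (∀ (l : M) (i : J), P₁ l i = P₂ (τ₀ l) (σ₀ i)) →
    ∃ (σ : I₁ ≃ I₂) (τ : Λ₁ ≃ Λ₂), (∀ i : J, σ i = σ₀ i) ∧ (∀ l : M, τ l = τ₀ l) ∧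
      ∀ l i, P₁ l i = P₂ (τ l) (σ i)

variable {G : Type*} [Group G] {I Λ : Type*}

/-- If the group is homogeneous and all finite partial isomorphisms between the coloured graphs
attached to the various normalisations of `P` extend, then the Rees matrix semigroup is
homogeneous. -/
theorem ReesMatrix.isHomogeneousSemigroup (P : Matrix Λ I G) (hG : IsHomogeneousGroup G)
    (hP : ∀ (m : Λ) (j : I) (m' : Λ) (j' : I) (θ : G ≃* G),
      ExtendsPartialIsos (fun l i => θ (rebase P m j l i)) m j (rebase P m' j') m' j') :
    IsHomogeneousSemigroup (ReesMatrix P) := by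
  apply isHomogeneousSemigroup_of_extend
  intro A hA φ hφ
  rcases isEmpty_or_nonempty A with hE | ⟨x, hx⟩
  · exact ⟨MulEquiv.refl _, fun a => (hE.false a).elim⟩
  have hE := mul_mem hx (hA.isUnary x hx _ (isRelativeInverse_mk x))
  set m := x.right with hm
  set j := x.left with hj
  have hxe : x * (⟨j, (P m j)⁻¹ * x.elt⁻¹ * (P m j)⁻¹, m⟩ : ReesMatrix P) =
      ⟨j, (P m j)⁻¹, m⟩ := by
    ext <;> simp [mul_assoc, hm, hj]
  rw [hxe] at hE
  set Φ := rebaseEquiv P m j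
  have hnorm := isNormalised_rebase P m j
  obtain ⟨J, K, M, h, hJ, hM, hK, hjJ, hmM, hAB⟩ := exists_eq_block hnorm
    (hA.map (Φ : _ →ₙ* _) (hasRelativeInverses P)) ⟨_, hE, rebaseEquiv_base P m j⟩
  set Q := blockMatrix (rebase P m j) J K M h
  have hmem' : ∀ z ∈ block (rebase P m j) J K M h, Φ.symm z ∈ A := by
    rw [← hAB]
    rintro _ ⟨a, ha, rfl⟩
    change Φ.symm (Φ a) ∈ A
    rwa [Φ.symm_apply_apply]
  have hmem : ∀ t : ReesMatrix Q, Φ.symm (blockHom _ J K M h t : ReesMatrix _) ∈ A :=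
    fun t => hmem' _ (blockHom _ J K M h t).2
  let F : ReesMatrix Q →ₙ* A :=
    { toFun := fun t => ⟨_, hmem t⟩
      map_mul' := fun s t => Subtype.ext (by simp) }
  have hF : Function.Injective F := fun s t hst => by
    have := Φ.symm.injective (congrArg Subtype.val hst)
    exact (blockHom_bijective _ J K M h).1 (Subtype.ext this)
  have hQ : IsNormalised Q ⟨m, hmM⟩ ⟨j, hjJ⟩ :=
    ⟨fun i => Subtype.ext (hnorm.1 i), fun l => Subtype.ext (hnorm.2 l)⟩
  obtain ⟨m', j', κ, σ₀, τ₀, -, hc, hent, hσ₀, hτ₀, i1, i2, i3⟩ :=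
    exists_rebase_coordinates hQ (φ.comp F) (hφ.comp hF)
  obtain ⟨θ, hθ⟩ := hG.exists_extend ((Group.fg_iff_subgroup_fg K).2 hK) K.subtype κ
    K.subtype_injective i1
  obtain ⟨σ, τ, hσ, hτ, hστ⟩ := hP m j m' j' θ J M hjJ hmM σ₀ τ₀ hJ hM i2 i3 hσ₀ hτ₀
    (fun l i => by rw [← hent l i, ← hθ]; rfl)
  refine ⟨(Φ.trans (mapEquiv θ σ τ hστ)).trans (rebaseEquiv P m' j').symm, fun a => ?_⟩
  obtain ⟨t, ht⟩ := (blockHom_bijective _ J K M h).2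
    ⟨Φ a, by rw [← hAB]; exact ⟨a, a.2, rfl⟩⟩
  have hFt : F t = a := Subtype.ext (by
    change Φ.symm (blockHom _ J K M h t : ReesMatrix _) = a
    rw [ht]
    exact Φ.symm_apply_apply _)
  have hct := hc t
  rw [MulHom.comp_apply, hFt] at hct
  rw [MulEquiv.trans_apply, MulEquiv.trans_apply, MulEquiv.symm_apply_eq, hct]
  have ht' : Φ a = ⟨t.left, t.elt, t.right⟩ := (congrArg Subtype.val ht).symm
  rw [ht', mapEquiv_apply]
  exact ReesMatrix.ext (hσ _) (hθ _) (hτ _)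

end Criterion

/-! ### Symmetries of the sandwich matrix of a homogeneous semigroup -/

section Symmetry

variable {G : Type*} [Group G] {I Λ : Type*} {P : Matrix Λ I G} {l₀ : Λ} {i₀ : I}

open ReesMatrix

/-- In a homogeneous normalised Rees matrix semigroup, an embedding of a finitely generated
subgroup together with finite partial injections of the index sets that only meet trivial
entries is induced by a global symmetry of the sandwich matrix. -/
theorem IsHomogeneousSemigroup.exists_symmetry (hP : IsNormalised P l₀ i₀)
    (hS : IsHomogeneousSemigroup (ReesMatrix P)) {J : Set I} {M : Set Λ} (hJ : J.Finite)
    (hM : M.Finite) (hi : i₀ ∈ J) (hl : l₀ ∈ M) {σ₀ : J → I} {τ₀ : M → Λ}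
    (hσ : Function.Injective σ₀) (hτ : Function.Injective τ₀) (h1 : ∀ l ∈ M, ∀ i ∈ J, P l i = 1)
    (h2 : ∀ l i, rebase P (τ₀ ⟨l₀, hl⟩) (σ₀ ⟨i₀, hi⟩) (τ₀ l) (σ₀ i) = 1)
    {K : Type*} [Group K] (hK : Group.FG K) (f κ : K →* G) (hf : Function.Injective f)
    (hκ : Function.Injective κ) :
    ∃ (θ : G ≃* G) (σ : I ≃ I) (τ : Λ ≃ Λ), (∀ k, θ (f k) = κ k) ∧ (∀ i : J, σ i = σ₀ i) ∧
      (∀ l : M, τ l = τ₀ l) ∧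
      ∀ l i, θ (P l i) = rebase P (τ₀ ⟨l₀, hl⟩) (σ₀ ⟨i₀, hi⟩) (τ l) (σ i) := by
  set m := τ₀ ⟨l₀, hl⟩ with hm
  set j := σ₀ ⟨i₀, hi⟩ with hj
  let Q : Matrix M J K := fun _ _ => 1
  have hQ : IsNormalised Q ⟨l₀, hl⟩ ⟨i₀, hi⟩ := ⟨fun _ => rfl, fun _ => rfl⟩
  have := hJ.to_subtype
  have := hM.to_subtype
  let F₁ : ReesMatrix Q →ₙ* ReesMatrix P :=
    mapHom f Subtype.val Subtype.val (fun l i => by simp [Q, h1 l l.2 i i.2])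
  let F₂ : ReesMatrix Q →ₙ* ReesMatrix (rebase P m j) :=
    mapHom κ σ₀ τ₀ (fun l i => by simp [Q, h2])
  have hF₁ : Function.Injective F₁ :=
    mapHom_injective hf Subtype.coe_injective Subtype.coe_injective
  have hF₂ : Function.Injective F₂ := mapHom_injective hκ hσ hτ
  let Φ := rebaseEquiv P m j
  obtain ⟨ψ, hψ⟩ := hS.exists_comp_eq (hasRelativeInverses Q) (isFGUnary_top hQ hK) F₁
    ((Φ.symm : _ →ₙ* _).comp F₂) hF₁ (Φ.symm.injective.comp hF₂)
  have hψ' : ∀ t, Φ (ψ (F₁ t)) = F₂ t := fun t => by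
    rw [hψ]; exact Φ.apply_symm_apply _
  obtain ⟨θ, σ, τ, hc, hent, -, -⟩ := exists_equiv_coordinates hP (isNormalised_rebase P m j)
    (ψ.trans Φ) (by
      have := hψ' ⟨⟨i₀, hi⟩, 1, ⟨l₀, hl⟩⟩
      simpa [F₁, F₂, mapHom] using this)
  have key : ∀ t : ReesMatrix Q, (⟨σ t.left, θ (f t.elt), τ t.right⟩ : ReesMatrix (rebase P m j)) =
      ⟨σ₀ t.left, κ t.elt, τ₀ t.right⟩ := fun t => (hc (F₁ t)).symm.trans (hψ' t)
  refine ⟨θ, σ, τ, fun k => ?_, fun i => ?_, fun l => ?_, hent⟩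
  · exact congrArg ReesMatrix.elt (key ⟨⟨i₀, hi⟩, k, ⟨l₀, hl⟩⟩)
  · exact congrArg ReesMatrix.left (key ⟨i, 1, ⟨l₀, hl⟩⟩)
  · exact congrArg ReesMatrix.right (key ⟨⟨i₀, hi⟩, 1, l⟩)

/-- An injection of finitely many rows, including the base row, is induced by a symmetry of the
matrix that maps the base column to any prescribed column and fixes any prescribed finite set of
group elements. No condition on the entries arises, as those of the base column are trivial. -/
theorem IsHomogeneousSemigroup.exists_row_symmetry (hP : IsNormalised P l₀ i₀)
    (hS : IsHomogeneousSemigroup (ReesMatrix P)) (F : Finset Λ) (τ₀ : Λ → Λ)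
    (hτ : Set.InjOn τ₀ (insert l₀ (F : Set Λ))) (j : I) {X : Set G} (hX : X.Finite) :
    ∃ (θ : G ≃* G) (σ : I ≃ I) (τ : Λ ≃ Λ), (∀ x ∈ X, θ x = x) ∧ σ i₀ = j ∧ τ l₀ = τ₀ l₀ ∧
      (∀ l ∈ F, τ l = τ₀ l) ∧ ∀ l i, θ (P l i) = rebase P (τ₀ l₀) j (τ l) (σ i) := by
  have := hX.to_subtype
  obtain ⟨θ, σ, τ, h1, h2, h3, h4⟩ := hS.exists_symmetry hP (J := {i₀})
    (M := insert l₀ (F : Set Λ)) (Set.finite_singleton _) (F.finite_toSet.insert _) rfl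
    (Set.mem_insert _ _) (σ₀ := fun _ => j) (τ₀ := fun l => τ₀ l)
    (fun a b _ => Subsingleton.elim a b) (Set.injOn_iff_injective.1 hτ)
    (fun l _ i hi => by rw [Set.mem_singleton_iff.1 hi, hP.2]) (fun l i => by simp [rebase])
    (K := Subgroup.closure X) inferInstance (Subgroup.subtype _) (Subgroup.subtype _)
    (Subgroup.subtype_injective _) (Subgroup.subtype_injective _)
  exact ⟨θ, σ, τ, fun x hx => h1 ⟨x, Subgroup.subset_closure hx⟩, h2 ⟨i₀, rfl⟩,
    h3 ⟨l₀, Set.mem_insert _ _⟩, fun l hl => h3 ⟨l, Or.inr hl⟩, h4⟩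

theorem IsHomogeneousSemigroup.exists_column_symmetry (hP : IsNormalised P l₀ i₀)
    (hS : IsHomogeneousSemigroup (ReesMatrix P)) (F : Finset I) (σ₀ : I → I)
    (hσ : Set.InjOn σ₀ (insert i₀ (F : Set I))) (m : Λ) {X : Set G} (hX : X.Finite) :
    ∃ (θ : G ≃* G) (σ : I ≃ I) (τ : Λ ≃ Λ), (∀ x ∈ X, θ x = x) ∧ σ i₀ = σ₀ i₀ ∧ τ l₀ = m ∧
      (∀ i ∈ F, σ i = σ₀ i) ∧ ∀ l i, θ (P l i) = rebase P m (σ₀ i₀) (τ l) (σ i) := by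
  have := hX.to_subtype
  obtain ⟨θ, σ, τ, h1, h2, h3, h4⟩ := hS.exists_symmetry hP (J := insert i₀ (F : Set I))
    (M := {l₀}) (F.finite_toSet.insert _) (Set.finite_singleton _) (Set.mem_insert _ _) rfl
    (σ₀ := fun i => σ₀ i) (τ₀ := fun _ => m) (Set.injOn_iff_injective.1 hσ)
    (fun a b _ => Subsingleton.elim a b)
    (fun l hl i _ => by rw [Set.mem_singleton_iff.1 hl, hP.1]) (fun l i => by simp [rebase])
    (K := Subgroup.closure X) inferInstance (Subgroup.subtype _) (Subgroup.subtype _)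
    (Subgroup.subtype_injective _) (Subgroup.subtype_injective _)
  exact ⟨θ, σ, τ, fun x hx => h1 ⟨x, Subgroup.subset_closure hx⟩, h2 ⟨i₀, Set.mem_insert _ _⟩,
    h3 ⟨l₀, rfl⟩, fun i hi => h2 ⟨i, Or.inr hi⟩, h4⟩

/-- The structure group of a homogeneous Rees matrix semigroup is homogeneous, and its
automorphisms permute the entries of the normalised sandwich matrix. -/
theorem IsHomogeneousSemigroup.group (hP : IsNormalised P l₀ i₀)
    (hS : IsHomogeneousSemigroup (ReesMatrix P)) :
    IsHomogeneousGroup G ∧ ∀ (θ : G ≃* G), ∀ g ∈ entrySet P, θ g ∈ entrySet P := by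
  have key : ∀ (K : Subgroup G) (κ : K →* G), K.FG → Function.Injective κ →
      ∃ (θ : G ≃* G) (σ : I ≃ I) (τ : Λ ≃ Λ), (∀ k : K, θ k = κ k) ∧
        ∀ l i, θ (P l i) = P (τ l) (σ i) := by
    intro K κ hK hκ
    obtain ⟨θ, σ, τ, h1, -, -, h4⟩ := hS.exists_symmetry hP (J := {i₀}) (M := {l₀})
      (Set.finite_singleton _) (Set.finite_singleton _) rfl rfl
      (σ₀ := fun i => i) (τ₀ := fun l => l) Subtype.coe_injective Subtype.coe_injective
      (fun l _ i hi => by rw [Set.mem_singleton_iff.1 hi, hP.2])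
      (fun l i => by rw [rebase_self hP, Set.mem_singleton_iff.1 i.2, hP.2])
      ((Group.fg_iff_subgroup_fg K).2 hK) K.subtype κ K.subtype_injective hκ
    exact ⟨θ, σ, τ, h1, fun l i => by rw [h4, rebase_self hP]⟩
  constructor
  · intro A B hA _ φ
    obtain ⟨θ, -, -, h, -⟩ := key A (B.subtype.comp (φ : A →* B)) hA
      (B.subtype_injective.comp φ.injective)
    exact ⟨θ, h⟩
  · rintro θ _ ⟨l, i, rfl⟩
    obtain ⟨θ', σ, τ, h, h'⟩ := key (Subgroup.closure {P l i})
      ((θ : G →* G).comp (Subgroup.subtype _)) ((Subgroup.fg_iff _).2 ⟨_, rfl,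
        Set.finite_singleton _⟩) (θ.injective.comp (Subgroup.subtype_injective _))
    refine ⟨τ l, σ i, ?_⟩
    rw [← h']
    exact h ⟨P l i, Subgroup.subset_closure rfl⟩

/-- The consequences of homogeneity for the columns of a normalised sandwich matrix: their
restrictions to finite sets of rows are closed under permuting the rows, including the base row,
and under quotients, and the fibres of a column are permuted transitively. -/
structure RowSymmetric (P : Matrix Λ I G) (l₀ : Λ) (i₀ : I) : Prop where
  norm : IsNormalised P l₀ i₀
  permute : ∀ (F : Finset Λ) (τ : Λ → Λ), Set.InjOn τ (insert l₀ (F : Set Λ)) → ∀ i,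
    ∃ k, (k = i₀ ↔ i = i₀) ∧ ∀ l ∈ F, P l k = P (τ l) i * (P (τ l₀) i)⁻¹
  quot : ∀ (F : Finset Λ) (i j : I),
    ∃ k, (k = i₀ ↔ i = j) ∧ ∀ l ∈ F, P l k = (P l j)⁻¹ * P l i
  fibre : ∀ (j : I) (m : Λ) (c : G),
    ∃ τ : Λ ≃ Λ, τ l₀ = m ∧ ∀ l, P l j = c ↔ P (τ l) j = c * P m j

/-- The sandwich matrix with rows and columns exchanged. The inverses make it a matrix
over the same group rather than over the opposite one. -/
def dualMatrix (P : Matrix Λ I G) : Matrix I Λ G := fun i l => (P l i)⁻¹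

theorem IsHomogeneousSemigroup.rowSymmetric (hP : IsNormalised P l₀ i₀)
    (hS : IsHomogeneousSemigroup (ReesMatrix P)) : RowSymmetric P l₀ i₀ := by
  refine ⟨hP, ?_, ?_, ?_⟩
  · intro F τ₀ hτ₀ i
    obtain ⟨θ, σ, τ, h1, h2, h3, h4, h5⟩ := hS.exists_row_symmetry hP F τ₀ hτ₀ i₀
      (X := (fun l => P (τ₀ l) i * (P (τ₀ l₀) i)⁻¹) '' F) (F.finite_toSet.image _)
    refine ⟨σ.symm i, by rw [Equiv.symm_apply_eq, h2], fun l hl => θ.injective ?_⟩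
    rw [h5, h4 l hl, h1 _ ⟨l, hl, rfl⟩]
    simp [rebase, hP.2]
  · intro F i j
    obtain ⟨θ, σ, τ, h1, h2, h3, h4, h5⟩ := hS.exists_row_symmetry hP F id
      Function.injective_id.injOn j (X := (fun l => (P l j)⁻¹ * P l i) '' F)
      (F.finite_toSet.image _)
    refine ⟨σ.symm i, by rw [Equiv.symm_apply_eq, h2], fun l hl => θ.injective ?_⟩
    rw [h5, h4 l hl, h1 _ ⟨l, hl, rfl⟩]
    simp [rebase, hP.1]
  · intro j m c
    obtain ⟨θ, σ, τ, h1, h2, h3, h4, h5⟩ := hS.exists_column_symmetry hP {j} id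
      Function.injective_id.injOn m (X := {c}) (Set.finite_singleton c)
    refine ⟨τ, h3, fun l => ?_⟩
    rw [← θ.injective.eq_iff, h1 c rfl, h5, h4 j (by simp)]
    simp [rebase, hP.2, mul_inv_eq_iff_eq_mul]

theorem IsHomogeneousSemigroup.rowSymmetric_dual (hP : IsNormalised P l₀ i₀)
    (hS : IsHomogeneousSemigroup (ReesMatrix P)) : RowSymmetric (dualMatrix P) i₀ l₀ := by
  refine ⟨⟨fun l => by simp [dualMatrix, hP.2], fun i => by simp [dualMatrix, hP.1]⟩, ?_, ?_, ?_⟩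
  · intro F σ₀ hσ₀ m
    obtain ⟨θ, σ, τ, h1, h2, h3, h4, h5⟩ := hS.exists_column_symmetry hP F σ₀ hσ₀ l₀
      (X := (fun i => (P m (σ₀ i₀))⁻¹ * P m (σ₀ i)) '' F) (F.finite_toSet.image _)
    refine ⟨τ.symm m, by rw [Equiv.symm_apply_eq, h3], fun i hi => ?_⟩
    have : P (τ.symm m) i = (P m (σ₀ i₀))⁻¹ * P m (σ₀ i) := θ.injective (by
      rw [h5, h4 i hi, h1 _ ⟨i, hi, rfl⟩]
      simp [rebase, hP.1])
    simp [dualMatrix, this]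
  · intro F l m
    obtain ⟨θ, σ, τ, h1, h2, h3, h4, h5⟩ := hS.exists_column_symmetry hP F id
      Function.injective_id.injOn m (X := (fun i => P l i * (P m i)⁻¹) '' F)
      (F.finite_toSet.image _)
    refine ⟨τ.symm l, by rw [Equiv.symm_apply_eq, h3], fun i hi => ?_⟩
    have : P (τ.symm l) i = P l i * (P m i)⁻¹ := θ.injective (by
      rw [h5, h4 i hi, h1 _ ⟨i, hi, rfl⟩]
      simp [rebase, hP.2])
    simp [dualMatrix, this]
  · intro l m c
    obtain ⟨θ, σ, τ, h1, h2, h3, h4, h5⟩ := hS.exists_row_symmetry hP {l} id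
      Function.injective_id.injOn m (X := {c⁻¹}) (Set.finite_singleton _)
    refine ⟨σ, h2, fun i => ?_⟩
    have h6 : (P l m)⁻¹ * P l (σ i) = θ (P l i) := by
      rw [h5, h4 l (by simp)]; simp [rebase, hP.1]
    simp only [dualMatrix]
    rw [inv_eq_iff_eq_inv, ← θ.injective.eq_iff, h1 _ rfl, ← h6, inv_mul_eq_iff_eq_mul,
      inv_eq_iff_eq_inv, mul_inv_rev, inv_inv]

end Symmetry

/-! ### Classification of symmetric sandwich matrices -/

namespace RowSymmetric

variable {G : Type*} [Group G] {I Λ : Type*} {P : Matrix Λ I G} {l₀ : Λ} {i₀ : I}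

theorem exists_permute (h : RowSymmetric P l₀ i₀) (F : Finset Λ) (τ : Equiv.Perm Λ) (i : I) :
    ∃ k, (k = i₀ ↔ i = i₀) ∧ ∀ l ∈ F, P l k = P (τ l) i * (P (τ l₀) i)⁻¹ :=
  h.permute F τ τ.injective.injOn i

theorem exists_permute_of_fixed (h : RowSymmetric P l₀ i₀) (F : Finset Λ) {τ : Equiv.Perm Λ}
    (hτ : τ l₀ = l₀) (i : I) :
    ∃ k, (k = i₀ ↔ i = i₀) ∧ ∀ l ∈ F, P l k = P (τ l) i := by
  obtain ⟨k, hk, hk'⟩ := h.exists_permute F τ i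
  exact ⟨k, hk, fun l hl => by rw [hk' l hl, hτ, h.norm.1]; simp⟩

/-- All rows other than the base row have the same entries. -/
theorem row_transfer (h : RowSymmetric P l₀ i₀) {l m : Λ} (hl : l ≠ l₀) (hm : m ≠ l₀) (i : I) :
    ∃ k, (k = i₀ ↔ i = i₀) ∧ P l k = P m i := by
  classical
  obtain ⟨k, hk, hk'⟩ := h.exists_permute_of_fixed {l} (τ := Equiv.swap l m)
    (Equiv.swap_apply_of_ne_of_ne hl.symm hm.symm) i
  exact ⟨k, hk, by rw [hk' l (by simp), Equiv.swap_apply_left]⟩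

theorem row_surjOn (h : RowSymmetric P l₀ i₀) {l : Λ} (hl : l ≠ l₀) {g : G}
    (hg : g ∈ entrySet P) : ∃ i, P l i = g := by
  obtain ⟨m, i, rfl⟩ := hg
  by_cases hm : m = l₀
  · exact ⟨i₀, by rw [hm, h.norm.1, h.norm.2]⟩
  · obtain ⟨k, -, hk⟩ := h.row_transfer hl hm i
    exact ⟨k, hk⟩

theorem entrySet_div_mem (h : RowSymmetric P l₀ i₀) {c d : G} (hc : c ∈ entrySet P)
    (hd : d ∈ entrySet P) : c⁻¹ * d ∈ entrySet P := by
  obtain ⟨l, j, rfl⟩ := hc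
  by_cases hl : l = l₀
  · rw [hl, h.norm.1]; simpa using hd
  · obtain ⟨i, rfl⟩ := h.row_surjOn hl hd
    obtain ⟨k, -, hk⟩ := h.quot {l} i j
    exact ⟨l, k, hk l (by simp)⟩

theorem one_mem_entrySet (h : RowSymmetric P l₀ i₀) : 1 ∈ entrySet P := ⟨l₀, i₀, h.norm.1 _⟩

/-- The entries of the sandwich matrix form a subgroup. -/
def entrySubgroup (h : RowSymmetric P l₀ i₀) : Subgroup G where
  carrier := entrySet P
  one_mem' := h.one_mem_entrySet
  inv_mem' hc := by simpa using h.entrySet_div_mem hc h.one_mem_entrySet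
  mul_mem' {c d} hc hd := by
    have : c⁻¹ ∈ entrySet P := by simpa using h.entrySet_div_mem hc h.one_mem_entrySet
    simpa using h.entrySet_div_mem this hd

theorem entrySet_dual (h : RowSymmetric P l₀ i₀) : entrySet (dualMatrix P) = entrySet P := by
  ext g
  constructor
  · rintro ⟨i, l, rfl⟩
    exact h.entrySubgroup.inv_mem ⟨l, i, rfl⟩
  · intro hg
    obtain ⟨l, i, hli⟩ := h.entrySubgroup.inv_mem hg
    exact ⟨i, l, by rw [dualMatrix, hli, inv_inv]⟩

theorem column_surjOn (h : RowSymmetric P l₀ i₀) (h' : RowSymmetric (dualMatrix P) i₀ l₀) {i : I}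
    (hi : i ≠ i₀) {g : G} (hg : g ∈ entrySet P) : ∃ l, P l i = g := by
  obtain ⟨l, hl⟩ := h'.row_surjOn hi (g := g⁻¹)
    (by rw [h.entrySet_dual]; exact h.entrySubgroup.inv_mem hg)
  exact ⟨l, inv_injective hl⟩

section NoTrivialEntry

/-! #### Matrices without trivial entries off the base row and column -/

theorem row_injective (h : RowSymmetric P l₀ i₀) (h1 : ∀ l ≠ l₀, ∀ i ≠ i₀, P l i ≠ 1) {l : Λ}
    (hl : l ≠ l₀) : Function.Injective (P l) := by
  intro i j hij
  obtain ⟨k, hk, hk'⟩ := h.quot {l} i j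
  refine hk.1 (by_contra fun hk0 => h1 l hl k hk0 ?_)
  rw [hk' l (by simp), hij, inv_mul_cancel]

theorem column_injective (h' : RowSymmetric (dualMatrix P) i₀ l₀)
    (h1 : ∀ l ≠ l₀, ∀ i ≠ i₀, P l i ≠ 1) {i : I} (hi : i ≠ i₀) :
    Function.Injective (fun l => P l i) := by
  intro l m hlm
  refine h'.row_injective (fun i hi l hl => ?_) hi (a₁ := l) (a₂ := m) ?_
  · exact inv_ne_one.2 (h1 l hl i hi)
  · exact congrArg (·⁻¹) hlm

/-- There are at most two rows other than the base row: permuting three of them cyclically and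
exchanging two of them would lead to the same column. -/
theorem not_three_rows (h : RowSymmetric P l₀ i₀) (h' : RowSymmetric (dualMatrix P) i₀ l₀)
    (h1 : ∀ l ≠ l₀, ∀ i ≠ i₀, P l i ≠ 1) {i : I} (hi : i ≠ i₀) {l m n : Λ} (hl : l ≠ l₀)
    (hm : m ≠ l₀) (hn : n ≠ l₀) (hlm : l ≠ m) (hln : l ≠ n) (hmn : m ≠ n) : False := by
  classical
  have e0 : Equiv.swap l m l₀ = l₀ := Equiv.swap_apply_of_ne_of_ne hl.symm hm.symm
  have e1 : Equiv.swap m n l₀ = l₀ := Equiv.swap_apply_of_ne_of_ne hm.symm hn.symm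
  obtain ⟨k, -, hk⟩ := h.exists_permute_of_fixed {l, m} e0 i
  obtain ⟨k', -, hk'⟩ := h.exists_permute_of_fixed {l, m}
    (τ := (Equiv.swap m n).trans (Equiv.swap l m)) (by simp [e0, e1]) i
  have a1 := hk l (by simp)
  have a2 := hk m (by simp)
  have b1 := hk' l (by simp)
  have b2 := hk' m (by simp)
  rw [Equiv.swap_apply_left] at a1
  rw [Equiv.swap_apply_right] at a2
  rw [Equiv.trans_apply, Equiv.swap_apply_of_ne_of_ne hlm hln, Equiv.swap_apply_left] at b1
  rw [Equiv.trans_apply, Equiv.swap_apply_left, Equiv.swap_apply_of_ne_of_ne hln.symm hmn.symm]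
    at b2
  have hkk : k = k' := h.row_injective h1 hl (a1.trans b1.symm)
  subst hkk
  exact hln (column_injective h' h1 hi (a2.symm.trans b2))

/-- Each row other than the base row is a bijection onto the subgroup of entries. -/
noncomputable def rowEquiv (h : RowSymmetric P l₀ i₀) (h1 : ∀ l ≠ l₀, ∀ i ≠ i₀, P l i ≠ 1) {l : Λ}
    (hl : l ≠ l₀) : I ≃ h.entrySubgroup :=
  Equiv.ofBijective (fun i => ⟨P l i, ⟨l, i, rfl⟩⟩)
    ⟨fun _ _ hij => h.row_injective h1 hl (congrArg Subtype.val hij), fun g => by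
      obtain ⟨i, hi⟩ := h.row_surjOn hl g.2
      exact ⟨i, Subtype.ext hi⟩⟩

/-- Each column other than the base column is a bijection onto the subgroup of entries. -/
noncomputable def columnEquiv (h : RowSymmetric P l₀ i₀)
    (h' : RowSymmetric (dualMatrix P) i₀ l₀) (h1 : ∀ l ≠ l₀, ∀ i ≠ i₀, P l i ≠ 1) {i : I}
    (hi : i ≠ i₀) : Λ ≃ h.entrySubgroup :=
  Equiv.ofBijective (fun l => ⟨P l i, ⟨l, i, rfl⟩⟩)
    ⟨fun _ _ hij => column_injective h' h1 hi (congrArg Subtype.val hij), fun g => by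
      obtain ⟨l, hl⟩ := h.column_surjOn h' hi g.2
      exact ⟨l, Subtype.ext hl⟩⟩

/-- Without trivial entries off the base row and column, the matrix has two or three rows. -/
theorem card_eq_two_or_three (h : RowSymmetric P l₀ i₀) (h' : RowSymmetric (dualMatrix P) i₀ l₀)
    (h1 : ∀ l ≠ l₀, ∀ i ≠ i₀, P l i ≠ 1) {i : I} (hi : i ≠ i₀) {l : Λ} (hl : l ≠ l₀) :
    Nat.card Λ = 2 ∨ Nat.card Λ = 3 := by
  classical
  by_cases hm : ∃ m, m ≠ l₀ ∧ m ≠ l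
  · obtain ⟨m, hm, hml⟩ := hm
    right
    have : (Set.univ : Set Λ) = ({l₀, l, m} : Finset Λ) := by
      ext n
      simp only [Set.mem_univ, Finset.coe_insert, Finset.coe_singleton, Set.mem_insert_iff,
        Set.mem_singleton_iff, true_iff]
      by_contra! hn
      exact h.not_three_rows h' h1 hi hl hm hn.1 hml.symm hn.2.1.symm hn.2.2.symm
    rw [← Set.ncard_univ, this, Set.ncard_coe_finset, Finset.card_eq_three]
    exact ⟨l₀, l, m, hl.symm, hm.symm, hml.symm, rfl⟩
  · push Not at hm
    left
    have : (Set.univ : Set Λ) = ({l₀, l} : Finset Λ) := by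
      ext n
      simp only [Set.mem_univ, Finset.coe_insert, Finset.coe_singleton, Set.mem_insert_iff,
        Set.mem_singleton_iff, true_iff]
      exact or_iff_not_imp_left.2 (hm n)
    rw [← Set.ncard_univ, this, Set.ncard_coe_finset, Finset.card_pair hl.symm]

end NoTrivialEntry

section TrivialEntry

/-! #### Matrices with a trivial entry off the base row and column -/

/-- The restrictions of the columns to a finite set of rows form a group. -/
def columnSubgroup (h : RowSymmetric P l₀ i₀) (F : Finset Λ) : Subgroup (F → G) where
  carrier := {f | ∃ k, ∀ l : F, f l = P l k}
  one_mem' := ⟨i₀, fun l => (h.norm.2 l).symm⟩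
  inv_mem' := by
    rintro f ⟨j, hj⟩
    obtain ⟨k, -, hk⟩ := h.quot F i₀ j
    exact ⟨k, fun l => by rw [hk l l.2, h.norm.2, mul_one, Pi.inv_apply, hj]⟩
  mul_mem' := by
    rintro f g ⟨i, hi⟩ ⟨j, hj⟩
    obtain ⟨k, -, hk⟩ := h.quot F i₀ i
    obtain ⟨n, -, hn⟩ := h.quot F j k
    exact ⟨n, fun l => by
      rw [hn l l.2, hk l l.2, h.norm.2, mul_one, Pi.mul_apply, hi, hj, inv_inv]⟩

theorem exists_column_div (h : RowSymmetric P l₀ i₀) (F : Finset Λ) (i j : I) :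
    ∃ k, ∀ l ∈ F, P l k = P l i * (P l j)⁻¹ := by
  have hi : (fun l : F => P l i) ∈ h.columnSubgroup F := ⟨i, fun _ => rfl⟩
  have hj : (fun l : F => P l j) ∈ h.columnSubgroup F := ⟨j, fun _ => rfl⟩
  obtain ⟨k, hk⟩ := (h.columnSubgroup F).mul_mem hi ((h.columnSubgroup F).inv_mem hj)
  exact ⟨k, fun l hl => (hk ⟨l, hl⟩).symm⟩

/-- If an entry `c` of row `l` and an entry `d` of row `m` share a column, then `c * d⁻¹` occurs in
row `l` in a column whose entry in a third row `n` is trivial: divide the column by its image under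
exchanging `l` and `m`. -/
theorem exists_column_ratio (h : RowSymmetric P l₀ i₀) {l m n : Λ} (hl : l ≠ l₀) (hm : m ≠ l₀)
    (hln : l ≠ n) (hmn : m ≠ n) (i : I) :
    ∃ k, P l k = P l i * (P m i)⁻¹ ∧ P n k = 1 := by
  classical
  obtain ⟨j, -, hj⟩ := h.exists_permute_of_fixed {l, n} (τ := Equiv.swap l m)
    (Equiv.swap_apply_of_ne_of_ne hl.symm hm.symm) i
  obtain ⟨k, hk⟩ := h.exists_column_div {l, n} i j
  refine ⟨k, ?_, ?_⟩
  · rw [hk l (by simp), hj l (by simp), Equiv.swap_apply_left]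
  · rw [hk n (by simp), hj n (by simp), Equiv.swap_apply_of_ne_of_ne hln.symm hmn.symm,
      mul_inv_cancel]

/-- If there are at least three rows other than the base row, then any entry occurs in one of two
given rows in a column where the other row has a trivial entry. -/
theorem exists_column_pair (h : RowSymmetric P l₀ i₀) {l m n : Λ} (hl : l ≠ l₀) (hm : m ≠ l₀)
    (hlm : l ≠ m) (hln : l ≠ n) (hmn : m ≠ n) {c : G} (hc : c ∈ entrySet P) :
    ∃ k, P l k = c ∧ P n k = 1 := by
  classical
  obtain ⟨i, hi⟩ := h.row_surjOn hl (h.entrySubgroup.inv_mem hc)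
  -- with `(c⁻¹, d)` also `(d⁻¹, c⁻¹ * d⁻¹)` is a pair of entries in rows `l` and `m`
  obtain ⟨j, -, hj⟩ := h.exists_permute {l, m}
    ((Equiv.swap l₀ l).trans (Equiv.swap l m)) i
  have e1 := hj l (by simp)
  have e2 := hj m (by simp)
  simp only [Equiv.trans_apply, Equiv.swap_apply_left, Equiv.swap_apply_right] at e1 e2
  rw [Equiv.swap_apply_of_ne_of_ne hl.symm hm.symm, h.norm.1, one_mul] at e1
  rw [Equiv.swap_apply_of_ne_of_ne hm hlm.symm, Equiv.swap_apply_right, hi] at e2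
  obtain ⟨k, hk1, hk2⟩ := h.exists_column_ratio hl hm hln hmn j
  exact ⟨k, by rw [hk1, e1, e2]; simp, hk2⟩

/-- If there are at least three rows other than the base row, then all assignments of entries to
finitely many, but not all, of these rows are realised by a column. -/
theorem exists_column (h : RowSymmetric P l₀ i₀)
    (h3 : ∀ l m : Λ, ∃ n, n ≠ l₀ ∧ n ≠ l ∧ n ≠ m) {F : Finset Λ} (hF : l₀ ∉ F) {n : Λ}
    (hn : n ∉ F) (hn0 : n ≠ l₀) (α : Λ → G) (hα : ∀ l ∈ F, α l ∈ entrySet P) :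
    ∃ i, ∀ l ∈ F, P l i = α l := by
  classical
  suffices hmem : (fun l : F => α l) ∈ h.columnSubgroup F by
    obtain ⟨i, hi⟩ := hmem
    exact ⟨i, fun l hl => (hi ⟨l, hl⟩).symm⟩
  apply Subgroup.pi_mem_of_mulSingle_mem
  rintro ⟨l, hl⟩
  have hl0 : l ≠ l₀ := fun e => hF (e ▸ hl)
  have hln : l ≠ n := fun e => hn (e ▸ hl)
  obtain ⟨m, hm0, hml, hmn⟩ := h3 l n
  obtain ⟨i, hi1, hi2⟩ := h.exists_column_pair hl0 hm0 hml.symm hln hmn (hα l hl)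
  obtain ⟨j, -, hj⟩ := h.exists_permute_of_fixed F (τ := Equiv.swap l n)
    (Equiv.swap_apply_of_ne_of_ne hl0.symm hn0.symm) i
  obtain ⟨k, hk⟩ := h.exists_column_div F i j
  refine ⟨k, fun x => ?_⟩
  rw [hk x x.2, hj x x.2]
  by_cases hx : x = ⟨l, hl⟩
  · subst hx
    simp [hi1, hi2]
  · have hx' : (x : Λ) ≠ l := fun e => hx (Subtype.ext e)
    have hxn : (x : Λ) ≠ n := fun e => hn (e ▸ x.2)
    rw [Pi.mulSingle_eq_of_ne hx, Equiv.swap_apply_of_ne_of_ne hx' hxn, mul_inv_cancel]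

theorem exists_one_in_column (h' : RowSymmetric (dualMatrix P) i₀ l₀)
    (h1 : ∃ l ≠ l₀, ∃ i ≠ i₀, P l i = 1) {j : I} (hj : j ≠ i₀) :
    ∃ l ≠ l₀, P l j = 1 := by
  obtain ⟨l, hl, i, hi, hli⟩ := h1
  obtain ⟨k, hk, hk'⟩ := h'.row_transfer hj hi l
  exact ⟨k, fun e => hl (hk.1 e), inv_injective (hk'.trans (congrArg _ hli))⟩

/-- In a column other than the base column all entries occur equally often. -/
theorem fibre_equiv (h : RowSymmetric P l₀ i₀) (h' : RowSymmetric (dualMatrix P) i₀ l₀)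
    {j : I} (hj : j ≠ i₀) {a : G} (ha : a ∈ entrySet P) :
    ∃ τ : Λ ≃ Λ, ∀ l, P l j = 1 ↔ P (τ l) j = a := by
  obtain ⟨m, hm⟩ := h.column_surjOn h' hj ha
  obtain ⟨τ, -, hτ⟩ := h.fibre j m 1
  exact ⟨τ, fun l => by rw [hτ, one_mul, hm]⟩

/-- Two rows with trivial entry and two rows with entry `a` in one column leave at least three rows
other than the base row. -/
theorem exists_third_row (h : RowSymmetric P l₀ i₀) (h' : RowSymmetric (dualMatrix P) i₀ l₀)
    (h1 : ∃ l ≠ l₀, ∃ i ≠ i₀, P l i = 1) {a : G} (ha : a ∈ entrySet P)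
    (ha1 : a ≠ 1) (x y : Λ) : ∃ n, n ≠ l₀ ∧ n ≠ x ∧ n ≠ y := by
  obtain ⟨-, -, j, hj, -⟩ := id h1
  obtain ⟨l, hl, hlj⟩ := exists_one_in_column h' h1 hj
  obtain ⟨τ, hτ⟩ := fibre_equiv h h' hj ha
  have a1 := (hτ l₀).1 (h.norm.1 j)
  have a2 := (hτ l).1 hlj
  have ne : ∀ m, P m j = a → m ≠ l₀ ∧ m ≠ l := fun m hm =>
    ⟨fun e => ha1 (by rw [← hm, e, h.norm.1]), fun e => ha1 (by rw [← hm, e, hlj])⟩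
  have hτl : τ l ≠ τ l₀ := fun e => hl (τ.injective e)
  obtain ⟨b1, b2⟩ := ne _ a1
  obtain ⟨b3, b4⟩ := ne _ a2
  by_contra! hc
  have c1 := hc l hl
  have c2 := hc _ b1
  have c3 := hc _ b3
  by_cases hx : l = x
  · exact hτl ((c3 (hx ▸ b4)).trans (c2 (hx ▸ b2)).symm)
  · have hy := c1 hx
    have d2 := not_imp_comm.1 c2 (hy ▸ b2)
    have d3 := not_imp_comm.1 c3 (hy ▸ b4)
    exact hτl (d3.trans d2.symm)

/-- A nontrivial matrix of this kind with finitely many rows has four rows and two different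
entries, and each column other than the base column has one trivial entry off the base row. The
column used has two trivial entries only, while the fibres of each column have equal size. -/
theorem of_finite (h : RowSymmetric P l₀ i₀) (h' : RowSymmetric (dualMatrix P) i₀ l₀)
    [Finite Λ] (h1 : ∃ l ≠ l₀, ∃ i ≠ i₀, P l i = 1) {a : G}
    (ha : a ∈ entrySet P) (ha1 : a ≠ 1) :
    Nat.card Λ = 4 ∧ entrySet P = {1, a} ∧ ∀ j ≠ i₀, ∃! l, l ≠ l₀ ∧ P l j = 1 := by
  classical
  have := Fintype.ofFinite Λ
  have h3 := exists_third_row h h' h1 ha ha1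
  have hfib : ∀ {j : I}, j ≠ i₀ → ∀ {b : G}, b ∈ entrySet P →
      (Finset.univ.filter fun l => P l j = 1).card =
        (Finset.univ.filter fun l => P l j = b).card := by
    intro j hj b hb
    obtain ⟨τ, hτ⟩ := fibre_equiv h h' hj hb
    exact Finset.card_equiv τ fun l => by simp [hτ]
  have htwo : ∀ {j : I}, j ≠ i₀ → 2 ≤ (Finset.univ.filter fun l => P l j = 1).card := by
    intro j hj
    obtain ⟨l, hl, hlj⟩ := exists_one_in_column h' h1 hj
    rw [← Finset.card_pair hl.symm]
    apply Finset.card_le_card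
    intro x hx
    simp only [Finset.mem_insert, Finset.mem_singleton] at hx
    rcases hx with rfl | rfl
    · simp [h.norm.1]
    · simp [hlj]
  -- a column that has the entry `a` in all rows but the base row and one other row
  obtain ⟨n, hn, -⟩ := h3 l₀ l₀
  obtain ⟨m, hm, hmn, -⟩ := h3 n n
  set F : Finset Λ := (Finset.univ.erase l₀).erase n with hF
  obtain ⟨j, hj⟩ := h.exists_column h3 (F := F) (n := n) (by simp [hF]) (by simp [hF]) hn
    (fun _ => a) (fun _ _ => ha)
  have hmem : ∀ l, l ≠ n → l ≠ l₀ → P l j = a := fun l h1 h2 => hj l (by simp [hF, h1, h2])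
  have hj0 : j ≠ i₀ := fun e => ha1 (by rw [← hmem m hmn hm, e, h.norm.2])
  have hsub : (Finset.univ.filter fun l => P l j = 1) ⊆ {l₀, n} := by
    intro l hl
    simp only [Finset.mem_filter, Finset.mem_univ, true_and] at hl
    simp only [Finset.mem_insert, Finset.mem_singleton]
    by_contra! hc
    exact ha1 (by rw [← hmem l hc.2 hc.1, hl])
  have heq := Finset.eq_of_subset_of_card_le hsub
    ((Finset.card_le_two).trans (htwo hj0))
  have hnj : P n j = 1 := by
    have : n ∈ Finset.univ.filter fun l => P l j = 1 := by rw [heq]; simp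
    simpa using this
  have hent : entrySet P = {1, a} := by
    apply Set.Subset.antisymm
    · intro g hg
      obtain ⟨l, rfl⟩ := h.column_surjOn h' hj0 hg
      by_cases hl0 : l = l₀
      · left; rw [hl0, h.norm.1]
      by_cases hln : l = n
      · left; rw [hln, hnj]
      · right; exact hmem l hln hl0
    · rintro g (rfl | rfl)
      exacts [h.one_mem_entrySet, ha]
  have hval : ∀ (l : Λ) (i : I), P l i = a ↔ ¬ P l i = 1 := fun l i => by
    have : P l i ∈ ({1, a} : Set G) := hent ▸ ⟨l, i, rfl⟩
    rcases this with e | e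
    · simp [e, ha1.symm]
    · rw [Set.mem_singleton_iff] at e
      simp [e, ha1]
  have hsum : ∀ i ≠ i₀, 2 * (Finset.univ.filter fun l => P l i = 1).card = Fintype.card Λ := by
    intro i hi
    rw [two_mul]
    nth_rewrite 2 [hfib hi ha]
    simp only [hval]
    rw [Finset.card_filter_add_card_filter_not, Finset.card_univ]
  have hcard : Fintype.card Λ = 4 := by
    rw [← hsum j hj0, heq, Finset.card_pair hn.symm]
  refine ⟨by rw [Nat.card_eq_fintype_card, hcard], hent, fun i hi => ?_⟩
  obtain ⟨l, hl, hli⟩ := exists_one_in_column h' h1 hi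
  refine ⟨l, ⟨hl, hli⟩, fun x hx => ?_⟩
  have hc : (Finset.univ.filter fun l => P l i = 1).card ≤ 2 := by
    have := hsum i hi
    omega
  by_contra hxl
  have : ({l₀, l, x} : Finset Λ).card ≤ 2 := by
    refine (Finset.card_le_card ?_).trans hc
    intro y hy
    simp only [Finset.mem_insert, Finset.mem_singleton] at hy
    rcases hy with rfl | rfl | rfl
    · simp [h.norm.1]
    · simp [hli]
    · simp [hx.2]
  rw [Finset.card_eq_three.2 ⟨l₀, l, x, hl.symm, hx.1.symm, Ne.symm hxl, rfl⟩] at this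
  omega

/-- A matrix with finitely many rows has finitely many columns. -/
theorem finite_columns (h : RowSymmetric P l₀ i₀) (h' : RowSymmetric (dualMatrix P) i₀ l₀)
    [Finite Λ] (h1 : ∃ l ≠ l₀, ∃ i ≠ i₀, P l i = 1) {a : G}
    (ha : a ∈ entrySet P) (ha1 : a ≠ 1) : Finite I := by
  classical
  have := Fintype.ofFinite Λ
  obtain ⟨-, hent, -⟩ := of_finite h h' h1 ha ha1
  have hfin : Finite (entrySet P) := by rw [hent]; infer_instance
  refine Finite.of_injective (fun i (l : Λ) => (⟨P l i, l, i, rfl⟩ : entrySet P)) ?_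
  intro i j hij
  obtain ⟨k, hk, hk'⟩ := h.quot Finset.univ i j
  refine hk.1 (by_contra fun hk0 => ?_)
  obtain ⟨l, hl⟩ := h.column_surjOn h' hk0 ha
  apply ha1
  have : P l i = P l j := congrArg Subtype.val (congrFun hij l)
  rw [← hl, hk' l (Finset.mem_univ _), this, inv_mul_cancel]

/-- In a matrix with infinitely many rows, all assignments of entries to finitely many rows are
realised by columns other than the base column. -/
theorem exists_column_of_infinite (h : RowSymmetric P l₀ i₀)
    (h' : RowSymmetric (dualMatrix P) i₀ l₀) [Infinite Λ]
    (h1 : ∃ l ≠ l₀, ∃ i ≠ i₀, P l i = 1) {a : G} (ha : a ∈ entrySet P) (ha1 : a ≠ 1) {F : Finset Λ} (hF : l₀ ∉ F) (α : Λ → G)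
    (hα : ∀ l ∈ F, α l ∈ entrySet P) : ∃ i ≠ i₀, ∀ l ∈ F, P l i = α l := by
  classical
  obtain ⟨n, hn⟩ := Infinite.exists_notMem_finset (insert l₀ F)
  obtain ⟨m, hm⟩ := Infinite.exists_notMem_finset (insert n (insert l₀ F))
  simp only [Finset.mem_insert, not_or] at hn hm
  obtain ⟨i, hi⟩ := h.exists_column (exists_third_row h h' h1 ha ha1) (F := insert n F) (n := m)
    (by simp [hF, Ne.symm hn.1]) (by simp [hm.1, hm.2.2]) hm.2.1
    (Function.update α n a) (by
      intro l hl
      by_cases e : l = n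
      · simpa [e] using ha
      · rw [Function.update_of_ne e]
        exact hα l ((Finset.mem_insert.1 hl).resolve_left e))
  refine ⟨i, fun e => ha1 ?_, fun l hl => ?_⟩
  · have := hi n (by simp)
    rw [e, h.norm.2, Function.update_self] at this
    exact this.symm
  · rw [hi l (Finset.mem_insert_of_mem hl), Function.update_of_ne]
    rintro rfl
    exact hn.2 hl

end TrivialEntry

end RowSymmetric

/-! ### Homogeneous semigroups belong to the list -/

section Forward

open ReesMatrix

theorem ReesMatrix.countable_index {G I Λ : Type*} [Group G] {P : Matrix Λ I G} (l₀ : Λ) (i₀ : I)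
    [Countable (ReesMatrix P)] : Countable G ∧ Countable I ∧ Countable Λ :=
  ⟨Function.Injective.countable (f := fun g => (⟨i₀, g, l₀⟩ : ReesMatrix P))
      fun _ _ h => congrArg ReesMatrix.elt h,
    Function.Injective.countable (f := fun i => (⟨i, 1, l₀⟩ : ReesMatrix P))
      fun _ _ h => congrArg ReesMatrix.left h,
    Function.Injective.countable (f := fun l => (⟨i₀, 1, l⟩ : ReesMatrix P))
      fun _ _ h => congrArg ReesMatrix.right h⟩

theorem exists_equiv_fin_zero {I : Type*} {n : ℕ} [NeZero n] (hI : Nat.card I = n) (i₀ : I) :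
    ∃ e : I ≃ Fin n, e i₀ = 0 := by
  have : Finite I := Nat.finite_of_card_ne_zero (hI ▸ NeZero.ne n)
  let e := Finite.equivFinOfCardEq hI
  exact ⟨e.trans (Equiv.swap (e i₀) 0), by simp⟩

theorem nonempty_mulEquiv_zmod {H : Type*} [Group H] {p : ℕ} [Fact p.Prime]
    (hH : Nat.card H = p) : Nonempty (H ≃* Multiplicative (ZMod p)) :=
  ⟨mulEquivOfPrimeCardEq (p := p) hH (by simp)⟩

variable {G : Type u} [Group G]

/-- A Rees matrix semigroup with trivial matrix is a direct product of its group with a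
rectangular band. -/
def ReesMatrix.equivProd {I Λ : Type*} {P : Matrix Λ I G} (h : ∀ l i, P l i = 1) :
    ReesMatrix P ≃* G × RectangularBand I Λ where
  toFun x := (x.elt, ⟨x.left, x.right⟩)
  invFun y := ⟨y.2.fst, y.1, y.2.snd⟩
  left_inv _ := rfl
  right_inv _ := rfl
  map_mul' x y := by
    refine Prod.ext ?_ rfl
    simp [h]

/-- A normalised Rees matrix semigroup with index sets of cardinality `n` can be indexed
by `Fin n`. -/
theorem exists_reindex {I Λ : Type*} {P : Matrix Λ I G} {l₀ : Λ} {i₀ : I}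
    (hP : IsNormalised P l₀ i₀) {n : ℕ} [NeZero n] (hI : Nat.card I = n) (hΛ : Nat.card Λ = n) :
    ∃ (σ : I ≃ Fin n) (τ : Λ ≃ Fin n) (Q : Matrix (Fin n) (Fin n) G), σ i₀ = 0 ∧ τ l₀ = 0 ∧
      IsNormalised Q 0 0 ∧ (∀ l i, P l i = Q (τ l) (σ i)) ∧
      Nonempty (ReesMatrix P ≃* ReesMatrix Q) := by
  obtain ⟨σ, hσ⟩ := exists_equiv_fin_zero hI i₀
  obtain ⟨τ, hτ⟩ := exists_equiv_fin_zero hΛ l₀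
  refine ⟨σ, τ, fun l i => P (τ.symm l) (σ.symm i), hσ, hτ, ⟨fun i => ?_, fun l => ?_⟩,
    fun l i => by simp, ⟨mapEquiv (MulEquiv.refl G) σ τ fun l i => by simp⟩⟩
  · simp [← hτ, hP.1]
  · simp [← hσ, hP.2]

theorem dualMatrix_dualMatrix {I Λ : Type*} (P : Matrix Λ I G) :
    dualMatrix (dualMatrix P) = P := by
  ext l i
  simp [dualMatrix]

theorem RowSymmetric.characteristic {I Λ : Type*} {P : Matrix Λ I G} {l₀ : Λ} {i₀ : I}
    (h : RowSymmetric P l₀ i₀) (hS : IsHomogeneousSemigroup (ReesMatrix P)) :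
    h.entrySubgroup.Characteristic :=
  Subgroup.characteristic_iff_le_comap.2 fun θ g hg => (hS.group h.norm).2 θ g hg

theorem RowSymmetric.isReesTypeTwo {S : Type u} [Semigroup S] {P : Matrix (Fin 2) (Fin 2) G}
    (h : RowSymmetric P 0 0) (e : S ≃* ReesMatrix P) (hc : Nat.card h.entrySubgroup = 2) :
    IsReesTypeTwo S G h.entrySubgroup := by
  refine ⟨P, P 1 1, h.norm, ⟨e⟩, ?_, nonempty_mulEquiv_zmod hc, rfl⟩
  ext g
  constructor
  · rintro ⟨l, i, rfl⟩
    fin_cases l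
    · exact Or.inl (h.norm.1 i)
    · fin_cases i
      · exact Or.inl (h.norm.2 1)
      · exact Or.inr rfl
  · rintro (rfl | rfl)
    · exact one_mem _
    · exact ⟨1, 1, rfl⟩

theorem RowSymmetric.isReesTypeThree {S : Type u} [Semigroup S] {P : Matrix (Fin 3) (Fin 3) G}
    (h : RowSymmetric P 0 0) (h' : RowSymmetric (dualMatrix P) 0 0)
    (h1 : ∀ l ≠ 0, ∀ i ≠ 0, P l i ≠ 1) (e : S ≃* ReesMatrix P)
    (hc : Nat.card h.entrySubgroup = 3) : IsReesTypeThree S G h.entrySubgroup := by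
  have h11 : P 1 1 ≠ 1 := h1 1 (by decide) 1 (by decide)
  set a := P 1 1 with ha
  have haH : a ∈ h.entrySubgroup := ⟨1, 1, rfl⟩
  have ha' : a⁻¹ ∈ h.entrySubgroup := inv_mem haH
  have hcube : a ^ 3 = 1 := by
    have : (⟨a, haH⟩ : h.entrySubgroup) ^ 3 = 1 := orderOf_dvd_iff_pow_eq_one.1
      ((orderOf_dvd_natCard _).trans hc.dvd)
    exact congrArg Subtype.val this
  have hinv : a ≠ a⁻¹ := fun e => h11 (by
    have h2 : a * a = 1 := by nth_rewrite 2 [e]; exact mul_inv_cancel a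
    rw [pow_succ, pow_two, h2, one_mul] at hcube
    exact hcube)
  have hH : (h.entrySubgroup : Set G) = {1, a, a⁻¹} := by
    symm
    apply Set.eq_of_subset_of_ncard_le
    · rintro g (rfl | rfl | rfl)
      exacts [one_mem _, haH, ha']
    · rw [Set.ncard_eq_three.2 ⟨1, a, a⁻¹, h11.symm, (inv_ne_one.2 h11).symm, hinv, rfl⟩]
      exact hc.le
    · exact Nat.finite_of_card_ne_zero (α := h.entrySubgroup) (by rw [hc]; decide)
  refine ⟨P, a, h.norm, ⟨e⟩, hH, nonempty_mulEquiv_zmod hc, ?_, ?_, ?_⟩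
  · ext g
    constructor
    · rintro ⟨l, i, rfl⟩
      have : P l i ∈ ({1, a, a⁻¹} : Set G) := hH ▸ ⟨l, i, rfl⟩
      exact this.resolve_left (h1 l l.2 i i.2)
    · intro hg
      obtain ⟨i, hi⟩ := h.row_surjOn (l := 1) (by decide) (g := g)
        (hH.ge (Set.mem_insert_of_mem _ hg))
      refine ⟨⟨1, by decide⟩, ⟨i, ?_⟩, hi⟩
      rintro rfl
      rw [h.norm.2] at hi
      rcases hg with e | e
      · exact h11 (e.symm.trans hi.symm)
      · exact h11 (inv_eq_one.1 (e.symm.trans hi.symm))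
  · intro l
    obtain ⟨i, hi⟩ := h.row_surjOn l.2 haH
    refine ⟨⟨i, ?_⟩, hi, fun j hj => Subtype.ext (h.row_injective h1 l.2 (hj.trans hi.symm))⟩
    rintro rfl
    exact h11 (hi.symm.trans (h.norm.2 _))
  · intro i
    obtain ⟨l, hl⟩ := h.column_surjOn h' i.2 haH
    refine ⟨⟨l, ?_⟩, hl, fun j hj =>
      Subtype.ext (column_injective h' h1 i.2 (hj.trans hl.symm))⟩
    rintro rfl
    exact h11 (hl.symm.trans (h.norm.1 _))

theorem RowSymmetric.isReesTypeFour {S : Type u} [Semigroup S] {P : Matrix (Fin 4) (Fin 4) G}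
    (h : RowSymmetric P 0 0) (h' : RowSymmetric (dualMatrix P) 0 0)
    (h1 : ∃ l ≠ 0, ∃ i ≠ 0, P l i = 1) {a : G} (ha : a ∈ entrySet P) (ha1 : a ≠ 1)
    (e : S ≃* ReesMatrix P) : IsReesTypeFour S G h.entrySubgroup := by
  obtain ⟨-, hent, hcol⟩ := h.of_finite h' h1 ha ha1
  have h'' : RowSymmetric (dualMatrix (dualMatrix P)) 0 0 := by rwa [dualMatrix_dualMatrix]
  obtain ⟨l, hl, i, hi, hli⟩ := h1
  obtain ⟨-, -, hrow⟩ := h'.of_finite h'' ⟨i, hi, l, hl, inv_eq_one.2 hli⟩ (a := a)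
    (by rwa [h.entrySet_dual]) ha1
  have hc : Nat.card h.entrySubgroup = 2 := by
    change (entrySet P).ncard = 2
    rw [hent, Set.ncard_pair ha1.symm]
  refine ⟨P, a, h.norm, ⟨e⟩, hent, nonempty_mulEquiv_zmod hc, ?_, ?_, ?_⟩
  · apply Set.Subset.antisymm
    · rintro _ ⟨l, i, rfl⟩
      exact hent ▸ ⟨l, i, rfl⟩
    · rintro g (rfl | rfl)
      · exact ⟨⟨l, hl⟩, ⟨i, hi⟩, hli⟩
      · obtain ⟨m, hm⟩ := h.column_surjOn h' hi ha
        refine ⟨⟨m, ?_⟩, ⟨i, hi⟩, hm⟩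
        rintro rfl
        exact ha1 (hm.symm.trans (h.norm.1 _))
  · rintro ⟨l, hl⟩
    obtain ⟨i, ⟨hi, hli⟩, huniq⟩ := hrow l hl
    exact ⟨⟨i, hi⟩, inv_eq_one.1 hli, fun j hj =>
      Subtype.ext (huniq j ⟨j.2, inv_eq_one.2 hj⟩)⟩
  · rintro ⟨i, hi⟩
    obtain ⟨l, ⟨hl, hli⟩, huniq⟩ := hcol i hi
    exact ⟨⟨l, hl⟩, hli, fun j hj => Subtype.ext (huniq j ⟨j.2, hj⟩)⟩

/-- The column half of genericity, for a matrix with infinitely many rows. -/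
theorem RowSymmetric.exists_generic_column {I Λ : Type*} {P : Matrix Λ I G} {l₀ : Λ} {i₀ : I}
    (h : RowSymmetric P l₀ i₀) (h' : RowSymmetric (dualMatrix P) i₀ l₀) [Infinite Λ]
    (h1 : ∃ l ≠ l₀, ∃ i ≠ i₀, P l i = 1) {a : G} (ha : a ∈ entrySet P) (ha1 : a ≠ 1)
    (s : Finset {l : Λ // l ≠ l₀}) (α : s → entrySet P) :
    ∃ r : {i : I // i ≠ i₀}, ∀ y : s, P y r = α y := by
  classical
  have hinj : Function.Injective fun y : s => y.1.1 := fun x y hxy =>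
    Subtype.ext (Subtype.ext hxy)
  obtain ⟨i, hi, hiα⟩ := h.exists_column_of_infinite h' h1 ha ha1
    (F := s.map (Function.Embedding.subtype _)) (by simp)
    (Function.extend (fun y : s => y.1.1) (fun y => (α y : G)) 1) (by
      intro l hl
      obtain ⟨y, hy, rfl⟩ := Finset.mem_map.1 hl
      have := hinj.extend_apply (fun y => (α y : G)) 1 ⟨y, hy⟩
      simp only at this
      rw [Function.Embedding.subtype_apply, this]
      exact (α ⟨y, hy⟩).2)
  refine ⟨⟨i, hi⟩, fun y => ?_⟩
  exact (hiα _ (Finset.mem_map_of_mem (Function.Embedding.subtype _) y.2)).trans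
    (hinj.extend_apply (fun y => (α y : G)) 1 y)

/-- The infinite case: the matrix is generic over its subgroup of entries. -/
theorem RowSymmetric.isReesGeneric {S : Type u} [Semigroup S]
    {I Λ : Type u} [Countable I] [Countable Λ]
    {P : Matrix Λ I G} {l₀ : Λ} {i₀ : I} (h : RowSymmetric P l₀ i₀)
    (h' : RowSymmetric (dualMatrix P) i₀ l₀) [Infinite Λ]
    (h1 : ∃ l ≠ l₀, ∃ i ≠ i₀, P l i = 1) {a : G} (ha : a ∈ entrySet P) (ha1 : a ≠ 1)
    (e : S ≃* ReesMatrix P) : IsReesGeneric S G h.entrySubgroup := by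
  have h'' : RowSymmetric (dualMatrix (dualMatrix P)) l₀ i₀ := by rwa [dualMatrix_dualMatrix]
  have h1' : ∃ i ≠ i₀, ∃ l ≠ l₀, dualMatrix P i l = 1 := by
    obtain ⟨l, hl, i, hi, hli⟩ := h1
    exact ⟨i, hi, l, hl, inv_eq_one.2 hli⟩
  have ha' : a ∈ entrySet (dualMatrix P) := by rwa [h.entrySet_dual]
  have : Infinite I := by
    by_contra hI
    have := not_infinite_iff_finite.1 hI
    exact not_finite_iff_infinite.2 ‹Infinite Λ› (h'.finite_columns h'' h1' ha' ha1)
  have hne : ∀ (X : Type u) [Infinite X] (x : X), Infinite {y : X // y ≠ x} := fun X _ x =>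
    (Set.finite_singleton x).infinite_compl.to_subtype
  have := hne I i₀
  have := hne Λ l₀
  refine ⟨I, Λ, P, l₀, i₀, h.norm, ⟨e⟩, rfl, fun l i => ⟨l, i, rfl⟩, Cardinal.mk_eq_aleph0 _,
    Cardinal.mk_eq_aleph0 _, fun s α => h.exists_generic_column h' h1 ha ha1 s α, fun s α => ?_⟩
  obtain ⟨l, hl⟩ := h'.exists_generic_column h'' h1' ha' ha1 s
    (fun y => ⟨(α y : G)⁻¹, by rw [h.entrySet_dual]; exact h.entrySubgroup.inv_mem (α y).2⟩)
  exact ⟨l, fun y => inv_injective (hl y)⟩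

/-- A countable homogeneous completely simple semigroup is of one of the five types. -/
theorem IsHomogeneousSemigroup.exists_type {S : Type u} [Semigroup S] [Countable S]
    (hS : IsCompletelySimple S) (hom : IsHomogeneousSemigroup S) :
    ∃ (G : Type u) (_ : Group G) (H : Subgroup G),
      Countable G ∧ IsHomogeneousGroup G ∧ H.Characteristic ∧
      (IsRectangularGroupOver S G ∨ IsReesTypeTwo S G H ∨ IsReesTypeThree S G H ∨
        IsReesTypeFour S G H ∨ IsReesGeneric S G H) := by
  classical
  have hinv := hS.hasRelativeInverses
  obtain ⟨G, _, I, Λ, P, l₀, i₀, hP, ⟨e⟩⟩ := hS.exists_reesMatrix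
  have hhom := hom.of_equiv hinv e
  have h := hhom.rowSymmetric hP
  have h' := hhom.rowSymmetric_dual hP
  have hcount : Countable (ReesMatrix P) := e.symm.injective.countable
  obtain ⟨hG, hI, hΛ⟩ := countable_index (P := P) l₀ i₀
  have hGhom := (hhom.group hP).1
  by_cases hall : ∀ l i, P l i = 1
  · exact ⟨G, _, h.entrySubgroup, hG, hGhom, h.characteristic hhom,
      Or.inl ⟨I, Λ, ⟨i₀⟩, ⟨l₀⟩, ⟨e.trans (equivProd hall)⟩⟩⟩
  push Not at hall
  obtain ⟨l, i, hli⟩ := hall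
  have hl : l ≠ l₀ := fun e => hli (e ▸ h.norm.1 i)
  have hi : i ≠ i₀ := fun e => hli (e ▸ h.norm.2 l)
  by_cases h1 : ∃ l ≠ l₀, ∃ i ≠ i₀, P l i = 1
  · rcases finite_or_infinite Λ with hfin | hinf
    · obtain ⟨hcΛ, -, -⟩ := h.of_finite h' h1 ⟨l, i, rfl⟩ hli
      have := h.finite_columns h' h1 ⟨l, i, rfl⟩ hli
      have h'' : RowSymmetric (dualMatrix (dualMatrix P)) l₀ i₀ := by
        rwa [dualMatrix_dualMatrix]
      obtain ⟨m, hm, j, hj, hmj⟩ := h1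
      obtain ⟨hcI, -, -⟩ := h'.of_finite h'' ⟨j, hj, m, hm, inv_eq_one.2 hmj⟩
        (a := P l i) (by rw [h.entrySet_dual]; exact ⟨l, i, rfl⟩) hli
      obtain ⟨σ, τ, Q, hσ, hτ, hQ, hPQ, ⟨e'⟩⟩ := exists_reindex hP hcI hcΛ
      have hhomQ := hom.of_equiv hinv (e.trans e')
      have k := hhomQ.rowSymmetric hQ
      refine ⟨G, _, k.entrySubgroup, hG, hGhom, k.characteristic hhomQ,
        Or.inr (Or.inr (Or.inr (Or.inl (k.isReesTypeFour (hhomQ.rowSymmetric_dual hQ)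
          ⟨τ m, ?_, σ j, ?_, ?_⟩ (a := P l i) ⟨τ l, σ i, (hPQ l i).symm⟩ hli
          (e.trans e')))))⟩
      · rw [← hτ]; exact τ.injective.ne hm
      · rw [← hσ]; exact σ.injective.ne hj
      · rw [← hPQ, hmj]
    · exact ⟨G, _, h.entrySubgroup, hG, hGhom, h.characteristic hhom,
        Or.inr (Or.inr (Or.inr (Or.inr (h.isReesGeneric h' h1 ⟨l, i, rfl⟩ hli e))))⟩
  · push Not at h1
    have hcI : Nat.card I = Nat.card Λ :=
      (Nat.card_congr (h.rowEquiv h1 hl)).trans (Nat.card_congr (h.columnEquiv h' h1 hi)).symm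
    have hreindex : ∀ n : ℕ, [NeZero n] → Nat.card Λ = n →
        ∃ (Q : Matrix (Fin n) (Fin n) G) (_ : IsNormalised Q 0 0) (_ : S ≃* ReesMatrix Q),
          ∀ l ≠ 0, ∀ i ≠ 0, Q l i ≠ 1 := by
      intro n _ hn
      obtain ⟨σ, τ, Q, hσ, hτ, hQ, hPQ, ⟨e'⟩⟩ := exists_reindex hP (hcI.trans hn) hn
      refine ⟨Q, hQ, e.trans e', fun l hl i hi => ?_⟩
      have := hPQ (τ.symm l) (σ.symm i)
      rw [Equiv.apply_symm_apply, Equiv.apply_symm_apply] at this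
      rw [← this]
      refine h1 _ (fun e => hl ?_) _ (fun e => hi ?_)
      · rw [← hτ, ← e, Equiv.apply_symm_apply]
      · rw [← hσ, ← e, Equiv.apply_symm_apply]
    rcases h.card_eq_two_or_three h' h1 hi hl with hc | hc
    · obtain ⟨Q, hQ, e', hQ1⟩ := hreindex 2 hc
      have hhomQ := hom.of_equiv hinv e'
      have k := hhomQ.rowSymmetric hQ
      exact ⟨G, _, k.entrySubgroup, hG, hGhom, k.characteristic hhomQ,
        Or.inr (Or.inl (k.isReesTypeTwo e'
          (by rw [← Nat.card_congr (k.rowEquiv hQ1 (l := 1) (by decide)), Nat.card_fin])))⟩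
    · obtain ⟨Q, hQ, e', hQ1⟩ := hreindex 3 hc
      have hhomQ := hom.of_equiv hinv e'
      have k := hhomQ.rowSymmetric hQ
      exact ⟨G, _, k.entrySubgroup, hG, hGhom, k.characteristic hhomQ,
        Or.inr (Or.inr (Or.inl (k.isReesTypeThree (hhomQ.rowSymmetric_dual hQ) hQ1 e'
          (by rw [← Nat.card_congr (k.rowEquiv hQ1 (l := 1) (by decide)), Nat.card_fin]))))⟩

end Forward

/-! ### Extending finite partial isomorphisms: trivial matrices and perfect matchings -/

section Extension

open ReesMatrix

/-- An injection defined on a finite subset of `α` extends to a bijection. -/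
theorem exists_equiv_extend {α β : Type*} {s : Set α} (hs : s.Finite) {f : s → β}
    (hf : Function.Injective f) (h : Nonempty (α ≃ β)) : ∃ g : α ≃ β, ∀ x : s, g x = f x := by
  rcases finite_or_infinite α with hα | hα
  · exact Cardinal.extend_function_finite ⟨f, hf⟩ h
  · exact Cardinal.extend_function_of_lt ⟨f, hf⟩
      ((Cardinal.lt_aleph0_iff_set_finite.2 hs).trans_le (Cardinal.aleph0_le_mk α)) h

variable {G : Type*}

/-- The edges of colour `x` of the graph attached to the normalised matrix `P` form a perfect
matching and all other edges have the colour `y`. The matching is extended to the base points. -/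
def IsMatching {I Λ : Type*} (P : Matrix Λ I G) (l₀ : Λ) (i₀ : I) (x y : G) : Prop :=
  x ≠ y ∧ ∃ m : Λ ≃ I, m l₀ = i₀ ∧
    ∀ l ≠ l₀, ∀ i ≠ i₀, (m l = i → P l i = x) ∧ (m l ≠ i → P l i = y)

theorem IsMatching.of_existsUnique {I Λ : Type*} {P : Matrix Λ I G} {l₀ : Λ} {i₀ : I} {x y : G}
    (hxy : x ≠ y) (h : ∀ l ≠ l₀, ∀ i ≠ i₀, P l i = x ∨ P l i = y)
    (hr : ∀ l ≠ l₀, ∃! i, i ≠ i₀ ∧ P l i = x) (hc : ∀ i ≠ i₀, ∃! l, l ≠ l₀ ∧ P l i = x) :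
    IsMatching P l₀ i₀ x y := by
  classical
  have : Nonempty I := ⟨i₀⟩
  choose! f hf hf' using hr
  have hb : Function.Bijective fun l => if l = l₀ then i₀ else f l := by
    constructor
    · intro l m hlm
      simp only at hlm
      split_ifs at hlm with h1 h2 h2
      · rw [h1, h2]
      · exact ((hf m h2).1 hlm.symm).elim
      · exact ((hf l h1).1 hlm).elim
      · exact (hc (f l) (hf l h1).1).unique ⟨h1, (hf l h1).2⟩ ⟨h2, hlm ▸ (hf m h2).2⟩
    · intro i
      by_cases hi : i = i₀
      · exact ⟨l₀, by simp [hi]⟩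
      · obtain ⟨l, ⟨hl, hli⟩, -⟩ := hc i hi
        exact ⟨l, by simp [hl, hf' l hl i ⟨hi, hli⟩]⟩
  refine ⟨hxy, Equiv.ofBijective _ hb, by simp, fun l hl i hi => ?_⟩
  simp only [Equiv.ofBijective_apply, if_neg hl]
  refine ⟨fun e => e ▸ (hf l hl).2, fun e => (h l hl i hi).resolve_left fun hx => ?_⟩
  exact e (hf' l hl i ⟨hi, hx⟩).symm

/-- On two by two vertices the complement of a perfect matching is a perfect matching. -/
theorem IsMatching.swap {P : Matrix (Fin 3) (Fin 3) G} {l₀ i₀ : Fin 3} {x y : G}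
    (h : IsMatching P l₀ i₀ x y) : IsMatching P l₀ i₀ y x := by
  obtain ⟨hxy, m, hm, hP⟩ := h
  have key : ∀ i : Fin 3, ∃ r s : Fin 3, r ≠ s ∧ r ≠ i ∧ s ≠ i ∧ ∀ j, j ≠ i → j = r ∨ j = s := by
    decide
  obtain ⟨r, s, hrs, hr, hs, h2⟩ := key i₀
  refine ⟨hxy.symm, m.trans (Equiv.swap r s), ?_, fun l hl i hi => ?_⟩
  · rw [Equiv.trans_apply, hm, Equiv.swap_apply_of_ne_of_ne hr.symm hs.symm]
  · have hl' : m l ≠ i₀ := fun e => hl (m.injective (e.trans hm.symm))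
    have : Equiv.swap r s (m l) = i ↔ m l ≠ i := by
      rcases h2 _ hl' with e | e <;> rcases h2 _ hi with e' | e' <;> simp [e, e', hrs, hrs.symm]
    rw [Equiv.trans_apply, Ne, this, Ne, not_not]
    exact (hP l hl i hi).symm

variable [Group G]

theorem extendsPartialIsos_one {I Λ : Type*} {P₁ P₂ : Matrix Λ I G} (h₁ : ∀ l i, P₁ l i = 1)
    (h₂ : ∀ l i, P₂ l i = 1) (l₁ l₂ : Λ) (i₁ i₂ : I) :
    ExtendsPartialIsos P₁ l₁ i₁ P₂ l₂ i₂ := by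
  intro J M hi hl σ₀ τ₀ hJ hM hσ hτ _ _ _
  obtain ⟨σ, hσ'⟩ := exists_equiv_extend hJ hσ ⟨Equiv.refl I⟩
  obtain ⟨τ, hτ'⟩ := exists_equiv_extend hM hτ ⟨Equiv.refl Λ⟩
  exact ⟨σ, τ, hσ', hτ', fun l i => by rw [h₁, h₂]⟩

theorem IsMatching.map {I Λ : Type*} {P : Matrix Λ I G} {l₀ : Λ} {i₀ : I} {x y : G}
    (h : IsMatching P l₀ i₀ x y) (θ : G ≃* G) :
    IsMatching (fun l i => θ (P l i)) l₀ i₀ (θ x) (θ y) := by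
  obtain ⟨hxy, m, hm, hP⟩ := h
  exact ⟨θ.injective.ne hxy, m, hm, fun l hl i hi =>
    ⟨fun e => congrArg θ ((hP l hl i hi).1 e), fun e => congrArg θ ((hP l hl i hi).2 e)⟩⟩

/-- Finite partial isomorphisms between perfect matchings extend: first extend the map of the left
vertices to the partners of the right vertices in the domain, then to all left vertices, and
transport the result along the matchings. -/
theorem IsMatching.extendsPartialIsos {I₁ Λ₁ I₂ Λ₂ : Type*} {P₁ : Matrix Λ₁ I₁ G}
    {P₂ : Matrix Λ₂ I₂ G} {l₁ : Λ₁} {i₁ : I₁} {l₂ : Λ₂} {i₂ : I₂} {x y : G}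
    (hP₁ : IsNormalised P₁ l₁ i₁) (hP₂ : IsNormalised P₂ l₂ i₂)
    (h₁ : IsMatching P₁ l₁ i₁ x y) (h₂ : IsMatching P₂ l₂ i₂ x y) (he : Nonempty (Λ₁ ≃ Λ₂)) :
    ExtendsPartialIsos P₁ l₁ i₁ P₂ l₂ i₂ := by
  classical
  intro J M hi hl σ₀ τ₀ hJ hM hσ hτ hσ₀ hτ₀ hστ
  obtain ⟨hxy, m₁, hm₁, h₁⟩ := h₁
  obtain ⟨-, m₂, hm₂, h₂⟩ := h₂
  -- a pair of base points counts as matched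
  have hval : ∀ l ≠ l₁, ∀ i ≠ i₁, ∀ l' ≠ l₂, ∀ i' ≠ i₂,
      (P₁ l i = P₂ l' i' ↔ (m₁ l = i ↔ m₂ l' = i')) := by
    intro l hl i hi l' hl' i' hi'
    by_cases a : m₁ l = i <;> by_cases b : m₂ l' = i'
    · simp [(h₁ l hl i hi).1 a, (h₂ l' hl' i' hi').1 b, a, b]
    · simp [(h₁ l hl i hi).1 a, (h₂ l' hl' i' hi').2 b, a, b, hxy]
    · simp [(h₁ l hl i hi).2 a, (h₂ l' hl' i' hi').1 b, a, b, hxy.symm]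
    · simp [(h₁ l hl i hi).2 a, (h₂ l' hl' i' hi').2 b, a, b]
  have hτb : ∀ l : M, τ₀ l = l₂ ↔ (l : Λ₁) = l₁ := fun l => by
    rw [← hτ₀, hτ.eq_iff, Subtype.ext_iff]
  have hσb : ∀ i : J, σ₀ i = i₂ ↔ (i : I₁) = i₁ := fun i => by
    rw [← hσ₀, hσ.eq_iff, Subtype.ext_iff]
  have hcompat : ∀ (l : M) (i : J), m₁ l = i ↔ m₂ (τ₀ l) = σ₀ i := by
    intro l i
    by_cases hl1 : (l : Λ₁) = l₁
    · rw [(hτb l).2 hl1, hl1, hm₁, hm₂, eq_comm, ← hσb, eq_comm]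
    by_cases hi1 : (i : I₁) = i₁
    · rw [(hσb i).2 hi1, hi1, ← hm₁, ← hm₂, m₁.injective.eq_iff, m₂.injective.eq_iff, hτb]
    · exact (hval l hl1 i hi1 _ (mt (hτb l).1 hl1) _ (mt (hσb i).1 hi1)).1 (hστ l i)
  set s : Set Λ₁ := M ∪ m₁ ⁻¹' J with hs
  have hsf : s.Finite := hM.union (hJ.preimage m₁.injective.injOn)
  have hsJ : ∀ l ∈ s, l ∉ M → m₁ l ∈ J := fun l h h' => h.resolve_left h'
  let g : s → Λ₂ := fun l =>
    if h : (l : Λ₁) ∈ M then τ₀ ⟨l, h⟩ else m₂.symm (σ₀ ⟨m₁ l, hsJ l l.2 h⟩)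
  have hg1 : ∀ (l : s) (h : (l : Λ₁) ∈ M), g l = τ₀ ⟨l, h⟩ := fun l h => by simp [g, h]
  have hg2 : ∀ (l : s) (h : m₁ l ∈ J), m₂ (g l) = σ₀ ⟨m₁ l, h⟩ := fun l h => by
    by_cases h' : (l : Λ₁) ∈ M
    · rw [hg1 l h', ← hcompat]
    · simp [g, h']
  have hg : Function.Injective g := by
    rintro ⟨a, ha⟩ ⟨b, hb⟩ hab
    have hcase : ∀ (a : Λ₁) (ha : a ∈ s) (b : Λ₁) (hb : b ∈ s), g ⟨a, ha⟩ = g ⟨b, hb⟩ →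
        a ∈ M → m₁ b ∈ J → a = b := by
      intro a ha b hb hab h1 h2
      have := hg2 ⟨b, hb⟩ h2
      rw [← hab, hg1 _ h1, ← hcompat] at this
      exact m₁.injective this
    apply Subtype.ext
    rcases id ha with ha' | ha' <;> rcases id hb with hb' | hb'
    · rw [hg1 _ ha', hg1 _ hb'] at hab
      exact (Subtype.mk.inj (hτ hab) :)
    · exact hcase a ha b hb hab ha' hb'
    · exact (hcase b hb a ha hab.symm hb' ha').symm
    · have := congrArg m₂ hab
      rw [hg2 ⟨a, ha⟩ ha', hg2 ⟨b, hb⟩ hb'] at this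
      exact m₁.injective (Subtype.mk.inj (hσ this))
  obtain ⟨τ, hτg⟩ := exists_equiv_extend hsf hg he
  have hτM : ∀ l : M, τ l = τ₀ l := fun l =>
    (hτg ⟨l, Or.inl l.2⟩).trans (hg1 ⟨l, Or.inl l.2⟩ l.2)
  have hσJ : ∀ i : J, m₂ (τ (m₁.symm i)) = σ₀ i := fun i => by
    have h1 : m₁ (m₁.symm i) ∈ J := by rw [Equiv.apply_symm_apply]; exact i.2
    have h2 : m₁.symm i ∈ s := Or.inr h1
    rw [hτg ⟨_, h2⟩, hg2 ⟨_, h2⟩ h1]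
    congr 1
    exact Subtype.ext (m₁.apply_symm_apply _)
  refine ⟨(m₁.symm.trans τ).trans m₂, τ, hσJ, hτM, fun l i => ?_⟩
  have hτ1 : τ l₁ = l₂ := (hτM ⟨l₁, hl⟩).trans hτ₀
  have hσ1 : m₂ (τ (m₁.symm i₁)) = i₂ := (hσJ ⟨i₁, hi⟩).trans hσ₀
  change P₁ l i = P₂ (τ l) (m₂ (τ (m₁.symm i)))
  by_cases hl1 : l = l₁
  · rw [hl1, hτ1, hP₁.1, hP₂.1]
  by_cases hi1 : i = i₁
  · rw [hi1, hσ1, hP₁.2, hP₂.2]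
  refine (hval l hl1 i hi1 _ ?_ _ ?_).2 ?_
  · rw [← hτ1]; exact τ.injective.ne hl1
  · rw [← hσ1]
    exact fun e => hi1 (m₁.symm.injective (τ.injective (m₂.injective e)))
  · rw [m₂.injective.eq_iff, τ.injective.eq_iff, Equiv.eq_symm_apply]

/-- If the graphs attached to all normalisations of `Q` are perfect matchings, in the same pair of
colours up to automorphisms of the group, then each matrix of that form gives a homogeneous
semigroup. -/
theorem IsMatching.isHomogeneousSemigroup {n : ℕ} [NeZero n] {P Q : Matrix (Fin n) (Fin n) G}
    {x y : G} (hG : IsHomogeneousGroup G) (hP : IsNormalised P 0 0) (hPm : IsMatching P 0 0 x y)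
    (hQ : IsNormalised Q 0 0) (hQm : ∀ m j, IsMatching (rebase Q m j) m j x y)
    (hθ : ∀ (θ : G ≃* G) (R : Matrix (Fin n) (Fin n) G) (l i : Fin n),
      IsMatching R l i (θ x) (θ y) → IsMatching R l i x y) :
    IsHomogeneousSemigroup (ReesMatrix P) := by
  have hQhom : IsHomogeneousSemigroup (ReesMatrix Q) := by
    refine ReesMatrix.isHomogeneousSemigroup Q hG fun m j m' j' θ => ?_
    have hn := isNormalised_rebase Q m j
    exact IsMatching.extendsPartialIsos ⟨fun i => by simp [hn.1], fun l => by simp [hn.2]⟩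
      (isNormalised_rebase Q m' j') (hθ θ _ _ _ ((hQm m j).map θ)) (hQm m' j') ⟨Equiv.refl _⟩
  have hQ0 := hQm 0 0
  rw [rebase_self hQ] at hQ0
  obtain ⟨σ, τ, -, -, hστ⟩ := hPm.extendsPartialIsos hP hQ hQ0 ⟨Equiv.refl _⟩ {0} {0} rfl rfl
    (fun i => i) (fun i => i) (Set.finite_singleton _) (Set.finite_singleton _)
    Subtype.coe_injective Subtype.coe_injective rfl rfl (by
      rintro ⟨l, rfl⟩ ⟨i, rfl⟩
      rw [hP.1, hQ.1])
  exact hQhom.of_equiv (hasRelativeInverses Q) (mapEquiv (MulEquiv.refl G) σ τ hστ).symm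

/-- The matrix with entries `χ (f l i)`, for a character `χ` of `ℤ/k` with values in `G`. -/
def characterMatrix {k n : ℕ} (χ : Multiplicative (ZMod k) →* G) (f : Fin n → Fin n → ZMod k) :
    Matrix (Fin n) (Fin n) G := fun l i => χ (Multiplicative.ofAdd (f l i))

theorem isMatching_characterMatrix {k n : ℕ} {χ : Multiplicative (ZMod k) →* G}
    (hχ : Function.Injective χ) (f : Fin n → Fin n → ZMod k) {x y : ZMod k} (hxy : x ≠ y)
    (m j : Fin n) (h : ∀ l ≠ m, ∀ i ≠ j, -f l j + f l i - f m i + f m j = x ∨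
      -f l j + f l i - f m i + f m j = y)
    (hr : ∀ l ≠ m, ∃! i, i ≠ j ∧ -f l j + f l i - f m i + f m j = x)
    (hc : ∀ i ≠ j, ∃! l, l ≠ m ∧ -f l j + f l i - f m i + f m j = x) :
    IsMatching (rebase (characterMatrix χ f) m j) m j (χ (Multiplicative.ofAdd x))
      (χ (Multiplicative.ofAdd y)) := by
  have key : ∀ l i, rebase (characterMatrix χ f) m j l i =
      χ (Multiplicative.ofAdd (-f l j + f l i - f m i + f m j)) := fun l i => by
    simp [rebase, characterMatrix, sub_eq_add_neg, ofAdd_add, ofAdd_neg]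
  have hinj : ∀ a b : ZMod k, χ (Multiplicative.ofAdd a) = χ (Multiplicative.ofAdd b) ↔ a = b :=
    fun a b => by rw [hχ.eq_iff, Multiplicative.ofAdd.injective.eq_iff]
  apply IsMatching.of_existsUnique
  · exact fun e => hxy ((hinj _ _).1 e)
  · simpa only [key, hinj] using h
  · simpa only [key, hinj] using hr
  · simpa only [key, hinj] using hc

end Extension

/-! ### The semigroups with finite sandwich matrices are homogeneous -/

section FiniteTypes

open ReesMatrix

variable {S : Type u} [Semigroup S] {G : Type u} [Group G] {H : Subgroup G}

theorem IsRectangularGroupOver.isHomogeneousSemigroup (hG : IsHomogeneousGroup G)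
    (h : IsRectangularGroupOver S G) : IsHomogeneousSemigroup S := by
  obtain ⟨I, Λ, -, -, ⟨e⟩⟩ := h
  let P : Matrix Λ I G := fun _ _ => 1
  refine IsHomogeneousSemigroup.of_equiv (S := ReesMatrix P) ?_ (hasRelativeInverses P)
    ((equivProd (P := P) fun _ _ => rfl).trans e.symm)
  refine ReesMatrix.isHomogeneousSemigroup P hG fun m j m' j' θ => ?_
  exact extendsPartialIsos_one (fun l i => by simp [rebase, P]) (fun l i => by simp [rebase, P])
    _ _ _ _

theorem mem_of_characteristic (hH : H.Characteristic) (θ : G ≃* G) {g : G} (hg : g ∈ H) :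
    θ g ∈ H :=
  Subgroup.characteristic_iff_le_comap.1 hH θ hg

/-- An isomorphism `H ≃* ℤ/k` gives a character with values in `H`. -/
theorem exists_character {k : ℕ} (φ : H ≃* Multiplicative (ZMod k)) :
    ∃ χ : Multiplicative (ZMod k) →* G, Function.Injective χ ∧ ∀ z, χ z ∈ H :=
  ⟨H.subtype.comp (φ.symm : _ →* H), H.subtype_injective.comp φ.symm.injective,
    fun z => (φ.symm z).2⟩

theorem eq_of_mem_pair {a g : G} (hHa : (H : Set G) = {1, a}) (hg : g ∈ H) (hg1 : g ≠ 1) :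
    g = a :=
  (show g ∈ ({1, a} : Set G) from hHa ▸ hg).resolve_left hg1

theorem map_eq_of_mem_pair {a : G} (hH : H.Characteristic) (hHa : (H : Set G) = {1, a})
    (ha : a ≠ 1) (θ : G ≃* G) : θ a = a :=
  eq_of_mem_pair hHa (mem_of_characteristic hH θ (hHa.ge (Or.inr rfl))) (by simpa using ha)

theorem IsReesTypeTwo.isHomogeneousSemigroup (hG : IsHomogeneousGroup G) (hH : H.Characteristic)
    (h : IsReesTypeTwo S G H) : IsHomogeneousSemigroup S := by
  obtain ⟨P, a, hP, ⟨e⟩, hHa, ⟨φ⟩, rfl⟩ := h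
  obtain ⟨χ, hχ, hχH⟩ := exists_character φ
  set a := P 1 1 with ha
  have hχ1 : χ (Multiplicative.ofAdd 1) ≠ 1 := by
    rw [← map_one χ]; exact hχ.ne (by decide)
  have hχa : χ (Multiplicative.ofAdd 1) = a := eq_of_mem_pair hHa (hχH _) hχ1
  have ha1 : a ≠ 1 := hχa ▸ hχ1
  have hPm : IsMatching P 0 0 a 1 := by
    refine ⟨ha1, Equiv.refl _, rfl, fun l hl i hi => ?_⟩
    rw [Fin.eq_one_of_ne_zero l hl, Fin.eq_one_of_ne_zero i hi]
    exact ⟨fun _ => rfl, fun h => (h rfl).elim⟩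
  refine IsHomogeneousSemigroup.of_equiv ?_ (hasRelativeInverses P) e.symm
  refine hPm.isHomogeneousSemigroup hG hP
    (Q := characterMatrix χ fun l i => if l = 1 ∧ i = 1 then 1 else 0)
    ⟨fun i => by simp [characterMatrix], fun l => by simp [characterMatrix]⟩ ?_ ?_
  · intro m j
    have := isMatching_characterMatrix hχ (fun l i : Fin 2 => if l = 1 ∧ i = 1 then 1 else 0)
      (x := 1) (y := 0) (by decide) m j (by revert m j; decide)
      (by revert m j; delta ExistsUnique; decide) (by revert m j; delta ExistsUnique; decide)
    rwa [hχa, ofAdd_zero, map_one] at this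
  · intro θ R l i hR
    rwa [map_eq_of_mem_pair hH hHa ha1, map_one] at hR

theorem IsReesTypeFour.isHomogeneousSemigroup (hG : IsHomogeneousGroup G) (hH : H.Characteristic)
    (h : IsReesTypeFour S G H) : IsHomogeneousSemigroup S := by
  obtain ⟨P, a, hP, ⟨e⟩, hHa, ⟨φ⟩, hcol, hrow, hcolm⟩ := h
  obtain ⟨χ, hχ, hχH⟩ := exists_character φ
  have hχ1 : χ (Multiplicative.ofAdd 1) ≠ 1 := by
    rw [← map_one χ]; exact hχ.ne (by decide)
  have hχa : χ (Multiplicative.ofAdd 1) = a := eq_of_mem_pair hHa (hχH _) hχ1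
  have ha1 : a ≠ 1 := hχa ▸ hχ1
  have hPm : IsMatching P 0 0 1 a := by
    refine IsMatching.of_existsUnique ha1.symm (fun l hl i hi => ?_) (fun l hl => ?_)
      (fun i hi => ?_)
    · exact hcol.le ⟨⟨l, hl⟩, ⟨i, hi⟩, rfl⟩
    · obtain ⟨i, hi, hu⟩ := hrow ⟨l, hl⟩
      exact ⟨i, ⟨i.2, hi⟩, fun j hj => congrArg Subtype.val (hu ⟨j, hj.1⟩ hj.2)⟩
    · obtain ⟨l, hl, hu⟩ := hcolm ⟨i, hi⟩
      exact ⟨l, ⟨l.2, hl⟩, fun j hj => congrArg Subtype.val (hu ⟨j, hj.1⟩ hj.2)⟩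
  refine IsHomogeneousSemigroup.of_equiv ?_ (hasRelativeInverses P) e.symm
  refine hPm.isHomogeneousSemigroup hG hP
    (Q := characterMatrix χ fun l i => if l = 0 ∨ i = 0 ∨ l = i then 0 else 1)
    ⟨fun i => by simp [characterMatrix], fun l => by simp [characterMatrix]⟩ ?_ ?_
  · intro m j
    have := isMatching_characterMatrix hχ
      (fun l i : Fin 4 => if l = 0 ∨ i = 0 ∨ l = i then 0 else 1)
      (x := 0) (y := 1) (by decide) m j (by revert m j; decide)
      (by revert m j; delta ExistsUnique; decide) (by revert m j; delta ExistsUnique; decide)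
    rwa [hχa, ofAdd_zero, map_one] at this
  · intro θ R l i hR
    rwa [map_eq_of_mem_pair hH hHa ha1, map_one] at hR

theorem IsReesTypeThree.isHomogeneousSemigroup (hG : IsHomogeneousGroup G)
    (hH : H.Characteristic) (h : IsReesTypeThree S G H) : IsHomogeneousSemigroup S := by
  obtain ⟨P, a, hP, ⟨e⟩, hHa, ⟨φ⟩, hcol, hrow, hcolm⟩ := h
  obtain ⟨χ, hχ, hχH⟩ := exists_character φ
  have hχ1 : χ (Multiplicative.ofAdd 1) ≠ 1 := by
    rw [← map_one χ]; exact hχ.ne (by decide)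
  set x := χ (Multiplicative.ofAdd 1) with hx
  have hy : χ (Multiplicative.ofAdd 2) = x⁻¹ := by
    rw [hx, ← map_inv]; exact congrArg χ (by decide)
  have hxy : x ≠ x⁻¹ := by
    rw [← hy, hx]; exact hχ.ne (by decide)
  have hmem : ∀ g ∈ H, g ≠ 1 → g = a ∨ g = a⁻¹ := fun g hg hg1 =>
    (show g ∈ ({1, a, a⁻¹} : Set G) from hHa ▸ hg).resolve_left hg1
  have hmemx : ∀ g ∈ H, g ≠ 1 → g = x ∨ g = x⁻¹ := fun g hg hg1 => by
    rcases hmem g hg hg1 with h | h <;> rcases hmem x (hχH _) hχ1 with h' | h' <;> simp [h, h']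
  have ha : a ≠ a⁻¹ := by
    rcases hmem x (hχH _) hχ1 with h' | h'
    · rwa [← h']
    · rw [h', inv_inv] at hxy; exact hxy.symm
  have hPm : IsMatching P 0 0 a a⁻¹ := by
    refine IsMatching.of_existsUnique ha (fun l hl i hi => ?_) (fun l hl => ?_)
      (fun i hi => ?_)
    · exact hcol.le ⟨⟨l, hl⟩, ⟨i, hi⟩, rfl⟩
    · obtain ⟨i, hi, hu⟩ := hrow ⟨l, hl⟩
      exact ⟨i, ⟨i.2, hi⟩, fun j hj => congrArg Subtype.val (hu ⟨j, hj.1⟩ hj.2)⟩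
    · obtain ⟨l, hl, hu⟩ := hcolm ⟨i, hi⟩
      exact ⟨l, ⟨l.2, hl⟩, fun j hj => congrArg Subtype.val (hu ⟨j, hj.1⟩ hj.2)⟩
  have hPx : IsMatching P 0 0 x x⁻¹ := by
    rcases hmem x (hχH _) hχ1 with h' | h'
    · rwa [h']
    · rw [h', inv_inv]; exact hPm.swap
  refine IsHomogeneousSemigroup.of_equiv ?_ (hasRelativeInverses P) e.symm
  refine hPx.isHomogeneousSemigroup hG hP
    (Q := characterMatrix χ ![![0, 0, 0], ![0, 1, 2], ![0, 2, 1]])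
    ⟨fun i => ?_, fun l => ?_⟩ ?_ ?_
  · fin_cases i <;> simp [characterMatrix]
  · fin_cases l <;> simp [characterMatrix]
  · intro m j
    have := isMatching_characterMatrix hχ ![![0, 0, 0], ![0, 1, 2], ![0, 2, 1]]
      (x := 1) (y := 2) (by decide) m j (by revert m j; decide)
      (by revert m j; delta ExistsUnique; decide) (by revert m j; delta ExistsUnique; decide)
    rwa [hy] at this
  · intro θ R l i hR
    rcases hmemx (θ x) (mem_of_characteristic hH θ (hχH _)) (by simpa using hχ1) with h | h
    · rwa [map_inv, h] at hR
    · rw [map_inv, h, inv_inv] at hR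
      exact hR.swap

end FiniteTypes

/-! ### Back and forth -/

section BackAndForth

/-- A countable family of cofinal sets is met by an ascending sequence with prescribed start. -/
theorem exists_monotone_meeting {X ι : Type*} [Preorder X] [Countable ι] (p : X) (D : ι → Set X)
    (hD : ∀ i, IsCofinal (D i)) :
    ∃ s : ℕ → X, Monotone s ∧ s 0 = p ∧ ∀ i, ∃ n, s n ∈ D i := by
  have := Encodable.ofCountable ι
  let 𝒟 : ι → Order.Cofinal X := fun i => ⟨D i, hD i⟩
  exact ⟨Order.sequenceOfCofinals p 𝒟, Order.sequenceOfCofinals.monotone p 𝒟, rfl,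
    fun i => ⟨_, Order.sequenceOfCofinals.encode_mem p 𝒟 i⟩⟩

theorem preimage_swap_preimage_swap {A B : Type*} (R : Set (A × B)) :
    Prod.swap ⁻¹' (Prod.swap ⁻¹' R) = R := rfl

theorem preimage_swap_insert_preimage_swap {A B : Type*} (a : A) (b : B) (R : Set (A × B)) :
    Prod.swap ⁻¹' insert (b, a) (Prod.swap ⁻¹' R) = insert (a, b) R := by
  ext ⟨x, y⟩
  simp [and_comm]

theorem exists_equiv_of_relation {A B : Type*} {U : Set (A × B)}
    (hU : ∀ p ∈ U, ∀ q ∈ U, p.1 = q.1 ↔ p.2 = q.2) (h₁ : ∀ a, ∃ b, (a, b) ∈ U)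
    (h₂ : ∀ b, ∃ a, (a, b) ∈ U) : ∃ e : A ≃ B, ∀ a, (a, e a) ∈ U := by
  choose f hf using h₁
  refine ⟨Equiv.ofBijective f ⟨fun a b hab => (hU _ (hf a) _ (hf b)).2 hab, fun b => ?_⟩, hf⟩
  obtain ⟨a, ha⟩ := h₂ b
  exact ⟨a, (hU _ (hf a) _ ha).1 rfl⟩

/-- A chain of relations, each of which is the graph of a partial injection, and which
exhausts both sides, has the graph of a bijection as its union. -/
theorem exists_equiv_of_chain {A B : Type*} {R : ℕ → Set (A × B)} (hR : Monotone R)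
    (hU : ∀ n, ∀ p ∈ R n, ∀ q ∈ R n, p.1 = q.1 ↔ p.2 = q.2) (h₁ : ∀ a, ∃ n b, (a, b) ∈ R n)
    (h₂ : ∀ b, ∃ n a, (a, b) ∈ R n) :
    ∃ e : A ≃ B, (∀ a, ∃ n, (a, e a) ∈ R n) ∧ ∀ n, ∀ p ∈ R n, e p.1 = p.2 := by
  have hU' : ∀ p ∈ ⋃ n, R n, ∀ q ∈ ⋃ n, R n, p.1 = q.1 ↔ p.2 = q.2 := by
    intro p hp q hq
    obtain ⟨m, hm⟩ := Set.mem_iUnion.1 hp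
    obtain ⟨n, hn⟩ := Set.mem_iUnion.1 hq
    exact hU (max m n) p (hR (le_max_left _ _) hm) q (hR (le_max_right _ _) hn)
  obtain ⟨e, he⟩ := exists_equiv_of_relation hU'
    (fun a => by obtain ⟨n, b, h⟩ := h₁ a; exact ⟨b, Set.mem_iUnion.2 ⟨n, h⟩⟩)
    (fun b => by obtain ⟨n, a, h⟩ := h₂ b; exact ⟨a, Set.mem_iUnion.2 ⟨n, h⟩⟩)
  exact ⟨e, fun a => Set.mem_iUnion.1 (he a), fun n p hp =>
    (hU' _ (he p.1) p (Set.mem_iUnion.2 ⟨n, hp⟩)).1 rfl⟩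

end BackAndForth

/-! ### Uniqueness of countable homogeneous groups with a given age -/

section GroupUniqueness

variable {K G : Type*} [Group K] [Group G]

/-- A finitely generated subgroup of `K × G` that is the graph of an isomorphism between subgroups
of `K` and `G`. -/
def IsPartialGroupIso (R : Subgroup (K × G)) : Prop :=
  R.FG ∧ ∀ p ∈ R, p.1 = 1 ↔ p.2 = 1

theorem IsPartialGroupIso.swap {R : Subgroup (K × G)} (h : IsPartialGroupIso R) :
    IsPartialGroupIso (R.map (MulEquiv.prodComm : K × G ≃* G × K).toMonoidHom) := by
  refine ⟨?_, ?_⟩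
  · have := (Group.fg_iff_subgroup_fg R).2 h.1
    exact (Group.fg_iff_subgroup_fg _).1 (Group.fg_of_surjective
      ((MulEquiv.prodComm : K × G ≃* G × K).toMonoidHom.subgroupMap_surjective R))
  · rintro _ ⟨p, hp, rfl⟩
    exact (h.2 p hp).symm

/-- The forth step: the finitely generated group generated by the domain and `k` embeds in `G`, and
by homogeneity of `G` the embedding can be chosen to extend the given partial isomorphism. -/
theorem IsPartialGroupIso.exists_extend (hG : IsHomogeneousGroup G)
    (hemb : ∀ A : Subgroup K, A.FG → ∃ f : A →* G, Function.Injective f)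
    {R : Subgroup (K × G)} (h : IsPartialGroupIso R) (k : K) :
    ∃ R', IsPartialGroupIso R' ∧ R ≤ R' ∧ ∃ g, (k, g) ∈ R' := by
  have hRfg := (Group.fg_iff_subgroup_fg R).2 h.1
  let π₁ : R →* K := (MonoidHom.fst K G).comp R.subtype
  let π₂ : R →* G := (MonoidHom.snd K G).comp R.subtype
  have hπ₁ : Function.Injective π₁ := (injective_iff_map_eq_one π₁).2 fun p hp =>
    Subtype.ext (Prod.ext hp ((h.2 p p.2).1 hp))
  have hπ₂ : Function.Injective π₂ := (injective_iff_map_eq_one π₂).2 fun p hp =>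
    Subtype.ext (Prod.ext ((h.2 p p.2).2 hp) hp)
  set A : Subgroup K := π₁.range ⊔ Subgroup.closure {k} with hA
  have hAfg : A.FG := Subgroup.FG.sup ((Group.fg_iff_subgroup_fg _).1 inferInstance)
    ((Group.fg_iff_subgroup_fg _).1 inferInstance)
  obtain ⟨f, hf⟩ := hemb A hAfg
  have hRA : ∀ p, π₁ p ∈ A := fun p => (le_sup_left : π₁.range ≤ A) ⟨p, rfl⟩
  obtain ⟨θ, hθ⟩ := hG.exists_extend hRfg (f.comp (π₁.codRestrict A hRA)) π₂
    (hf.comp fun a b hab => hπ₁ (congrArg Subtype.val hab)) hπ₂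
  let g : A →* K × G := A.subtype.prod ((θ : G →* G).comp f)
  have := (Group.fg_iff_subgroup_fg A).2 hAfg
  refine ⟨g.range, ⟨(Group.fg_iff_subgroup_fg _).1 inferInstance, ?_⟩, ?_, θ (f ⟨k, ?_⟩),
    ⟨k, ?_⟩, rfl⟩
  · rintro _ ⟨a, rfl⟩
    change (a : K) = 1 ↔ θ (f a) = 1
    rw [EmbeddingLike.map_eq_one_iff, map_eq_one_iff f hf, Subtype.ext_iff, Subgroup.coe_one]
  · intro p hp
    exact ⟨⟨p.1, hRA ⟨p, hp⟩⟩, Prod.ext rfl (hθ ⟨p, hp⟩)⟩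
  all_goals exact (le_sup_right : _ ≤ A) (Subgroup.subset_closure rfl)

/-- Two countable homogeneous groups are isomorphic if each finitely generated subgroup of one
embeds in the other. -/
theorem IsHomogeneousGroup.nonempty_mulEquiv [Countable K] [Countable G]
    (hK : IsHomogeneousGroup K) (hG : IsHomogeneousGroup G)
    (hKG : ∀ A : Subgroup K, A.FG → ∃ f : A →* G, Function.Injective f)
    (hGK : ∀ A : Subgroup G, A.FG → ∃ f : A →* K, Function.Injective f) :
    Nonempty (K ≃* G) := by
  let X := {R : Subgroup (K × G) // IsPartialGroupIso R}
  let D : K ⊕ G → Set X := Sum.elim (fun k => {R | ∃ g, (k, g) ∈ R.1})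
    (fun g => {R | ∃ k, (k, g) ∈ R.1})
  have hD : ∀ i, IsCofinal (D i) := by
    rintro (k | g) ⟨R, hR⟩
    · obtain ⟨R', h1, h2, h3⟩ := hR.exists_extend hG hKG k
      exact ⟨⟨R', h1⟩, h3, h2⟩
    · obtain ⟨R', h1, h2, k, hk⟩ := hR.swap.exists_extend hK hGK g
      refine ⟨⟨_, h1.swap⟩, ⟨k, (g, k), hk, rfl⟩, fun p hp => ?_⟩
      exact ⟨p.swap, h2 ⟨p, hp, rfl⟩, rfl⟩
  have h0 : IsPartialGroupIso (⊥ : Subgroup (K × G)) :=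
    ⟨(Group.fg_iff_subgroup_fg _).1 inferInstance, fun p hp => by
      rw [Subgroup.mem_bot.1 hp]; exact iff_of_true rfl rfl⟩
  obtain ⟨s, hs, -, hsD⟩ := exists_monotone_meeting (⟨⊥, h0⟩ : X) D hD
  obtain ⟨e, he, he'⟩ := exists_equiv_of_chain (R := fun n => ((s n).1 : Set (K × G)))
    (fun m n hmn => hs hmn)
    (fun n p hp q hq => by
      have := (s n).2.2 _ (mul_mem hp (inv_mem hq))
      simpa [mul_inv_eq_one] using this)
    (fun k => hsD (Sum.inl k)) (fun g => hsD (Sum.inr g))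
  refine ⟨⟨e, fun a b => ?_⟩⟩
  obtain ⟨m, hm⟩ := he a
  obtain ⟨n, hn⟩ := he b
  exact he' (max m n) _ (mul_mem (hs (le_max_left m n) hm) (hs (le_max_right m n) hn))

end GroupUniqueness

/-! ### Generic sandwich matrices -/

section Generic

/-- A finite partial isomorphism between coloured complete bipartite graphs, as a pair of relations
between the index sets. -/
structure IsPartialGraphIso {G I₁ I₂ Λ₁ Λ₂ : Type*} (P₁ : Matrix Λ₁ I₁ G) (P₂ : Matrix Λ₂ I₂ G)
    (A : Set (Λ₁ × Λ₂)) (B : Set (I₁ × I₂)) : Prop where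
  rows_finite : A.Finite
  columns_finite : B.Finite
  rows_inj : ∀ p ∈ A, ∀ q ∈ A, p.1 = q.1 ↔ p.2 = q.2
  columns_inj : ∀ p ∈ B, ∀ q ∈ B, p.1 = q.1 ↔ p.2 = q.2
  colour : ∀ p ∈ A, ∀ q ∈ B, P₁ p.1 q.1 = P₂ p.2 q.2

namespace IsPartialGraphIso

variable {G I₁ I₂ Λ₁ Λ₂ : Type*} {P₁ : Matrix Λ₁ I₁ G} {P₂ : Matrix Λ₂ I₂ G}
  {A : Set (Λ₁ × Λ₂)} {B : Set (I₁ × I₂)}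

theorem symm (h : IsPartialGraphIso P₁ P₂ A B) :
    IsPartialGraphIso P₂ P₁ (Prod.swap ⁻¹' A) (Prod.swap ⁻¹' B) :=
  ⟨h.rows_finite.preimage Prod.swap_injective.injOn,
    h.columns_finite.preimage Prod.swap_injective.injOn,
    fun _ hp _ hq => (h.rows_inj _ hp _ hq).symm, fun _ hp _ hq => (h.columns_inj _ hp _ hq).symm,
    fun _ hp _ hq => (h.colour _ hp _ hq).symm⟩

theorem transpose (h : IsPartialGraphIso P₁ P₂ A B) :
    IsPartialGraphIso P₁.transpose P₂.transpose B A :=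
  ⟨h.columns_finite, h.rows_finite, h.columns_inj, h.rows_inj, fun p hp q hq => h.colour q hq p hp⟩

/-- The forth step for columns; the other three steps arise by symmetry and transposition. -/
theorem exists_insert_column [One G] {C : Set G} {l₁ : Λ₁} {l₂ : Λ₂}
    (h : IsPartialGraphIso P₁ P₂ A B) (hA : (l₁, l₂) ∈ A) {i : I₁} (hi : P₁ l₁ i = 1)
    (hC : ∀ l, P₁ l i ∈ C)
    (hcol : ∀ (E : Finset I₂) (F : Finset Λ₂) (α : Λ₂ → G), (∀ l ∈ F, α l ∈ C) → α l₂ = 1 →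
      ∃ k ∉ E, ∀ l ∈ F, P₂ l k = α l) :
    ∃ k, IsPartialGraphIso P₁ P₂ A (insert (i, k) B) := by
  classical
  by_cases hB : ∃ k, (i, k) ∈ B
  · obtain ⟨k, hk⟩ := hB
    exact ⟨k, by rwa [Set.insert_eq_of_mem hk]⟩
  let α : Λ₂ → G := fun l => if h : ∃ m, (m, l) ∈ A then P₁ h.choose i else 1
  have hα : ∀ p ∈ A, α p.2 = P₁ p.1 i := by
    intro p hp
    have hex : ∃ m, (m, p.2) ∈ A := ⟨p.1, hp⟩
    have : hex.choose = p.1 := (h.rows_inj _ hex.choose_spec p hp).2 rfl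
    simp only [α, dif_pos hex, this]
  obtain ⟨k, hkE, hkF⟩ := hcol (h.columns_finite.image Prod.snd).toFinset
    (h.rows_finite.image Prod.snd).toFinset α (by
      intro l hl
      obtain ⟨p, hp, rfl⟩ := (Set.Finite.mem_toFinset _).1 hl
      rw [hα p hp]
      exact hC _) ((hα _ hA).trans hi)
  have hk : ∀ q ∈ B, q.2 ≠ k := fun q hq e => hkE (by
    rw [Set.Finite.mem_toFinset]; exact ⟨q, hq, e⟩)
  have hi' : ∀ q ∈ B, q.1 ≠ i := fun q hq e => hB ⟨q.2, e ▸ hq⟩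
  refine ⟨k, h.rows_finite, h.columns_finite.insert _, h.rows_inj, ?_, ?_⟩
  · rintro p (rfl | hp) q (rfl | hq)
    · exact iff_of_true rfl rfl
    · exact iff_of_false (hi' q hq).symm (hk q hq).symm
    · exact iff_of_false (hi' p hp) (hk p hp)
    · exact h.columns_inj p hp q hq
  · rintro p hp q (rfl | hq)
    · rw [← hα p hp]
      exact (hkF _ (by rw [Set.Finite.mem_toFinset]; exact ⟨p, hp, rfl⟩)).symm
    · exact h.colour p hp q hq

end IsPartialGraphIso

/-- In a matrix with infinitely many rows and columns, a column with prescribed entries in finitely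
many rows can be found outside any finite set of columns. -/
theorem exists_column_notMem {G I Λ : Type*} [One G] {P : Matrix Λ I G} {C : Set G} {l₀ : Λ}
    [Infinite I] [Infinite Λ] (h1 : 1 ∈ C) (hmem : ∀ l i, P l i ∈ C)
    (hcol : ∀ (F : Finset Λ) (α : Λ → G), (∀ l ∈ F, α l ∈ C) → α l₀ = 1 →
      ∃ k, ∀ l ∈ F, P l k = α l) (E : Finset I) :
    ∀ (F : Finset Λ) (α : Λ → G), (∀ l ∈ F, α l ∈ C) → α l₀ = 1 →
      ∃ k ∉ E, ∀ l ∈ F, P l k = α l := by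
  classical
  by_cases hC : ∀ c ∈ C, c = 1
  · intro F α hα _
    obtain ⟨k, hk⟩ := Infinite.exists_notMem_finset E
    exact ⟨k, hk, fun l hl => by rw [hC _ (hα l hl), hC _ (hmem l k)]⟩
  push Not at hC
  obtain ⟨c, hc, hc1⟩ := hC
  induction E using Finset.induction_on with
  | empty =>
    intro F α hα hα0
    obtain ⟨k, hk⟩ := hcol F α hα hα0
    exact ⟨k, by simp, hk⟩
  | insert e E _ ih =>
    intro F α hα hα0
    -- prescribe in an additional row an entry that differs from that of the column `e`
    obtain ⟨n, hn⟩ := Infinite.exists_notMem_finset (insert l₀ F)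
    simp only [Finset.mem_insert, not_or] at hn
    obtain ⟨d, hd, hde⟩ : ∃ d ∈ C, d ≠ P n e := by
      by_cases h : P n e = 1
      · exact ⟨c, hc, h ▸ hc1⟩
      · exact ⟨1, h1, Ne.symm h⟩
    obtain ⟨k, hkE, hk⟩ := ih (insert n F) (Function.update α n d) (by
      intro l hl
      by_cases hln : l = n
      · subst hln; rwa [Function.update_self]
      · rw [Function.update_of_ne hln]
        exact hα l ((Finset.mem_insert.1 hl).resolve_left hln))
      (by rw [Function.update_of_ne (Ne.symm hn.1), hα0])
    refine ⟨k, ?_, fun l hl => ?_⟩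
    · rw [Finset.mem_insert, not_or]
      refine ⟨?_, hkE⟩
      rintro rfl
      have := hk n (Finset.mem_insert_self _ _)
      rw [Function.update_self] at this
      exact hde this.symm
    · rw [hk l (Finset.mem_insert_of_mem hl), Function.update_of_ne]
      rintro rfl
      exact hn.2 hl

variable {G : Type*} [Group G] {H : Subgroup G} {I Λ : Type*} {P : Matrix Λ I G} {l₀ : Λ} {i₀ : I}

/-- A normalised sandwich matrix whose attached graph is `H`-generic, with the conditions stated
for all rows and columns, including those of the base point. -/
structure IsGenericMatrix (H : Subgroup G) (P : Matrix Λ I G) (l₀ : Λ) (i₀ : I) : Prop where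
  norm : IsNormalised P l₀ i₀
  mem : ∀ l i, P l i ∈ H
  infinite_columns : Infinite I
  infinite_rows : Infinite Λ
  column : ∀ (F : Finset Λ) (α : Λ → G), (∀ l ∈ F, α l ∈ H) → α l₀ = 1 →
    ∃ k, ∀ l ∈ F, P l k = α l
  row : ∀ (F : Finset I) (α : I → G), (∀ i ∈ F, α i ∈ H) → α i₀ = 1 →
    ∃ k, ∀ i ∈ F, P k i = α i

namespace IsGenericMatrix

theorem column_notMem (h : IsGenericMatrix H P l₀ i₀) (E : Finset I) (F : Finset Λ) (α : Λ → G)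
    (hα : ∀ l ∈ F, α l ∈ (H : Set G)) (h0 : α l₀ = 1) : ∃ k ∉ E, ∀ l ∈ F, P l k = α l :=
  have := h.infinite_columns
  have := h.infinite_rows
  exists_column_notMem (C := (H : Set G)) (one_mem H) h.mem h.column E F α hα h0

theorem row_notMem (h : IsGenericMatrix H P l₀ i₀) (E : Finset Λ) (F : Finset I) (α : I → G)
    (hα : ∀ i ∈ F, α i ∈ (H : Set G)) (h0 : α i₀ = 1) : ∃ k ∉ E, ∀ i ∈ F, P k i = α i :=
  have := h.infinite_columns
  have := h.infinite_rows
  exists_column_notMem (P := P.transpose) (C := (H : Set G)) (one_mem H) (fun l i => h.mem i l)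
    h.row E F α hα h0

theorem of_isColourGeneric (hP : IsNormalised P l₀ i₀) (hH : entrySet P = (H : Set G))
    (h : IsColourGeneric (H : Set G) (inducedColouring P l₀ i₀)) : IsGenericMatrix H P l₀ i₀ := by
  classical
  obtain ⟨-, hL, hR, hcol, hrow⟩ := h
  have hL' : Infinite {l : Λ // l ≠ l₀} := Cardinal.infinite_iff.2 hL.ge
  have hR' : Infinite {i : I // i ≠ i₀} := Cardinal.infinite_iff.2 hR.ge
  refine ⟨hP, fun l i => hH.le ⟨l, i, rfl⟩,
    Infinite.of_injective (Subtype.val : {i : I // i ≠ i₀} → I) Subtype.val_injective,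
    Infinite.of_injective (Subtype.val : {l : Λ // l ≠ l₀} → Λ) Subtype.val_injective,
    fun F α hα h0 => ?_, fun F α hα h0 => ?_⟩
  · obtain ⟨r, hr⟩ := hcol (F.subtype (· ≠ l₀))
      (fun y => ⟨α y, hα _ (Finset.mem_subtype.1 y.2)⟩)
    refine ⟨r, fun l hl => ?_⟩
    by_cases hl0 : l = l₀
    · rw [hl0, hP.1, h0]
    · exact hr ⟨⟨l, hl0⟩, Finset.mem_subtype.2 hl⟩
  · obtain ⟨r, hr⟩ := hrow (F.subtype (· ≠ i₀))
      (fun y => ⟨α y, hα _ (Finset.mem_subtype.1 y.2)⟩)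
    refine ⟨r, fun i hi => ?_⟩
    by_cases hi0 : i = i₀
    · rw [hi0, hP.2, h0]
    · exact hr ⟨⟨i, hi0⟩, Finset.mem_subtype.2 hi⟩

theorem map (h : IsGenericMatrix H P l₀ i₀) (hH : H.Characteristic) (θ : G ≃* G) :
    IsGenericMatrix H (fun l i => θ (P l i)) l₀ i₀ := by
  refine ⟨⟨fun i => by simp [h.norm.1], fun l => by simp [h.norm.2]⟩,
    fun l i => mem_of_characteristic hH θ (h.mem l i), h.infinite_columns, h.infinite_rows,
    fun F α hα h0 => ?_, fun F α hα h0 => ?_⟩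
  · obtain ⟨k, hk⟩ := h.column F (fun l => θ.symm (α l))
      (fun l hl => mem_of_characteristic hH θ.symm (hα l hl)) (by simp [h0])
    exact ⟨k, fun l hl => by rw [hk l hl, MulEquiv.apply_symm_apply]⟩
  · obtain ⟨k, hk⟩ := h.row F (fun l => θ.symm (α l))
      (fun l hl => mem_of_characteristic hH θ.symm (hα l hl)) (by simp [h0])
    exact ⟨k, fun l hl => by rw [hk l hl, MulEquiv.apply_symm_apply]⟩

open ReesMatrix in
theorem rebase_mem [H.Normal] (hmem : ∀ l i, P l i ∈ H) (m : Λ) (j : I) (l : Λ) (i : I) :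
    rebase P m j l i ∈ H :=
  H.mul_mem (H.mul_mem (H.mul_mem (H.inv_mem (hmem l j)) (hmem l i)) (H.inv_mem (hmem m i)))
    (hmem m j)

open ReesMatrix in
/-- Genericity does not depend on the normalisation. -/
theorem rebase [H.Normal] (h : IsGenericMatrix H P l₀ i₀) (m : Λ) (j : I) :
    IsGenericMatrix H (ReesMatrix.rebase P m j) m j := by
  classical
  refine ⟨isNormalised_rebase P m j, rebase_mem h.mem m j, h.infinite_columns, h.infinite_rows,
    fun F α hα h0 => ?_, fun F α hα h0 => ?_⟩
  · let β : Λ → G := fun l => P l j * α l * (P m j)⁻¹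
    have hβm : β m = 1 := by simp [β, h0]
    have hβ : ∀ l, (l ∈ F ∨ l = m) → β l ∈ H := by
      rintro l (hl | rfl)
      · exact H.mul_mem (H.mul_mem (h.mem l j) (hα l hl)) (H.inv_mem (h.mem m j))
      · rw [hβm]; exact H.one_mem
    -- the entry in the row `m` is free if the base row is not prescribed
    obtain ⟨k, hk⟩ : ∃ k, ∀ l ∈ insert m F, P l k * (P m k)⁻¹ = β l := by
      by_cases hl₀ : l₀ ∈ insert m F
      · have hl₀' : l₀ ∈ F ∨ l₀ = m := by rw [Finset.mem_insert] at hl₀; exact hl₀.symm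
        obtain ⟨k, hk⟩ := h.column (insert m F) (fun l => β l * (β l₀)⁻¹) (by
          intro l hl
          exact H.mul_mem (hβ l (Finset.mem_insert.1 hl).symm) (H.inv_mem (hβ _ hl₀')))
          (mul_inv_cancel _)
        refine ⟨k, fun l hl => ?_⟩
        rw [hk l hl, hk m (Finset.mem_insert_self _ _), hβm]
        simp
      · have hne : ∀ {l}, l ∈ insert m F → l ≠ l₀ := fun hl e => hl₀ (e ▸ hl)
        obtain ⟨k, hk⟩ := h.column (insert m F) (Function.update β l₀ 1) (by
          intro l hl
          rw [Function.update_of_ne (hne hl)]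
          exact hβ l (Finset.mem_insert.1 hl).symm) (Function.update_self _ _ _)
        refine ⟨k, fun l hl => ?_⟩
        have hm := Finset.mem_insert_self m F
        rw [hk l hl, hk m hm, Function.update_of_ne (hne hl), Function.update_of_ne (hne hm), hβm]
        simp
    refine ⟨k, fun l hl => ?_⟩
    have := hk l (Finset.mem_insert_of_mem hl)
    simp only [ReesMatrix.rebase]
    rw [mul_assoc (P l j)⁻¹, this]
    simp [β, mul_assoc]
  · let β : I → G := fun i => α i * (P m j)⁻¹ * P m i
    have hβj : β j = 1 := by simp [β, h0]
    have hβ : ∀ i, (i ∈ F ∨ i = j) → β i ∈ H := by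
      rintro i (hi | rfl)
      · exact H.mul_mem (H.mul_mem (hα i hi) (H.inv_mem (h.mem m j))) (h.mem m i)
      · rw [hβj]; exact H.one_mem
    obtain ⟨k, hk⟩ : ∃ k, ∀ i ∈ insert j F, (P k j)⁻¹ * P k i = β i := by
      by_cases hi₀ : i₀ ∈ insert j F
      · have hi₀' : i₀ ∈ F ∨ i₀ = j := by rw [Finset.mem_insert] at hi₀; exact hi₀.symm
        obtain ⟨k, hk⟩ := h.row (insert j F) (fun i => (β i₀)⁻¹ * β i) (by
          intro i hi
          exact H.mul_mem (H.inv_mem (hβ _ hi₀')) (hβ i (Finset.mem_insert.1 hi).symm))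
          (inv_mul_cancel _)
        refine ⟨k, fun i hi => ?_⟩
        rw [hk i hi, hk j (Finset.mem_insert_self _ _), hβj]
        simp
      · have hne : ∀ {i}, i ∈ insert j F → i ≠ i₀ := fun hi e => hi₀ (e ▸ hi)
        obtain ⟨k, hk⟩ := h.row (insert j F) (Function.update β i₀ 1) (by
          intro i hi
          rw [Function.update_of_ne (hne hi)]
          exact hβ i (Finset.mem_insert.1 hi).symm) (Function.update_self _ _ _)
        refine ⟨k, fun i hi => ?_⟩
        have hj := Finset.mem_insert_self j F
        rw [hk i hi, hk j hj, Function.update_of_ne (hne hi), Function.update_of_ne (hne hj), hβj]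
        simp
    refine ⟨k, fun i hi => ?_⟩
    have := hk i (Finset.mem_insert_of_mem hi)
    simp only [ReesMatrix.rebase]
    rw [this]
    simp [β]

/-- Finite partial isomorphisms between countable generic graphs extend, by back and forth. -/
theorem extendsPartialIsos {I₁ I₂ Λ₁ Λ₂ : Type*} [Countable I₁] [Countable I₂] [Countable Λ₁]
    [Countable Λ₂] {P₁ : Matrix Λ₁ I₁ G} {P₂ : Matrix Λ₂ I₂ G} {l₁ : Λ₁} {i₁ : I₁} {l₂ : Λ₂}
    {i₂ : I₂} (h₁ : IsGenericMatrix H P₁ l₁ i₁) (h₂ : IsGenericMatrix H P₂ l₂ i₂) :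
    ExtendsPartialIsos P₁ l₁ i₁ P₂ l₂ i₂ := by
  intro J M hi hl σ₀ τ₀ hJ hM hσ hτ hσ₀ hτ₀ hστ
  let X := {r : Set (Λ₁ × Λ₂) × Set (I₁ × I₂) //
    IsPartialGraphIso P₁ P₂ r.1 r.2 ∧ (l₁, l₂) ∈ r.1 ∧ (i₁, i₂) ∈ r.2}
  let D : (Λ₁ ⊕ Λ₂) ⊕ (I₁ ⊕ I₂) → Set X := Sum.elim
    (Sum.elim (fun l => {r | ∃ l', (l, l') ∈ r.1.1}) (fun l' => {r | ∃ l, (l, l') ∈ r.1.1}))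
    (Sum.elim (fun i => {r | ∃ i', (i, i') ∈ r.1.2}) (fun i' => {r | ∃ i, (i, i') ∈ r.1.2}))
  have hD : ∀ t, IsCofinal (D t) := by
    rintro ((l | l) | (i | i)) ⟨⟨A, B⟩, h, hA, hB⟩
    · obtain ⟨k, hk⟩ := h.transpose.exists_insert_column (C := (H : Set G)) hB (i := l)
        (h₁.norm.2 l) (fun i => h₁.mem l i) h₂.row_notMem
      exact ⟨⟨(insert (l, k) A, B), hk.transpose, Or.inr hA, hB⟩, ⟨k, Or.inl rfl⟩,
        Set.subset_insert _ _, le_rfl⟩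
    · obtain ⟨k, hk⟩ := h.symm.transpose.exists_insert_column (C := (H : Set G))
        (l₁ := i₂) (l₂ := i₁) hB (i := l)
        (h₂.norm.2 l) (fun i => h₂.mem l i) h₁.row_notMem
      have hk' := hk.transpose.symm
      rw [preimage_swap_insert_preimage_swap, preimage_swap_preimage_swap] at hk'
      exact ⟨⟨(insert (k, l) A, B), hk', Or.inr hA, hB⟩, ⟨k, Or.inl rfl⟩,
        Set.subset_insert _ _, le_rfl⟩
    · obtain ⟨k, hk⟩ := h.exists_insert_column (C := (H : Set G)) hA (i := i)
        (h₁.norm.1 i) (fun l => h₁.mem l i) h₂.column_notMem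
      exact ⟨⟨(A, insert (i, k) B), hk, hA, Or.inr hB⟩, ⟨k, Or.inl rfl⟩, le_rfl,
        Set.subset_insert _ _⟩
    · obtain ⟨k, hk⟩ := h.symm.exists_insert_column (C := (H : Set G))
        (l₁ := l₂) (l₂ := l₁) hA (i := i)
        (h₂.norm.1 i) (fun l => h₂.mem l i) h₁.column_notMem
      have hk' := hk.symm
      rw [preimage_swap_insert_preimage_swap, preimage_swap_preimage_swap] at hk'
      exact ⟨⟨(A, insert (k, i) B), hk', hA, Or.inr hB⟩, ⟨k, Or.inl rfl⟩, le_rfl,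
        Set.subset_insert _ _⟩
  have := hJ.to_subtype
  have := hM.to_subtype
  have h0 : IsPartialGraphIso P₁ P₂ (Set.range fun l : M => ((l : Λ₁), τ₀ l))
      (Set.range fun i : J => ((i : I₁), σ₀ i)) := by
    refine ⟨Set.finite_range _, Set.finite_range _, ?_, ?_, ?_⟩
    · rintro _ ⟨l, rfl⟩ _ ⟨l', rfl⟩
      exact Subtype.ext_iff.symm.trans hτ.eq_iff.symm
    · rintro _ ⟨l, rfl⟩ _ ⟨l', rfl⟩
      exact Subtype.ext_iff.symm.trans hσ.eq_iff.symm
    · rintro _ ⟨l, rfl⟩ _ ⟨i, rfl⟩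
      exact hστ l i
  obtain ⟨s, hs, hs0, hsD⟩ := exists_monotone_meeting
    (⟨(_, _), h0, ⟨⟨l₁, hl⟩, Prod.ext rfl hτ₀⟩, ⟨⟨i₁, hi⟩, Prod.ext rfl hσ₀⟩⟩ : X) D hD
  obtain ⟨τ, hτ1, hτ2⟩ := exists_equiv_of_chain (R := fun n => (s n).1.1)
    (fun m n hmn => (hs hmn).1) (fun n => (s n).2.1.rows_inj)
    (fun l => hsD (Sum.inl (Sum.inl l))) (fun l => hsD (Sum.inl (Sum.inr l)))
  obtain ⟨σ, hσ1, hσ2⟩ := exists_equiv_of_chain (R := fun n => (s n).1.2)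
    (fun m n hmn => (hs hmn).2) (fun n => (s n).2.1.columns_inj)
    (fun i => hsD (Sum.inr (Sum.inl i))) (fun i => hsD (Sum.inr (Sum.inr i)))
  refine ⟨σ, τ, fun i => hσ2 0 (i, σ₀ i) ?_, fun l => hτ2 0 (l, τ₀ l) ?_, fun l i => ?_⟩
  · simp only [hs0]
    exact ⟨i, rfl⟩
  · simp only [hs0]
    exact ⟨l, rfl⟩
  · obtain ⟨m, hm⟩ := hτ1 l
    obtain ⟨n, hn⟩ := hσ1 i
    exact (s (max m n)).2.1.colour (l, τ l) ((hs (le_max_left m n)).1 hm) (i, σ i)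
      ((hs (le_max_right m n)).2 hn)

/-- A countable Rees matrix semigroup over a homogeneous group with generic matrix is
homogeneous. -/
theorem isHomogeneousSemigroup [Countable I] [Countable Λ] (hG : IsHomogeneousGroup G)
    (hH : H.Characteristic) (h : IsGenericMatrix H P l₀ i₀) :
    IsHomogeneousSemigroup (ReesMatrix P) :=
  ReesMatrix.isHomogeneousSemigroup P hG fun m j m' j' θ =>
    ((h.rebase m j).map hH θ).extendsPartialIsos (h.rebase m' j')

end IsGenericMatrix

theorem IsReesGeneric.isHomogeneousSemigroup {S G : Type u} [Semigroup S] [Group G] [Countable S]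
    {H : Subgroup G} (hG : IsHomogeneousGroup G) (hH : H.Characteristic)
    (h : IsReesGeneric S G H) : IsHomogeneousSemigroup S := by
  obtain ⟨I, Λ, P, l₀, i₀, hP, ⟨e⟩, hent, hgen⟩ := h
  have : Countable (ReesMatrix P) := e.symm.injective.countable
  obtain ⟨-, _, _⟩ := ReesMatrix.countable_index (P := P) l₀ i₀
  exact ((IsGenericMatrix.of_isColourGeneric hP hent hgen).isHomogeneousSemigroup hG hH).of_equiv
    (ReesMatrix.hasRelativeInverses P) e.symm

end Generic

/-! ### The age of a generic semigroup -/

section Age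

open ReesMatrix

theorem ReesMatrix.finite_of_isFGUnary_top {K J M : Type*} [Group K] {Q : Matrix M J K} {m₀ : M}
    {j₀ : J} (hQ : IsNormalised Q m₀ j₀) (h : IsFGUnary (⊤ : Subsemigroup (ReesMatrix Q))) :
    Group.FG K ∧ Finite J ∧ Finite M := by
  obtain ⟨J', K', M', hent, hJ, hM, hK, -, -, heq⟩ :=
    exists_eq_block hQ h (Subsemigroup.mem_top _)
  have hmem : ∀ x : ReesMatrix Q, x ∈ block Q J' K' M' hent := fun x => heq ▸ Subsemigroup.mem_top x
  refine ⟨⟨?_⟩, Set.finite_univ_iff.1 ?_, Set.finite_univ_iff.1 ?_⟩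
  · rwa [← (Subgroup.eq_top_iff' K').2 fun k => (hmem ⟨j₀, k, m₀⟩).2.1]
  · rwa [← Set.eq_univ_of_forall fun j => (hmem ⟨j, 1, m₀⟩).1]
  · rwa [← Set.eq_univ_of_forall fun m => (hmem ⟨j₀, 1, m⟩).2.2]

theorem entrySet_finite {K J M : Type*} [Finite J] [Finite M] (Q : Matrix M J K) :
    (entrySet Q).Finite := by
  have : entrySet Q = Set.range fun p : M × J => Q p.1 p.2 := by
    ext g
    simp [entrySet]
  rw [this]
  exact Set.finite_range _

theorem fg_closure_entrySet {K J M : Type*} [Group K] [Finite J] [Finite M] (Q : Matrix M J K) :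
    Group.FG (Subgroup.closure (entrySet Q)) := by
  have := (entrySet_finite Q).to_subtype
  infer_instance

variable {G : Type*} [Group G] {H : Subgroup G} {I Λ : Type*} {P : Matrix Λ I G} {l₀ : Λ} {i₀ : I}

/-- Every finite normalised matrix over `H` embeds in a generic matrix. -/
theorem IsGenericMatrix.exists_embedding (h : IsGenericMatrix H P l₀ i₀) {J M : Type*} [Finite J]
    [Finite M] {Q : Matrix M J G} {m₀ : M} {j₀ : J} (hQ : IsNormalised Q m₀ j₀)
    (hQH : ∀ m j, Q m j ∈ H) :
    ∃ (σ : J → I) (τ : M → Λ), Function.Injective σ ∧ Function.Injective τ ∧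
      ∀ m j, Q m j = P (τ m) (σ j) := by
  classical
  have hrows : ∀ E : Finset M, ∃ A, IsPartialGraphIso Q P A {(j₀, i₀)} ∧ (m₀, l₀) ∈ A ∧
      ∀ m ∈ E, ∃ l, (m, l) ∈ A := by
    intro E
    induction E using Finset.induction_on with
    | empty =>
      refine ⟨{(m₀, l₀)}, ⟨Set.finite_singleton _, Set.finite_singleton _, ?_, ?_, ?_⟩, rfl,
        by simp⟩
      · rintro _ rfl _ rfl; exact iff_of_true rfl rfl
      · rintro _ rfl _ rfl; exact iff_of_true rfl rfl
      · rintro _ rfl _ rfl; exact (hQ.1 _).trans (h.norm.1 _).symm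
    | insert m E _ ih =>
      obtain ⟨A, hA, hA0, hE⟩ := ih
      obtain ⟨k, hk⟩ := hA.transpose.exists_insert_column (C := (H : Set G)) (l₁ := j₀) (l₂ := i₀)
        rfl (i := m) (hQ.2 m) (fun j => hQH m j) h.row_notMem
      refine ⟨_, hk.transpose, Or.inr hA0, fun m' hm' => ?_⟩
      rcases Finset.mem_insert.1 hm' with rfl | hm'
      · exact ⟨k, Or.inl rfl⟩
      · obtain ⟨l, hl⟩ := hE m' hm'
        exact ⟨l, Or.inr hl⟩
  have := Fintype.ofFinite M
  have := Fintype.ofFinite J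
  obtain ⟨A, hA, hA0, hAE⟩ := hrows Finset.univ
  have hcols : ∀ E : Finset J, ∃ B, IsPartialGraphIso Q P A B ∧ ∀ j ∈ E, ∃ i, (j, i) ∈ B := by
    intro E
    induction E using Finset.induction_on with
    | empty => exact ⟨_, hA, by simp⟩
    | insert j E _ ih =>
      obtain ⟨B, hB, hE⟩ := ih
      obtain ⟨k, hk⟩ := hB.exists_insert_column (C := (H : Set G)) hA0 (i := j) (hQ.1 j)
        (fun m => hQH m j) h.column_notMem
      refine ⟨_, hk, fun j' hj' => ?_⟩
      rcases Finset.mem_insert.1 hj' with rfl | hj'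
      · exact ⟨k, Or.inl rfl⟩
      · obtain ⟨i, hi⟩ := hE j' hj'
        exact ⟨i, Or.inr hi⟩
  obtain ⟨B, hB, hBE⟩ := hcols Finset.univ
  choose τ hτ using fun m => hAE m (Finset.mem_univ m)
  choose σ hσ using fun j => hBE j (Finset.mem_univ j)
  exact ⟨σ, τ, fun a b hab => (hB.columns_inj _ (hσ a) _ (hσ b)).2 hab,
    fun a b hab => (hB.rows_inj _ (hτ a) _ (hτ b)).2 hab, fun m j => hB.colour _ (hτ m) _ (hσ j)⟩

/-- The age of a generic semigroup over `G` and `H` is `CS(G; H)`. -/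
theorem IsReesGeneric.inSemigroupAge_iff {S G : Type u} [Semigroup S] [Group G] {H : Subgroup G}
    (hG : IsHomogeneousGroup G) (hH : H.Characteristic) (h : IsReesGeneric S G H) (T : Type u)
    [Semigroup T] : InSemigroupAge T S ↔ InCS G H T := by
  obtain ⟨I, Λ, P, l₀, i₀, hP, ⟨e⟩, hent, hgen⟩ := h
  have hgen := IsGenericMatrix.of_isColourGeneric hP hent hgen
  refine and_congr_right fun hT => and_congr_right fun hfg => ⟨?_, ?_⟩
  · rintro ⟨f, hf⟩
    obtain ⟨K, _, J, M, Q, m₀, j₀, hQ, ⟨eT⟩⟩ := hT.exists_reesMatrix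
    obtain ⟨hK, _, _⟩ := finite_of_isFGUnary_top hQ
      (isFGUnary_top_of_equiv eT hT.hasRelativeInverses hfg)
    obtain ⟨m, j, κ, σ, τ, -, -, hκ, -, -, hκi, -, -⟩ := exists_rebase_coordinates hQ
      ((e : S →ₙ* ReesMatrix P).comp (f.comp (eT.symm : ReesMatrix Q →ₙ* T)))
      (e.injective.comp (hf.comp eT.symm.injective))
    have hle : ∀ x ∈ Subgroup.closure (entrySet Q), κ x ∈ H := by
      intro x hx
      refine (Subgroup.closure_le (H.comap κ)).2 ?_ hx
      rintro _ ⟨l, i, rfl⟩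
      change κ (Q l i) ∈ H
      rw [hκ]
      exact IsGenericMatrix.rebase_mem hgen.mem _ _ _ _
    exact ⟨K, _, J, M, Q, m₀, j₀, hQ, ⟨hK, κ, hκi⟩, ⟨fg_closure_entrySet Q,
      (κ.comp (Subgroup.subtype _)).codRestrict H fun x => hle x x.2,
      fun x y hxy => Subtype.ext (hκi (congrArg Subtype.val hxy))⟩, ⟨eT⟩⟩
  · rintro ⟨K, _, J, M, Q, m₀, j₀, hQ, ⟨hK, f, hf⟩, ⟨hC, g, hg⟩, ⟨eT⟩⟩
    obtain ⟨-, _, _⟩ := finite_of_isFGUnary_top hQ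
      (isFGUnary_top_of_equiv eT hT.hasRelativeInverses hfg)
    -- by homogeneity of `G`, the group generated by the entries lands in `H`
    obtain ⟨θ, hθ⟩ := hG.exists_extend hC (H.subtype.comp g) (f.comp (Subgroup.subtype _))
      (H.subtype_injective.comp hg) (hf.comp (Subgroup.subtype_injective _))
    have hfH : ∀ m j, f (Q m j) ∈ H := fun m j => by
      have := hθ ⟨Q m j, Subgroup.subset_closure ⟨m, j, rfl⟩⟩
      change _ = f (Q m j) at this
      rw [← this]
      exact mem_of_characteristic hH θ (g _).2
    obtain ⟨σ, τ, hσ, hτ, hστ⟩ := hgen.exists_embedding (Q := fun m j => f (Q m j)) (m₀ := m₀)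
      (j₀ := j₀) ⟨fun j => by simp [hQ.1], fun m => by simp [hQ.2]⟩ hfH
    exact ⟨(e.symm : ReesMatrix P →ₙ* S).comp ((mapHom f σ τ hστ).comp (eT : T →ₙ* ReesMatrix Q)),
      e.symm.injective.comp ((mapHom_injective (h := hστ) hf hσ hτ).comp eT.injective)⟩

end Age

/-! ### Fraïssé limits are generic -/

section FraisseLimit

open ReesMatrix

theorem isNormalised_one {K J M : Type*} [Group K] (m₀ : M) (j₀ : J) :
    IsNormalised (fun _ _ => 1 : Matrix M J K) m₀ j₀ := ⟨fun _ => rfl, fun _ => rfl⟩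

variable {S G : Type u} [Semigroup S] [Group G] {H : Subgroup G}

/-- The Rees matrix semigroups of finite normalised matrices over a finitely generated subgroup
of `G`, with entries in `H`, belong to `CS(G; H)`. -/
theorem inCS_reesMatrix {K : Subgroup G} (hK : K.FG) {J M : Type u} [Finite J] [Finite M]
    {Q : Matrix M J K} {m₀ : M} {j₀ : J} (hQ : IsNormalised Q m₀ j₀)
    (hQH : ∀ m j, (Q m j : G) ∈ H) : InCS G H (ReesMatrix Q) := by
  have hK' := (Group.fg_iff_subgroup_fg K).2 hK
  have : Nonempty J := ⟨j₀⟩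
  have : Nonempty M := ⟨m₀⟩
  have hle : ∀ x ∈ Subgroup.closure (entrySet Q), (x : G) ∈ H := by
    intro x hx
    refine (Subgroup.closure_le (H.comap K.subtype)).2 ?_ hx
    rintro _ ⟨l, i, rfl⟩
    exact hQH l i
  exact ⟨isCompletelySimple Q, isFGUnary_top hQ hK', K, _, J, M, Q, m₀, j₀, hQ,
    ⟨hK', K.subtype, K.subtype_injective⟩, ⟨fg_closure_entrySet Q,
      (K.subtype.comp (Subgroup.subtype _)).codRestrict H fun x => hle x x.2,
      fun x y hxy => Subtype.ext (K.subtype_injective (congrArg Subtype.val hxy :))⟩,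
    ⟨MulEquiv.refl _⟩⟩

variable {I Λ : Type u} {P : Matrix Λ I G} {l₀ : Λ} {i₀ : I}

/-- The extension property of a homogeneous semigroup with age `CS(G; H)`: a partial embedding of a
finite matrix over `H` in its sandwich matrix extends to an embedding. -/
theorem exists_extend_of_inSemigroupAge (hP : IsNormalised P l₀ i₀)
    (hom : IsHomogeneousSemigroup (ReesMatrix P))
    (hage : ∀ (T : Type u) [Semigroup T], InCS G H T → InSemigroupAge T (ReesMatrix P))
    {J M : Type u} [Finite J] [Finite M] {Q : Matrix M J G} {m₀ : M} {j₀ : J}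
    (hQ : IsNormalised Q m₀ j₀) (hQH : ∀ m j, Q m j ∈ H) {J₀ : Set J} {M₀ : Set M}
    (hj : j₀ ∈ J₀) (hm : m₀ ∈ M₀) (σ₀ : J₀ → I) (τ₀ : M₀ → Λ) (hσ : Function.Injective σ₀)
    (hτ : Function.Injective τ₀) (hσ₀ : σ₀ ⟨j₀, hj⟩ = i₀) (hτ₀ : τ₀ ⟨m₀, hm⟩ = l₀)
    (hστ : ∀ (m : M₀) (j : J₀), Q m j = P (τ₀ m) (σ₀ j)) :
    ∃ (σ : J → I) (τ : M → Λ), Function.Injective σ ∧ Function.Injective τ ∧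
      (∀ j : J₀, σ j = σ₀ j) ∧ (∀ m : M₀, τ m = τ₀ m) ∧ ∀ m j, Q m j = P (τ m) (σ j) := by
  let K := Subgroup.closure (entrySet Q)
  let Q' : Matrix M J K := fun m j => ⟨Q m j, Subgroup.subset_closure ⟨m, j, rfl⟩⟩
  have hQ' : IsNormalised Q' m₀ j₀ :=
    ⟨fun j => Subtype.ext (hQ.1 j), fun m => Subtype.ext (hQ.2 m)⟩
  have hK : Group.FG K := fg_closure_entrySet Q
  obtain ⟨-, -, f, hf⟩ := hage _ (inCS_reesMatrix ((Group.fg_iff_subgroup_fg K).1 hK) hQ'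
    fun m j => hQH m j)
  let Q₀ : Matrix M₀ J₀ K := fun m j => Q' m j
  have hQ₀ : IsNormalised Q₀ ⟨m₀, hm⟩ ⟨j₀, hj⟩ := ⟨fun j => hQ'.1 j, fun m => hQ'.2 m⟩
  let ι : ReesMatrix Q₀ →ₙ* ReesMatrix Q' :=
    mapHom (MonoidHom.id K) Subtype.val Subtype.val fun _ _ => rfl
  have hι : Function.Injective ι :=
    mapHom_injective Function.injective_id Subtype.val_injective Subtype.val_injective
  let f₀ : ReesMatrix Q₀ →ₙ* ReesMatrix P := mapHom K.subtype σ₀ τ₀ hστ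
  have hf₀ : Function.Injective f₀ := mapHom_injective K.subtype_injective hσ hτ
  obtain ⟨ψ, hψ⟩ := hom.exists_comp_eq (hasRelativeInverses Q₀) (isFGUnary_top hQ₀ hK)
    (f.comp ι) f₀ (hf.comp hι) hf₀
  let F : ReesMatrix Q' →ₙ* ReesMatrix P := (ψ : _ →ₙ* _).comp f
  have hF : ∀ t, F (ι t) = f₀ t := hψ
  obtain ⟨κ, σ, τ, hc, hent, -, -⟩ := exists_coordinates hQ' hP F (by
    refine (hF ⟨⟨j₀, hj⟩, 1, ⟨m₀, hm⟩⟩).trans (ReesMatrix.ext hσ₀ rfl hτ₀))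
  obtain ⟨-, c2, c3⟩ := coordinates_injective m₀ j₀ hc (ψ.injective.comp hf)
  have key : ∀ t : ReesMatrix Q₀, (⟨σ t.left, κ t.elt, τ t.right⟩ : ReesMatrix P) =
      ⟨σ₀ t.left, t.elt, τ₀ t.right⟩ := fun t => (hc (ι t)).symm.trans (hF t)
  refine ⟨σ, τ, c2, c3, fun j => ?_, fun m => ?_, fun m j => ?_⟩
  · exact congrArg ReesMatrix.left (key ⟨j, 1, ⟨m₀, hm⟩⟩)
  · exact congrArg ReesMatrix.right (key ⟨⟨j₀, hj⟩, 1, m⟩)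
  · have h := congrArg ReesMatrix.elt (key ⟨⟨j₀, hj⟩, Q' m j, ⟨m₀, hm⟩⟩)
    exact h.symm.trans (hent m j)

theorem infinite_of_option {X : Type*} (f : Option X → X) (hf : Function.Injective f) :
    Infinite X := by
  by_contra h
  have := not_infinite_iff_finite.1 h
  have := Fintype.ofFinite X
  have h2 := Fintype.card_le_of_injective f hf
  rw [Fintype.card_option] at h2
  omega

/-- The sandwich matrix of a homogeneous semigroup with age `CS(G; H)` is generic. -/
theorem IsGenericMatrix.of_age (hG : IsHomogeneousGroup G) (hH : H.Characteristic)
    (hP : IsNormalised P l₀ i₀) (hom : IsHomogeneousSemigroup (ReesMatrix P))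
    (hage : ∀ (T : Type u) [Semigroup T], InSemigroupAge T (ReesMatrix P) ↔ InCS G H T) :
    IsGenericMatrix H P l₀ i₀ := by
  classical
  have hage' : ∀ (T : Type u) [Semigroup T], InCS G H T → InSemigroupAge T (ReesMatrix P) :=
    fun T _ => (hage T).2
  refine ⟨hP, fun l i => ?_, ?_, ?_, fun F α hα h0 => ?_, fun F α hα h0 => ?_⟩
  · let K := Subgroup.closure {P l i}
    have hK : Group.FG K := inferInstance
    have hent : ∀ m ∈ ({l₀, l} : Set Λ), ∀ j ∈ ({i₀, i} : Set I), P m j ∈ K := by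
      rintro m (rfl | rfl) j (rfl | rfl)
      · rw [hP.1]; exact one_mem _
      · rw [hP.1]; exact one_mem _
      · rw [hP.2]; exact one_mem _
      · exact Subgroup.subset_closure rfl
    let Q := blockMatrix P {i₀, i} K {l₀, l} hent
    have hQ : IsNormalised Q ⟨l₀, Or.inl rfl⟩ ⟨i₀, Or.inl rfl⟩ :=
      ⟨fun j => Subtype.ext (hP.1 j), fun m => Subtype.ext (hP.2 m)⟩
    have : Nonempty ({i₀, i} : Set I) := ⟨⟨i₀, Or.inl rfl⟩⟩
    have : Nonempty ({l₀, l} : Set Λ) := ⟨⟨l₀, Or.inl rfl⟩⟩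
    have hT : InSemigroupAge (ReesMatrix Q) (ReesMatrix P) :=
      ⟨isCompletelySimple Q, isFGUnary_top hQ hK,
        mapHom K.subtype Subtype.val Subtype.val fun _ _ => rfl,
        mapHom_injective K.subtype_injective Subtype.val_injective Subtype.val_injective⟩
    obtain ⟨-, -, K', _, J, M, Q', m₀, j₀, hQ', -, ⟨-, g, hg⟩, ⟨e⟩⟩ := (hage _).1 hT
    obtain ⟨m, j, κ, σ, τ, -, -, hκ, -, -, hκi, -, -⟩ := exists_rebase_coordinates hQ
      (e : ReesMatrix Q →ₙ* ReesMatrix Q') e.injective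
    let p : K := ⟨P l i, Subgroup.subset_closure rfl⟩
    have hp : κ p ∈ Subgroup.closure (entrySet Q') := by
      have := hκ ⟨l, Or.inr rfl⟩ ⟨i, Or.inr rfl⟩
      change κ p = _ at this
      rw [this]
      have hmem : ∀ a b, Q' a b ∈ Subgroup.closure (entrySet Q') := fun a b =>
        Subgroup.subset_closure ⟨a, b, rfl⟩
      exact mul_mem (mul_mem (mul_mem (inv_mem (hmem _ _)) (hmem _ _)) (inv_mem (hmem _ _)))
        (hmem _ _)
    have hle : ∀ x : K, κ x ∈ Subgroup.closure (entrySet Q') := by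
      rintro ⟨x, hx⟩
      obtain ⟨n, rfl⟩ := Subgroup.mem_closure_singleton.1 hx
      have : (⟨P l i ^ n, hx⟩ : K) = p ^ n := Subtype.ext rfl
      rw [this, map_zpow]
      exact zpow_mem hp n
    obtain ⟨θ, hθ⟩ := hG.exists_extend hK
      (H.subtype.comp (g.comp (κ.codRestrict _ hle))) K.subtype
      (H.subtype_injective.comp (hg.comp fun a b hab => hκi (congrArg Subtype.val hab)))
      K.subtype_injective
    have := hθ p
    change _ = P l i at this
    rw [← this]
    exact mem_of_characteristic hH θ (g _).2
  · by_contra hI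
    have := not_infinite_iff_finite.1 hI
    obtain ⟨σ, -, hσ, -⟩ := exists_extend_of_inSemigroupAge (H := H) hP hom hage'
      (isNormalised_one PUnit.unit (none : Option I)) (fun _ _ => one_mem H)
      (J₀ := {none}) (M₀ := Set.univ) rfl trivial (fun _ => i₀) (fun _ => l₀)
      (fun a b _ => Subsingleton.elim a b) (fun a b _ => Subsingleton.elim a b) rfl rfl
      (fun _ _ => (hP.1 _).symm)
    exact hI (infinite_of_option σ hσ)
  · by_contra hI
    have := not_infinite_iff_finite.1 hI
    obtain ⟨-, τ, -, hτ, -⟩ := exists_extend_of_inSemigroupAge (H := H) hP hom hage'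
      (isNormalised_one (none : Option Λ) PUnit.unit) (fun _ _ => one_mem H)
      (J₀ := Set.univ) (M₀ := {none}) trivial rfl (fun _ => i₀) (fun _ => l₀)
      (fun a b _ => Subsingleton.elim a b) (fun a b _ => Subsingleton.elim a b) rfl rfl
      (fun _ _ => (hP.1 _).symm)
    exact hI (infinite_of_option τ hτ)
  · let Q : Matrix ↥(insert l₀ F) (Option PUnit.{u + 1}) G := fun l j => j.elim 1 fun _ => α l
    obtain ⟨σ, τ, -, -, -, hτ, hστ⟩ := exists_extend_of_inSemigroupAge (H := H) (Q := Q)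
      (m₀ := ⟨l₀, Finset.mem_insert_self _ _⟩) (j₀ := none) hP hom hage'
      ⟨by rintro (_ | _); exacts [rfl, h0], fun _ => rfl⟩ (by
        rintro ⟨l, hl⟩ (_ | _)
        · exact one_mem H
        · rcases Finset.mem_insert.1 hl with hl | hl
          · change α l ∈ H
            rw [hl, h0]
            exact one_mem H
          · exact hα l hl)
      (J₀ := {none}) (M₀ := Set.univ) rfl trivial (fun _ => i₀) (fun l => l.1)
      (fun a b _ => Subsingleton.elim a b)
      (fun a b hab => Subtype.ext (Subtype.ext hab)) rfl rfl
      (by rintro l ⟨_, rfl⟩; exact (hP.2 _).symm)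
    refine ⟨σ (some PUnit.unit), fun l hl => ?_⟩
    have h1 := hστ ⟨l, Finset.mem_insert_of_mem hl⟩ (some PUnit.unit)
    rw [hτ ⟨_, trivial⟩] at h1
    exact h1.symm
  · let Q : Matrix (Option PUnit.{u + 1}) ↥(insert i₀ F) G := fun m i => m.elim 1 fun _ => α i
    obtain ⟨σ, τ, -, -, hσ, -, hστ⟩ := exists_extend_of_inSemigroupAge (H := H) (Q := Q)
      (j₀ := ⟨i₀, Finset.mem_insert_self _ _⟩) (m₀ := none) hP hom hage'
      ⟨fun _ => rfl, by rintro (_ | _); exacts [rfl, h0]⟩ (by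
        rintro (_ | _) ⟨i, hi⟩
        · exact one_mem H
        · rcases Finset.mem_insert.1 hi with hi | hi
          · change α i ∈ H
            rw [hi, h0]
            exact one_mem H
          · exact hα i hi)
      (J₀ := Set.univ) (M₀ := {none}) trivial rfl (fun i => i.1) (fun _ => l₀)
      (fun a b hab => Subtype.ext (Subtype.ext hab))
      (fun a b _ => Subsingleton.elim a b) rfl rfl
      (by rintro ⟨_, rfl⟩ i; exact (hP.1 _).symm)
    refine ⟨τ (some PUnit.unit), fun i hi => ?_⟩
    have h1 := hστ (some PUnit.unit) ⟨i, Finset.mem_insert_of_mem hi⟩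
    rw [hσ ⟨_, trivial⟩] at h1
    exact h1.symm

theorem IsGenericMatrix.isReesGeneric [Countable I] [Countable Λ] (h : IsGenericMatrix H P l₀ i₀)
    (e : S ≃* ReesMatrix P) : IsReesGeneric S G H := by
  classical
  have := h.infinite_columns
  have := h.infinite_rows
  have hne : ∀ (X : Type u) [Infinite X] (x : X), Infinite {y : X // y ≠ x} := fun X _ x =>
    (Set.finite_singleton x).infinite_compl.to_subtype
  have := hne I i₀
  have := hne Λ l₀
  have hext : ∀ {X : Type u} {x : X} {s : Finset {y : X // y ≠ x}} (α : s → (H : Set G)),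
      ∃ β : X → G, (∀ y ∈ s.map (Function.Embedding.subtype _), β y ∈ H) ∧ β x = 1 ∧
        ∀ y : s, β y.1.1 = α y := by
    intro X x s α
    have hinj : Function.Injective fun y : s => y.1.1 := fun x y hxy =>
      Subtype.ext (Subtype.ext hxy)
    have hval := hinj.extend_apply (fun y => (α y : G)) 1
    refine ⟨Function.extend (fun y : s => y.1.1) (fun y => (α y : G)) 1, ?_, ?_, hval⟩
    · intro l hl
      obtain ⟨y, hy, rfl⟩ := Finset.mem_map.1 hl
      have := hval ⟨y, hy⟩
      simp only at this
      rw [Function.Embedding.subtype_apply, this]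
      exact (α ⟨y, hy⟩).2
    · exact Function.extend_apply' _ _ _ fun ⟨y, hy⟩ => y.1.2 hy
  refine ⟨I, Λ, P, l₀, i₀, h.norm, ⟨e⟩, ?_, fun l i => h.mem l i, Cardinal.mk_eq_aleph0 _,
    Cardinal.mk_eq_aleph0 _, fun s α => ?_, fun s α => ?_⟩
  · apply Set.Subset.antisymm
    · rintro _ ⟨l, i, rfl⟩
      exact h.mem l i
    · intro g hg
      obtain ⟨l, hl⟩ := exists_ne l₀
      obtain ⟨k, hk⟩ := h.column {l} (Function.update 1 l g)
        (fun m hm => by rwa [Finset.mem_singleton.1 hm, Function.update_self])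
        (by rw [Function.update_of_ne hl.symm]; rfl)
      exact ⟨l, k, by rw [hk l (Finset.mem_singleton_self l), Function.update_self]⟩
  · obtain ⟨β, hβ, hβ0, hβα⟩ := hext α
    obtain ⟨k, hk, hkβ⟩ := h.column_notMem {i₀} _ β hβ hβ0
    exact ⟨⟨k, by simpa using hk⟩, fun y =>
      (hkβ _ (Finset.mem_map_of_mem (Function.Embedding.subtype _) y.2)).trans (hβα y)⟩
  · obtain ⟨β, hβ, hβ0, hβα⟩ := hext α
    obtain ⟨k, hk, hkβ⟩ := h.row_notMem {l₀} _ β hβ hβ0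
    exact ⟨⟨k, by simpa using hk⟩, fun y =>
      (hkβ _ (Finset.mem_map_of_mem (Function.Embedding.subtype _) y.2)).trans (hβα y)⟩

/-- The structure group of a Fraïssé limit of `CS(G; H)` is isomorphic to `G`. -/
theorem IsFraisseLimitCS.nonempty_group_equiv [Countable G] (hG : IsHomogeneousGroup G)
    (h : IsFraisseLimitCS S G H) {K : Type u} [Group K] {P : Matrix Λ I K}
    (hP : IsNormalised P l₀ i₀) (e : S ≃* ReesMatrix P) : Nonempty (K ≃* G) := by
  obtain ⟨hcount, hcs, hom, hage⟩ := h
  have : Countable (ReesMatrix P) := e.symm.injective.countable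
  obtain ⟨_, -, -⟩ := countable_index (P := P) l₀ i₀
  refine ((hom.of_equiv hcs.hasRelativeInverses e).group hP).1.nonempty_mulEquiv hG ?_ ?_
  · intro A hA
    let Q : Matrix PUnit.{u + 1} PUnit.{u + 1} A := fun _ _ => 1
    have hQ : IsNormalised Q PUnit.unit PUnit.unit := isNormalised_one _ _
    have hT : InSemigroupAge (ReesMatrix Q) S := by
      refine ⟨isCompletelySimple Q, isFGUnary_top hQ ((Group.fg_iff_subgroup_fg A).2 hA),
        (e.symm : ReesMatrix P →ₙ* S).comp (mapHom A.subtype (fun _ => i₀) (fun _ => l₀) ?_),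
        e.symm.injective.comp (mapHom_injective A.subtype_injective ?_ ?_)⟩
      · exact fun _ _ => (hP.1 _).symm
      all_goals exact fun _ _ _ => rfl
    obtain ⟨-, -, K', _, J, M, Q', m₀, j₀, -, ⟨-, f, hf⟩, -, ⟨e'⟩⟩ := (hage _).1 hT
    obtain ⟨-, -, κ, -, -, -, -, -, -, -, hκ, -, -⟩ := exists_rebase_coordinates hQ
      (e' : ReesMatrix Q →ₙ* ReesMatrix Q') e'.injective
    exact ⟨f.comp κ, hf.comp hκ⟩
  · intro A hA
    let Q : Matrix PUnit.{u + 1} PUnit.{u + 1} A := fun _ _ => 1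
    have hQ : IsNormalised Q PUnit.unit PUnit.unit := isNormalised_one _ _
    obtain ⟨-, -, f, hf⟩ := (hage _).2 (inCS_reesMatrix (H := H) hA hQ fun _ _ => one_mem H)
    obtain ⟨-, -, κ, -, -, -, -, -, -, -, hκ, -, -⟩ := exists_rebase_coordinates hQ
      ((e : S →ₙ* ReesMatrix P).comp f) (e.injective.comp hf)
    exact ⟨κ, hκ⟩

theorem inSemigroupAge_congr {S' : Type*} [Semigroup S'] (e : S ≃* S') (T : Type*)
    [Semigroup T] : InSemigroupAge T S ↔ InSemigroupAge T S' :=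
  and_congr_right fun _ => and_congr_right fun _ =>
    ⟨fun ⟨f, hf⟩ => ⟨(e : S →ₙ* S').comp f, e.injective.comp hf⟩,
      fun ⟨f, hf⟩ => ⟨(e.symm : S' →ₙ* S).comp f, e.symm.injective.comp hf⟩⟩

theorem IsFraisseLimitCS.isReesGeneric [Countable G] (hG : IsHomogeneousGroup G)
    (hH : H.Characteristic) (h : IsFraisseLimitCS S G H) : IsReesGeneric S G H := by
  obtain ⟨K, _, I, Λ, P, l₀, i₀, hP, ⟨e⟩⟩ := h.2.1.exists_reesMatrix
  obtain ⟨θ⟩ := h.nonempty_group_equiv hG hP e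
  obtain ⟨hcount, hcs, hom, hage⟩ := h
  have : Countable (ReesMatrix P) := e.symm.injective.countable
  obtain ⟨-, _, _⟩ := countable_index (P := P) l₀ i₀
  let P' : Matrix Λ I G := fun l i => θ (P l i)
  let e' : S ≃* ReesMatrix P' :=
    e.trans (mapEquiv θ (Equiv.refl I) (Equiv.refl Λ) fun _ _ => rfl)
  have hP' : IsNormalised P' l₀ i₀ :=
    ⟨fun i => by simp [P', hP.1], fun l => by simp [P', hP.2]⟩
  exact (IsGenericMatrix.of_age hG hH hP' (hom.of_equiv hcs.hasRelativeInverses e')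
    fun T _ => (inSemigroupAge_congr e' T).symm.trans (hage T)).isReesGeneric e'

end FraisseLimit

theorem theorem5p13 (S : Type u) [Semigroup S] [Countable S] (hS : IsCompletelySimple S) :
    (IsHomogeneousSemigroup S ↔
      ∃ (G : Type u) (_ : Group G) (H : Subgroup G),
        Countable G ∧ IsHomogeneousGroup G ∧ H.Characteristic ∧
        (IsRectangularGroupOver S G ∨ IsReesTypeTwo S G H ∨ IsReesTypeThree S G H ∨
          IsReesTypeFour S G H ∨ IsReesGeneric S G H)) ∧
    (∀ (G : Type u) [Group G] [Countable G] (H : Subgroup G),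
      IsHomogeneousGroup G → H.Characteristic →
        (IsFraisseLimitCS S G H ↔ IsReesGeneric S G H)) := by
  refine ⟨⟨fun hom => hom.exists_type hS, ?_⟩, fun G _ _ H hG hH => ⟨fun h =>
    h.isReesGeneric hG hH, fun h => ⟨inferInstance, hS, h.isHomogeneousSemigroup hG hH,
      fun T _ => h.inSemigroupAge_iff hG hH T⟩⟩⟩
  rintro ⟨G, _, H, -, hG, hH, h | h | h | h | h⟩
  · exact h.isHomogeneousSemigroup hG
  · exact h.isHomogeneousSemigroup hG hH
  · exact h.isHomogeneousSemigroup hG hH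
  · exact h.isHomogeneousSemigroup hG hH
  · exact h.isHomogeneousSemigroup hG hH
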